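/- **Diversity-aware $k$-median.** An instance $I$ consists of a finite metric space $(U,d)$, a set $C\subseteq U$ of clients, a set $F\subseteq U$ of facilities, groups $G_1,\dots,G_t\subseteq F$ (which may overlap), requirements $r[1],\dots,r[t]\in\mathbb Z_{\ge 0}$ and a budget $1\le k\le |F|$. A feasible solution is a set $S\subseteq F$ with $|S|=k$ and $|S\cap G_i|\ge r[i]$ for all $i\in\{1,\dots,t\}$; its cost is $\mathrm{cost}(S)=\sum_{c\in C}\min_{s\in S}d(c,s)$, to be minimized. **Machine model.** A randomized algorithm is a finite program for a unit-cost random access machine with natural-number memory (addition, truncated subtraction, comparison), real-number memory (addition, subtraction, multiplication, comparison, embedding of natural numbers; no conversion of reals to integers), fair coin flips, and random access to the entries of the input (the distances, the memberships in $C$, $F$ and $G_1,\dots,G_t$, the requirements, $|U|$, $t$ and $k$), the points of $U$ being numbered in an arbitrary way. **Lemma.** For every $\epsilon>0$ there is a randomized $(3+\epsilon)$-approximation algorithm for diversity-aware $k$-median that runs in time $f(k,t,\epsilon)\cdot\mathrm{poly}(|U|)$, where $$f(k,t,\epsilon)=O\Bigl(\bigl(2^t\,\max\{1,\epsilon^{-2}\}\,k^2\log(k+1)\bigr)^k\Bigr).$$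 That is, there are a real constant $A$ and a natural number $B$ such that for every $\epsilon>0$ there is a program with the following two properties for every instance $I$ and every numbering of its points. (1) Whatever the coin flips, the program halts on $I$ after at most $A\cdot\bigl(2^t\max\{1,\epsilon^{-2}\}\,k^2\ln(k+1)\bigr)^k\cdot|U|^{B}$ steps. (2) If $I$ has a feasible solution, then with probability at least $2/3$ the program outputs a feasible solution $S$ such that $\mathrm{cost}(S)\le(3+\epsilon)\,\mathrm{cost}(S')$ for every feasible solution $S'$. -/

import Mathlib

noncomputable section

/-! ### Diversity-aware `k`-median -/

/-- An instance of diversity-aware `k`-median with `t` groups over the finite metric space `U`. -/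
structure DivKMed (U : Type*) [DecidableEq U] (t : ℕ) where
  clients : Finset U
  facilities : Finset U
  /-- the groups `G₁, …, G_t`; they may overlap -/
  group : Fin t → Finset U
  group_subset : ∀ i, group i ⊆ facilities
  /-- the requirement vector -/
  req : Fin t → ℕ
  /-- the budget `k` -/
  k : ℕ
  k_pos : 1 ≤ k
  k_le : k ≤ facilities.card

namespace DivKMed

variable {U : Type*} [DecidableEq U] {t : ℕ}

/-- `S` is a solution: `k` facilities, with at least `req i` of them in the group `i`. -/
def Feasible (I : DivKMed U t) (S : Finset U) : Prop :=
  S ⊆ I.facilities ∧ S.card = I.k ∧ ∀ i, I.req i ≤ (S ∩ I.group i).card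

/-- The clustering cost `∑ c ∈ C, d(c, S)`. For nonempty finite `S`, `Metric.infDist c S` is
the distance from `c` to its closest point of `S`. -/
def cost [MetricSpace U] (I : DivKMed U t) (S : Finset U) : ℝ :=
  ∑ c ∈ I.clients, Metric.infDist c (S : Set U)

/-- `S` is a solution whose cost is at most `α` times the cost of every solution. -/
def IsApprox [MetricSpace U] (I : DivKMed U t) (α : ℝ) (S : Finset U) : Prop :=
  I.Feasible S ∧ ∀ S', I.Feasible S' → I.cost S ≤ α * I.cost S'

end DivKMed

/-! ### Randomized real RAM

A program is a finite piece of code in a structured imperative language. Its memory consists of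
arrays of natural numbers and arrays of real numbers (a program names finitely many arrays, each
of them is unbounded), all cells being initially zero. Cells are addressed by computed indices.
Natural numbers can be added, subtracted (with truncation at `0`) and compared; real numbers can be
added, subtracted, multiplied and compared; there is no conversion from reals to natural numbers
and there are no real constants besides the natural numbers. The input can be read at random, entry
by entry, through points numbered `0, …, |U| - 1` and groups numbered `0, …, t - 1`. Every
operation, every memory or input access, every test and every coin flip costs one unit of time. -/

/-- The read-only input of a machine. -/
structure RamInput where
  numPoints : ℕ
  numGroups : ℕ
  budget : ℕ
  /-- `1` if the point is a client, `0` if not -/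
  isClient : ℕ → ℕ
  /-- `1` if the point is a facility, `0` if not -/
  isFacility : ℕ → ℕ
  /-- `1` if the first argument (a point) belongs to the second (a group), `0` if not -/
  inGroup : ℕ → ℕ → ℕ
  req : ℕ → ℕ
  dist : ℕ → ℕ → ℝ

/-- An instance as input, its points being numbered by `label`. Entries with an index out of range
are `0`. -/
def DivKMed.toInput {U : Type*} [DecidableEq U] [Fintype U] [MetricSpace U] {t : ℕ}
    (I : DivKMed U t) (label : U ≃ Fin (Fintype.card U)) : RamInput where
  numPoints := Fintype.card U
  numGroups := t
  budget := I.k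
  isClient x := if h : x < Fintype.card U then
    (if label.symm ⟨x, h⟩ ∈ I.clients then 1 else 0) else 0
  isFacility x := if h : x < Fintype.card U then
    (if label.symm ⟨x, h⟩ ∈ I.facilities then 1 else 0) else 0
  inGroup x i := if h : x < Fintype.card U ∧ i < t then
    (if label.symm ⟨x, h.1⟩ ∈ I.group ⟨i, h.2⟩ then 1 else 0) else 0
  req i := if h : i < t then I.req ⟨i, h⟩ else 0
  dist x y := if h : x < Fintype.card U ∧ y < Fintype.card U then
    dist (label.symm ⟨x, h.1⟩) (label.symm ⟨y, h.2⟩) else 0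

/-- The state of a machine: the memory and the number of coins flipped so far. -/
structure RamState where
  /-- `nat a i` is the cell `i` of the array `a` of natural numbers -/
  nat : ℕ → ℕ → ℕ
  /-- `real a i` is the cell `i` of the array `a` of real numbers -/
  real : ℕ → ℕ → ℝ
  coinsUsed : ℕ

/-- The initial state. -/
def RamState.init : RamState := ⟨fun _ _ => 0, fun _ _ => 0, 0⟩

/-- Write `v` in the cell `i` of the array `a` of natural numbers. -/
def RamState.writeNat (s : RamState) (a i v : ℕ) : RamState :=
  ⟨Function.update s.nat a (Function.update (s.nat a) i v), s.real, s.coinsUsed⟩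

/-- Write `v` in the cell `i` of the array `a` of real numbers. -/
def RamState.writeReal (s : RamState) (a i : ℕ) (v : ℝ) : RamState :=
  ⟨s.nat, Function.update s.real a (Function.update (s.real a) i v), s.coinsUsed⟩

/-- Record that one more coin has been flipped. -/
def RamState.useCoin (s : RamState) : RamState := ⟨s.nat, s.real, s.coinsUsed + 1⟩

/-- Natural-number expressions. -/
inductive NatExpr
  | const (n : ℕ)
  | load (a : ℕ) (i : NatExpr)
  | add (e f : NatExpr)
  | sub (e f : NatExpr)
  | numPoints
  | numGroups
  | budget
  | isClient (x : NatExpr)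
  | isFacility (x : NatExpr)
  | inGroup (x i : NatExpr)
  | req (i : NatExpr)

namespace NatExpr

/-- The value of an expression. -/
def eval (inp : RamInput) (s : RamState) : NatExpr → ℕ
  | const n => n
  | load a i => s.nat a (i.eval inp s)
  | add e f => e.eval inp s + f.eval inp s
  | sub e f => e.eval inp s - f.eval inp s
  | numPoints => inp.numPoints
  | numGroups => inp.numGroups
  | budget => inp.budget
  | isClient x => inp.isClient (x.eval inp s)
  | isFacility x => inp.isFacility (x.eval inp s)
  | inGroup x i => inp.inGroup (x.eval inp s) (i.eval inp s)
  | req i => inp.req (i.eval inp s)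

/-- The time to evaluate an expression: its number of nodes. -/
def time : NatExpr → ℕ
  | const _ => 1
  | load _ i => i.time + 1
  | add e f => e.time + f.time + 1
  | sub e f => e.time + f.time + 1
  | numPoints => 1
  | numGroups => 1
  | budget => 1
  | isClient x => x.time + 1
  | isFacility x => x.time + 1
  | inGroup x i => x.time + i.time + 1
  | req i => i.time + 1

end NatExpr

/-- Real-number expressions. -/
inductive RealExpr
  | ofNat (e : NatExpr)
  | load (a : ℕ) (i : NatExpr)
  | dist (x y : NatExpr)
  | add (e f : RealExpr)
  | sub (e f : RealExpr)
  | mul (e f : RealExpr)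

namespace RealExpr

/-- The value of an expression. -/
def eval (inp : RamInput) (s : RamState) : RealExpr → ℝ
  | ofNat e => (e.eval inp s : ℝ)
  | load a i => s.real a (i.eval inp s)
  | dist x y => inp.dist (x.eval inp s) (y.eval inp s)
  | add e f => e.eval inp s + f.eval inp s
  | sub e f => e.eval inp s - f.eval inp s
  | mul e f => e.eval inp s * f.eval inp s

/-- The time to evaluate an expression: its number of nodes. -/
def time : RealExpr → ℕ
  | ofNat e => e.time + 1
  | load _ i => i.time + 1
  | dist x y => x.time + y.time + 1
  | add e f => e.time + f.time + 1
  | sub e f => e.time + f.time + 1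
  | mul e f => e.time + f.time + 1

end RealExpr

/-- Comparisons. -/
inductive RamTest
  | natLe (e f : NatExpr)
  | realLe (e f : RealExpr)

namespace RamTest

/-- The truth of a comparison. -/
def Holds (inp : RamInput) (s : RamState) : RamTest → Prop
  | natLe e f => e.eval inp s ≤ f.eval inp s
  | realLe e f => e.eval inp s ≤ f.eval inp s

/-- The time to evaluate a comparison. -/
def time : RamTest → ℕ
  | natLe e f => e.time + f.time + 1
  | realLe e f => e.time + f.time + 1

end RamTest

/-- Programs. -/
inductive RamProg
  | skip
  /-- store `e` in the cell `i` of the array `a` of natural numbers -/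
  | setNat (a : ℕ) (i e : NatExpr)
  /-- store `e` in the cell `i` of the array `a` of real numbers -/
  | setReal (a : ℕ) (i : NatExpr) (e : RealExpr)
  /-- store a fresh random bit in the cell `i` of the array `a` of natural numbers -/
  | flip (a : ℕ) (i : NatExpr)
  | seq (p q : RamProg)
  | ite (b : RamTest) (p q : RamProg)
  /-- repeat `p` as long as `b` holds -/
  | loop (b : RamTest) (p : RamProg)

/-- `RamExec inp coins p s n s'`: on the input `inp` and with the coin flips `coins`, the program
`p` started in the state `s` halts after `n` units of time in the state `s'`. -/
inductive RamExec (inp : RamInput) (coins : ℕ → Bool) :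
    RamProg → RamState → ℕ → RamState → Prop
  | skip (s : RamState) : RamExec inp coins .skip s 1 s
  | setNat (s : RamState) (a : ℕ) (i e : NatExpr) :
      RamExec inp coins (.setNat a i e) s (i.time + e.time + 1)
        (s.writeNat a (i.eval inp s) (e.eval inp s))
  | setReal (s : RamState) (a : ℕ) (i : NatExpr) (e : RealExpr) :
      RamExec inp coins (.setReal a i e) s (i.time + e.time + 1)
        (s.writeReal a (i.eval inp s) (e.eval inp s))
  | flip (s : RamState) (a : ℕ) (i : NatExpr) :
      RamExec inp coins (.flip a i) s (i.time + 1)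
        (s.writeNat a (i.eval inp s) (coins s.coinsUsed).toNat).useCoin
  | seq {p q : RamProg} {s s' s'' : RamState} {m n : ℕ} :
      RamExec inp coins p s m s' → RamExec inp coins q s' n s'' →
      RamExec inp coins (.seq p q) s (m + n) s''
  | ite_true {b : RamTest} {p q : RamProg} {s s' : RamState} {n : ℕ} :
      b.Holds inp s → RamExec inp coins p s n s' →
      RamExec inp coins (.ite b p q) s (b.time + n) s'
  | ite_false {b : RamTest} {p q : RamProg} {s s' : RamState} {n : ℕ} :
      ¬ b.Holds inp s → RamExec inp coins q s n s' →
      RamExec inp coins (.ite b p q) s (b.time + n) s'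
  | loop_true {b : RamTest} {p : RamProg} {s s' s'' : RamState} {m n : ℕ} :
      b.Holds inp s → RamExec inp coins p s m s' → RamExec inp coins (.loop b p) s' n s'' →
      RamExec inp coins (.loop b p) s (b.time + m + n) s''
  | loop_false {b : RamTest} {p : RamProg} {s : RamState} :
      ¬ b.Holds inp s → RamExec inp coins (.loop b p) s b.time s

/-- Whatever the coin flips, `p` halts on the input `inp` within time `T`. -/
def RunsInTime (p : RamProg) (inp : RamInput) (T : ℝ) : Prop :=
  ∀ coins : ℕ → Bool, ∃ (n : ℕ) (s : RamState),
    RamExec inp coins p RamState.init n s ∧ (n : ℝ) ≤ T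

/-- The law of an infinite sequence of independent fair coin flips. -/
def coinMeasure : MeasureTheory.Measure (ℕ → Bool) :=
  MeasureTheory.Measure.infinitePi fun _ => (PMF.uniformOfFintype Bool).toMeasure

/-- The set of points that a final state puts out: those whose cell in the array `0` of natural
numbers holds `1`. -/
def outputSet {U : Type*} [Fintype U] (label : U ≃ Fin (Fintype.card U)) (s : RamState) :
    Finset U :=
  Finset.univ.filter fun x => s.nat 0 (label x) = 1

/-- The probability that `p`, on the instance `I` with points numbered by `label`, puts out an
`α`-approximate solution. -/
def successProb {U : Type*} [DecidableEq U] [Fintype U] [MetricSpace U] {t : ℕ} (p : RamProg)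
    (I : DivKMed U t) (label : U ≃ Fin (Fintype.card U)) (α : ℝ) : ENNReal :=
  coinMeasure {coins | ∃ (n : ℕ) (s : RamState),
    RamExec (I.toInput label) coins p RamState.init n s ∧ I.IsApprox α (outputSet label s)}

end

/-! ### Reasoning about programs -/

namespace RamState

@[simp] theorem writeNat_nat (s : RamState) (a i v b j : ℕ) :
    (s.writeNat a i v).nat b j = if b = a ∧ j = i then v else s.nat b j := by
  unfold writeNat
  by_cases h : b = a
  · subst h
    simp [Function.update_apply]
  · simp [h]

@[simp] theorem writeNat_real (s : RamState) (a i v : ℕ) : (s.writeNat a i v).real = s.real := rfl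

@[simp] theorem writeReal_nat (s : RamState) (a i : ℕ) (v : ℝ) :
    (s.writeReal a i v).nat = s.nat := rfl

@[simp] theorem writeReal_real (s : RamState) (a i : ℕ) (v : ℝ) (b j : ℕ) :
    (s.writeReal a i v).real b j = if b = a ∧ j = i then v else s.real b j := by
  unfold writeReal
  by_cases h : b = a
  · subst h
    simp [Function.update_apply]
  · simp [h]

end RamState

namespace RamProg

/-- Whether some instruction of the program writes to an array of number `a`. -/
def mods (a : ℕ) : RamProg → Bool
  | skip => false
  | setNat b _ _ => b == a
  | setReal b _ _ => b == a
  | flip b _ => b == a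
  | seq p q => p.mods a || q.mods a
  | ite _ p q => p.mods a || q.mods a
  | loop _ p => p.mods a

end RamProg

/-- The arrays that the program `p` does not write to are the same in `s` and `s'`. -/
def Frame (p : RamProg) (s s' : RamState) : Prop :=
  ∀ a, p.mods a = false → s'.nat a = s.nat a ∧ s'.real a = s.real a

namespace Frame

variable {p q : RamProg} {s s' s'' : RamState}

theorem refl (p : RamProg) (s : RamState) : Frame p s s := fun _ _ => ⟨rfl, rfl⟩

theorem trans (h : Frame p s s') (h' : Frame p s' s'') : Frame p s s'' := fun a ha =>
  ⟨((h' a ha).1).trans (h a ha).1, ((h' a ha).2).trans (h a ha).2⟩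

theorem mono (h : Frame p s s') (hpq : ∀ a, q.mods a = false → p.mods a = false) :
    Frame q s s' := fun a ha => h a (hpq a ha)

theorem nat (h : Frame p s s') {a : ℕ} (ha : p.mods a = false) (i : ℕ) :
    s'.nat a i = s.nat a i := by rw [(h a ha).1]

theorem real (h : Frame p s s') {a : ℕ} (ha : p.mods a = false) (i : ℕ) :
    s'.real a i = s.real a i := by rw [(h a ha).2]

end Frame

theorem RamState.writeNat_frame (s : RamState) (a i v : ℕ) {b : ℕ} (h : b ≠ a) :
    (s.writeNat a i v).nat b = s.nat b := by
  ext j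
  simp [h]

theorem RamState.writeReal_frame (s : RamState) (a i : ℕ) (v : ℝ) {b : ℕ} (h : b ≠ a) :
    (s.writeReal a i v).real b = s.real b := by
  ext j
  simp [h]

theorem RamExec.frame {inp : RamInput} {coins : ℕ → Bool} {p : RamProg} {s s' : RamState} {m : ℕ}
    (h : RamExec inp coins p s m s') : Frame p s s' := by
  induction h with
  | skip s => exact Frame.refl _ _
  | setNat s a i e =>
    intro b hb
    have hb : b ≠ a := by
      rintro rfl
      simp [RamProg.mods] at hb
    exact ⟨s.writeNat_frame a _ _ hb, rfl⟩
  | setReal s a i e =>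
    intro b hb
    have hb : b ≠ a := by
      rintro rfl
      simp [RamProg.mods] at hb
    exact ⟨rfl, s.writeReal_frame a _ _ hb⟩
  | flip s a i =>
    intro b hb
    have hb : b ≠ a := by
      rintro rfl
      simp [RamProg.mods] at hb
    exact ⟨s.writeNat_frame a _ _ hb, rfl⟩
  | seq _ _ h₁ h₂ =>
    exact (h₁.mono fun a ha => by simp_all [RamProg.mods]).trans
      (h₂.mono fun a ha => by simp_all [RamProg.mods])
  | ite_true _ _ h => exact h.mono fun a ha => by simp_all [RamProg.mods]
  | ite_false _ _ h => exact h.mono fun a ha => by simp_all [RamProg.mods]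
  | loop_true _ _ _ h₁ h₂ => exact Frame.trans (h₁.mono fun a ha => by simp_all [RamProg.mods]) h₂
  | loop_false _ => exact Frame.refl _ _

/-- Started in the state `s`, the program `p` halts within time `T` in a state with `Q`. -/
def Runs (inp : RamInput) (coins : ℕ → Bool) (p : RamProg) (s : RamState) (T : ℕ)
    (Q : RamState → Prop) : Prop :=
  ∃ m s', RamExec inp coins p s m s' ∧ m ≤ T ∧ Q s'

namespace Runs

variable {inp : RamInput} {coins : ℕ → Bool} {p q : RamProg} {s : RamState} {T T₁ T₂ : ℕ}
  {Q Q₁ Q₂ : RamState → Prop}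

theorem mono (h : Runs inp coins p s T₁ Q) (hT : T₁ ≤ T) : Runs inp coins p s T Q := by
  obtain ⟨m, s', h₁, h₂, h₃⟩ := h
  exact ⟨m, s', h₁, h₂.trans hT, h₃⟩

theorem post (h : Runs inp coins p s T Q₁) (hQ : ∀ s', Frame p s s' → Q₁ s' → Q s') :
    Runs inp coins p s T Q := by
  obtain ⟨m, s', h₁, h₂, h₃⟩ := h
  exact ⟨m, s', h₁, h₂, hQ s' h₁.frame h₃⟩

theorem skip (h : Q s) : Runs inp coins .skip s 1 Q := ⟨_, _, .skip s, le_rfl, h⟩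

theorem setNat {a : ℕ} {i e : NatExpr} (h : Q (s.writeNat a (i.eval inp s) (e.eval inp s))) :
    Runs inp coins (.setNat a i e) s (i.time + e.time + 1) Q :=
  ⟨_, _, .setNat s a i e, le_rfl, h⟩

theorem setReal {a : ℕ} {i : NatExpr} {e : RealExpr}
    (h : Q (s.writeReal a (i.eval inp s) (e.eval inp s))) :
    Runs inp coins (.setReal a i e) s (i.time + e.time + 1) Q :=
  ⟨_, _, .setReal s a i e, le_rfl, h⟩

theorem seq (hp : Runs inp coins p s T₁ Q₁)
    (hq : ∀ s', Frame p s s' → Q₁ s' → Runs inp coins q s' T₂ Q) :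
    Runs inp coins (.seq p q) s (T₁ + T₂) Q := by
  obtain ⟨m, s', h₁, h₂, h₃⟩ := hp
  obtain ⟨m', s'', h₁', h₂', h₃'⟩ := hq s' h₁.frame h₃
  exact ⟨_, s'', .seq h₁ h₁', by omega, h₃'⟩

theorem ite {b : RamTest} (hp : b.Holds inp s → Runs inp coins p s T₁ Q)
    (hq : ¬ b.Holds inp s → Runs inp coins q s T₂ Q) :
    Runs inp coins (.ite b p q) s (b.time + max T₁ T₂) Q := by
  by_cases hb : b.Holds inp s
  · obtain ⟨m, s', h₁, h₂, h₃⟩ := hp hb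
    exact ⟨_, s', .ite_true hb h₁, by have := le_max_left T₁ T₂; omega, h₃⟩
  · obtain ⟨m, s', h₁, h₂, h₃⟩ := hq hb
    exact ⟨_, s', .ite_false hb h₁, by have := le_max_right T₁ T₂; omega, h₃⟩

end Runs

namespace RamProg

/-- A variable is the cell `0` of an array. -/
abbrev _root_.NatExpr.var (v : ℕ) : NatExpr := .load v (.const 0)

/-- Set a variable. -/
abbrev setVar (v : ℕ) (e : NatExpr) : RamProg := .setNat v (.const 0) e

/-- Do `body` for the values `0, …, e - 1` of the variable `v`. -/
def forLoop (v : ℕ) (e : NatExpr) (body : RamProg) : RamProg :=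
  .seq (setVar v (.const 0))
    (.loop (.natLe (.add (.var v) (.const 1)) e)
      (.seq body (setVar v (.add (.var v) (.const 1)))))

end RamProg

open RamProg

theorem Runs.forLoop {inp : RamInput} {coins : ℕ → Bool} {s : RamState} {v : ℕ} {e : NatExpr}
    {body : RamProg} {T : ℕ} (N : ℕ) (P : ℕ → RamState → Prop)
    (hN : ∀ s', Frame (forLoop v e body) s s' → e.eval inp s' = N)
    (hv : body.mods v = false)
    (h0 : P 0 (s.writeNat v 0 0))
    (hstep : ∀ j < N, ∀ s', Frame (forLoop v e body) s s' → s'.nat v 0 = j → P j s' →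
      Runs inp coins body s' T fun s'' => P (j + 1) (s''.writeNat v 0 (j + 1))) :
    Runs inp coins (forLoop v e body) s (N * (T + e.time + 11) + e.time + 11) (P N) := by
  have key : ∀ d j, j + d = N → ∀ s', Frame (RamProg.forLoop v e body) s s' → s'.nat v 0 = j →
      P j s' → Runs inp coins (.loop (.natLe (.add (.var v) (.const 1)) e)
        (.seq body (setVar v (.add (.var v) (.const 1))))) s'
        (d * (T + e.time + 11) + e.time + 5) (P N) := by
    intro d
    induction d with
    | zero =>
      intro j hj s' hf hvj hP
      obtain rfl : j = N := by omega
      refine ⟨_, s', .loop_false ?_, ?_, hP⟩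
      · simp [RamTest.Holds, NatExpr.eval, hN s' hf, hvj]
      · simp [RamTest.time, NatExpr.time]; omega
    | succ d ih =>
      intro j hj s' hf hvj hP
      obtain ⟨m, s₁, h₁, h₂, h₃⟩ := hstep j (by omega) s' hf hvj hP
      have hv₁ : s₁.nat v 0 = j := (h₁.frame.nat hv 0).trans hvj
      have e₁ : RamExec inp coins (setVar v (.add (.var v) (.const 1))) s₁ 6
          (s₁.writeNat v 0 (j + 1)) := by
        have := RamExec.setNat (inp := inp) (coins := coins) s₁ v (.const 0)
          (.add (.var v) (.const 1))
        simpa [NatExpr.eval, NatExpr.time, hv₁] using this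
      have e₂ := RamExec.seq h₁ e₁
      have hf₁ : Frame (RamProg.forLoop v e body) s (s₁.writeNat v 0 (j + 1)) :=
        hf.trans (e₂.frame.mono fun a ha => by simp_all [RamProg.forLoop, mods])
      obtain ⟨m', s₂, h₄, h₅, h₆⟩ := ih (j + 1) (by omega) _ hf₁ (by simp) h₃
      refine ⟨_, s₂, .loop_true ?_ e₂ h₄, ?_, h₆⟩
      · simp [RamTest.Holds, NatExpr.eval, hN s' hf, hvj]; omega
      · simp only [RamTest.time, NatExpr.time, add_mul, one_mul]; omega
  have e₀ := RamExec.setNat (inp := inp) (coins := coins) s v (.const 0) (.const 0)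
  have hf₀ : Frame (RamProg.forLoop v e body) s (s.writeNat v 0 0) :=
    e₀.frame.mono fun a ha => by simp_all [RamProg.forLoop, mods]
  obtain ⟨m, s', h₁, h₂, h₃⟩ := key N 0 (by omega) _ hf₀ (by simp) h0
  refine ⟨_, s', .seq e₀ h₁, ?_, h₃⟩
  simp only [NatExpr.time]; omega

namespace RamProg

/-- Add one to the number with `k` digits to the base `Q` in the array `arr`, the lowest digit
first, and leave the carry in the variable `carry`. -/
def increment (arr carry idx : ℕ) (Q k : NatExpr) : RamProg :=
  .seq (setVar carry (.const 1))
    (forLoop idx k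
      (.ite (.natLe (.const 1) (.var carry))
        (.ite (.natLe (.add (.load arr (.var idx)) (.const 2)) Q)
          (.seq (.setNat arr (.var idx) (.add (.load arr (.var idx)) (.const 1)))
            (setVar carry (.const 0)))
          (.setNat arr (.var idx) (.const 0)))
        .skip))

/-- Do `body` for all vectors of `k` numbers below `Q` in the array `arr`. -/
def enumerate (arr carry idx : ℕ) (Q k : NatExpr) (body : RamProg) : RamProg :=
  .seq (forLoop idx k (.setNat arr (.var idx) (.const 0)))
    (.seq (setVar carry (.const 0))
      (.loop (.natLe (.var carry) (.const 0)) (.seq body (increment arr carry idx Q k))))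

end RamProg

theorem Nat.succ_mod_eq_ite {q y : ℕ} (hq : 0 < q) :
    (y + 1) % q = if y % q + 2 ≤ q then y % q + 1 else 0 := by
  have h := Nat.mod_lt y hq
  rw [Nat.add_mod]
  split_ifs with h'
  · rw [Nat.mod_eq_of_lt (a := 1) (by omega), Nat.mod_eq_of_lt (by omega)]
  · obtain rfl | hq1 : q = 1 ∨ 1 < q := by omega
    · simp [Nat.mod_one]
    · rw [Nat.mod_eq_of_lt hq1, show y % q + 1 = q by omega, Nat.mod_self]

theorem Runs.increment {inp : RamInput} {coins : ℕ → Bool} {s : RamState} {arr carry idx : ℕ}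
    {Qe ke : NatExpr} (h₁ : arr ≠ carry) (h₂ : arr ≠ idx) (h₃ : carry ≠ idx) {Q k z : ℕ}
    (hQ : ∀ s', Frame (increment arr carry idx Qe ke) s s' → Qe.eval inp s' = Q)
    (hk : ∀ s', Frame (increment arr carry idx Qe ke) s s' → ke.eval inp s' = k)
    (hpos : 0 < Q) (hz : ∀ i < k, s.nat arr i = z / Q ^ i % Q) :
    Runs inp coins (RamProg.increment arr carry idx Qe ke) s
      (k * (Qe.time + ke.time + 40) + ke.time + 20) fun s' =>
      (∀ i < k, s'.nat arr i = (z + 1) / Q ^ i % Q) ∧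
        s'.nat carry 0 = if Q ^ k ∣ z + 1 then 1 else 0 := by
  refine Runs.mono (Runs.seq (Runs.setNat (Q := fun s' => (∀ i < k, s'.nat arr i = z / Q ^ i % Q) ∧
    s'.nat carry 0 = 1) ?_) fun s₁ f₁ hs₁ => ?_) (T₁ := 3 + (k * ((Qe.time + 27) + ke.time + 11) +
      ke.time + 11)) ?_
  · simpa [NatExpr.eval, h₁] using hz
  · refine Runs.post (Runs.forLoop k (fun j s' => (∀ i < j, s'.nat arr i = (z + 1) / Q ^ i % Q) ∧
      (∀ i < k, j ≤ i → s'.nat arr i = z / Q ^ i % Q) ∧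
        s'.nat carry 0 = if Q ^ j ∣ z + 1 then 1 else 0) ?_ ?_ ?_ ?_) ?_
    · intro s' hs'
      exact hk s' ((f₁.mono fun a ha => by simp_all [RamProg.increment, mods]).trans
        (hs'.mono fun a ha => by simp_all [RamProg.increment, mods]))
    · simp [mods, h₂, h₃]
    · simp [h₂, h₃, hs₁.2]
      exact hs₁.1
    · rintro j hj s' hf hidx ⟨hlo, hhi, hc⟩
      have hQ' : Qe.eval inp s' = Q :=
        hQ s' ((f₁.mono fun a ha => by simp_all [RamProg.increment, mods]).trans
          (hf.mono fun a ha => by simp_all [RamProg.increment, mods]))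
      refine Runs.mono (Runs.ite (T₁ := Qe.time + 22) (T₂ := 1) (fun hb => ?_) (fun hb => ?_)) ?_
      · have hd : Q ^ j ∣ z + 1 := by
          by_contra hd
          simp [RamTest.Holds, NatExpr.eval, hc, hd] at hb
        have hdiv : (z + 1) / Q ^ j = z / Q ^ j + 1 := by rw [Nat.succ_div, if_pos hd]
        have hmod := Nat.succ_mod_eq_ite (y := z / Q ^ j) hpos
        rw [← hdiv] at hmod
        have hdvd : Q ^ (j + 1) ∣ z + 1 ↔ (z + 1) / Q ^ j % Q = 0 := by
          rw [pow_succ, ← Nat.dvd_iff_mod_eq_zero]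
          exact (Nat.dvd_div_iff_mul_dvd hd).symm
        have hcur := hhi j hj le_rfl
        refine Runs.mono (Runs.ite (T₁ := 14) (T₂ := 4) (fun hb' => ?_) (fun hb' => ?_)) ?_
        · refine Runs.mono (Runs.seq (Runs.setNat (Q := fun s'' => s'' = s'.writeNat arr j
            (z / Q ^ j % Q + 1)) ?_) fun s₂ f₂ hs₂ => Runs.setNat ?_) ?_
          · simp [NatExpr.eval, hidx, hcur]
          · simp only [RamTest.Holds, NatExpr.eval, hidx, hcur, hQ'] at hb'
            rw [if_pos hb'] at hmod
            subst hs₂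
            simp only [NatExpr.eval, RamState.writeNat_nat, h₁, h₂, h₃, h₁.symm, false_and, if_false,
              true_and, and_true, hdvd]
            refine ⟨fun i hi => ?_, fun i hi hi' => ?_, ?_⟩
            · split_ifs with hij
              · rw [hij, hmod]
              · exact hlo i (by omega)
            · rw [if_neg (by omega)]
              exact hhi i hi (by omega)
            · rw [if_pos trivial, if_neg (by omega)]
          · simp [NatExpr.time]
        · refine Runs.mono (Runs.setNat ?_) ?_
          · simp only [RamTest.Holds, NatExpr.eval, hidx, hcur, hQ'] at hb'
            rw [if_neg hb'] at hmod
            simp only [NatExpr.eval, hidx, RamState.writeNat_nat, h₂, h₃, h₁.symm, false_and,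
              if_false, true_and, hdvd, hmod]
            refine ⟨fun i hi => ?_, fun i hi hi' => ?_, ?_⟩
            · split_ifs with hij
              · rw [hij, hmod]
              · exact hlo i (by omega)
            · rw [if_neg (by omega)]
              exact hhi i hi (by omega)
            · simp [hc, hd]
          · simp [NatExpr.time]
        · simp [RamTest.time, NatExpr.time]; omega
      · have hd : ¬ Q ^ j ∣ z + 1 := by
          intro hd
          simp [RamTest.Holds, NatExpr.eval, hc, hd] at hb
        have hdiv : (z + 1) / Q ^ j = z / Q ^ j := by rw [Nat.succ_div, if_neg hd]; rfl
        refine Runs.skip ?_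
        simp only [RamState.writeNat_nat, h₂, h₃, false_and, if_false]
        refine ⟨fun i hi => ?_, fun i hi hi' => hhi i hi (by omega), ?_⟩
        · obtain rfl | hij : i = j ∨ i < j := by omega
          · rw [hhi i hj le_rfl, hdiv]
          · exact hlo i hij
        · rw [hc, if_neg hd, if_neg fun h => hd ((pow_dvd_pow Q (Nat.le_succ j)).trans h)]
      · simp [RamTest.time, NatExpr.time]; omega
    · rintro s' - ⟨hlo, -, hc⟩
      exact ⟨hlo, hc⟩
  · have : k * (Qe.time + 27 + ke.time + 11) ≤ k * (Qe.time + ke.time + 40) :=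
      Nat.mul_le_mul_left _ (by omega)
    omega

theorem Runs.enumerate {inp : RamInput} {coins : ℕ → Bool} {s : RamState} {arr carry idx : ℕ}
    {Qe ke : NatExpr} {body : RamProg} (h₁ : arr ≠ carry) (h₂ : arr ≠ idx) (h₃ : carry ≠ idx)
    (hb : body.mods arr = false) {Q k T : ℕ}
    (P : ℕ → RamState → Prop)
    (hQ : ∀ s', Frame (enumerate arr carry idx Qe ke body) s s' → Qe.eval inp s' = Q)
    (hk : ∀ s', Frame (enumerate arr carry idx Qe ke body) s s' → ke.eval inp s' = k)
    (hpos : 0 < Q)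
    (hP : ∀ z s₁ s₂, P z s₁ → Frame (RamProg.increment arr carry idx Qe ke) s₁ s₂ → P z s₂)
    (h0 : P 0 s)
    (hstep : ∀ z < Q ^ k, ∀ s', Frame (enumerate arr carry idx Qe ke body) s s' →
      (∀ i < k, s'.nat arr i = z / Q ^ i % Q) → P z s' → Runs inp coins body s' T (P (z + 1))) :
    Runs inp coins (enumerate arr carry idx Qe ke body) s
      ((Q ^ k + 1) * (T + k * (Qe.time + ke.time + 40) + ke.time + 40)) (P (Q ^ k)) := by
  have key : ∀ d z, z + (d + 1) = Q ^ k →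
      ∀ s', Frame (RamProg.enumerate arr carry idx Qe ke body) s s' →
      s'.nat carry 0 = 0 → (∀ i < k, s'.nat arr i = z / Q ^ i % Q) → P z s' →
      Runs inp coins (.loop (.natLe (.var carry) (.const 0))
        (.seq body (RamProg.increment arr carry idx Qe ke))) s'
        ((d + 1) * (T + k * (Qe.time + ke.time + 40) + ke.time + 24) + 4) (P (Q ^ k)) := by
    intro d
    induction d with
    | zero =>
      intro z hz s' hf hc hd hPz
      obtain ⟨m₁, s₁, e₁, t₁, p₁⟩ := hstep z (by omega) s' hf hd hPz
      have f₁ : Frame (RamProg.enumerate arr carry idx Qe ke body) s s₁ :=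
        hf.trans (e₁.frame.mono fun a ha => by simp_all [RamProg.enumerate, mods])
      obtain ⟨m₂, s₂, e₂, t₂, p₂, c₂⟩ := Runs.increment (inp := inp) (coins := coins) (s := s₁)
        h₁ h₂ h₃ (Q := Q) (k := k) (z := z)
        (fun s' hs' => hQ s' (f₁.trans (hs'.mono fun a ha => by simp_all [RamProg.enumerate, mods])))
        (fun s' hs' => hk s' (f₁.trans (hs'.mono fun a ha => by simp_all [RamProg.enumerate, mods])))
        hpos (fun i hi => by rw [e₁.frame.nat hb, hd i hi])
      have hz' : z + 1 = Q ^ k := by omega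
      rw [hz', if_pos dvd_rfl] at c₂
      refine ⟨_, s₂, .loop_true ?_ (.seq e₁ e₂) (.loop_false ?_), ?_, hP _ _ _ (hz' ▸ p₁) e₂.frame⟩
      · simp [RamTest.Holds, NatExpr.eval, hc]
      · simp [RamTest.Holds, NatExpr.eval, c₂]
      · simp only [RamTest.time, NatExpr.time]; omega
    | succ d ih =>
      intro z hz s' hf hc hd hPz
      obtain ⟨m₁, s₁, e₁, t₁, p₁⟩ := hstep z (by omega) s' hf hd hPz
      have f₁ : Frame (RamProg.enumerate arr carry idx Qe ke body) s s₁ :=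
        hf.trans (e₁.frame.mono fun a ha => by simp_all [RamProg.enumerate, mods])
      obtain ⟨m₂, s₂, e₂, t₂, p₂, c₂⟩ := Runs.increment (inp := inp) (coins := coins) (s := s₁)
        h₁ h₂ h₃ (Q := Q) (k := k) (z := z)
        (fun s' hs' => hQ s' (f₁.trans (hs'.mono fun a ha => by simp_all [RamProg.enumerate, mods])))
        (fun s' hs' => hk s' (f₁.trans (hs'.mono fun a ha => by simp_all [RamProg.enumerate, mods])))
        hpos (fun i hi => by rw [e₁.frame.nat hb, hd i hi])
      rw [if_neg fun h => by have := Nat.le_of_dvd (by omega) h; omega] at c₂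
      have f₂ : Frame (RamProg.enumerate arr carry idx Qe ke body) s s₂ :=
        f₁.trans (e₂.frame.mono fun a ha => by simp_all [RamProg.enumerate, mods])
      obtain ⟨m₃, s₃, e₃, t₃, p₃⟩ := ih (z + 1) (by omega) s₂ f₂ c₂ p₂ (hP _ _ _ p₁ e₂.frame)
      refine ⟨_, s₃, .loop_true ?_ (.seq e₁ e₂) e₃, ?_, p₃⟩
      · simp [RamTest.Holds, NatExpr.eval, hc]
      · simp only [RamTest.time, NatExpr.time, add_mul] at *; omega
  have hQk : 0 < Q ^ k := pow_pos hpos k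
  refine Runs.mono (Runs.seq (Runs.forLoop k (fun j s' => ∀ i < j, s'.nat arr i = 0) (T := 4)
    ?_ ?_ ?_ ?_)
    fun s₁ f₁ hs₁ => Runs.seq (Runs.setNat (Q := fun s' => s' = s₁.writeNat carry 0 0) rfl)
      fun s₂ f₂ hs₂ => key (Q ^ k - 1) 0 (by omega) s₂ ?_ ?_ ?_ ?_) ?_
  · intro s' hs'
    exact hk s' (hs'.mono fun a ha => by simp_all [RamProg.enumerate, mods])
  · simp [mods, h₂]
  · simp
  · intro j hj s' hf hidx hs'
    refine Runs.setNat ?_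
    simp only [NatExpr.eval, hidx, RamState.writeNat_nat, h₂, false_and, if_false, true_and]
    intro i hi
    split_ifs with hij
    · rfl
    · exact hs' i (by omega)
  · exact (f₁.mono fun a ha => by simp_all [RamProg.enumerate, mods]).trans
      (f₂.mono fun a ha => by simp_all [RamProg.enumerate, mods])
  · simp [hs₂]
  · intro i hi
    simp [hs₂, h₁, hs₁ i hi]
  · exact hP _ _ _ h0 ((f₁.mono fun a ha => by simp_all [RamProg.increment, mods, RamProg.forLoop]).trans
      (f₂.mono fun a ha => by simp_all [RamProg.increment, mods]))
  · obtain ⟨R, hR⟩ : ∃ R, Q ^ k = R + 1 := ⟨Q ^ k - 1, by omega⟩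
    have : k * (4 + ke.time + 11) ≤ k * (Qe.time + ke.time + 40) :=
      Nat.mul_le_mul_left _ (by omega)
    have h4 : (R + 1) * (T + k * (Qe.time + ke.time + 40) + ke.time + 24) ≤
        (R + 1) * (T + k * (Qe.time + ke.time + 40) + ke.time + 40) :=
      Nat.mul_le_mul_left _ (by omega)
    rw [hR, Nat.add_sub_cancel, Nat.add_mul (R + 1) 1]
    simp only [NatExpr.time]
    omega

/-- Every vector of `k` numbers below `Q` is the vector of digits of a number. -/
theorem Nat.exists_digits_eq {Q : ℕ} (v : ℕ → ℕ) (k : ℕ) (hv : ∀ i < k, v i < Q) :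
    ∃ z < Q ^ k, ∀ i < k, z / Q ^ i % Q = v i := by
  induction k with
  | zero => exact ⟨0, by simp, by simp⟩
  | succ k ih =>
    obtain ⟨z, hz, hzv⟩ := ih fun i hi => hv i (by omega)
    have hk := hv k (by omega)
    have hQ : 0 < Q := by omega
    refine ⟨z + Q ^ k * v k, ?_, fun i hi => ?_⟩
    · calc z + Q ^ k * v k < Q ^ k * (v k + 1) := by rw [mul_add]; omega
        _ ≤ Q ^ (k + 1) := by rw [pow_succ]; exact Nat.mul_le_mul_left _ hk
    · obtain rfl | hik : i = k ∨ i < k := by omega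
      · rw [Nat.add_mul_div_left _ _ (pow_pos hQ _), Nat.div_eq_of_lt hz, zero_add,
          Nat.mod_eq_of_lt hk]
      · obtain ⟨d, rfl⟩ : ∃ d, k = i + (d + 1) := ⟨k - i - 1, by omega⟩
        rw [pow_add, mul_assoc, Nat.add_mul_div_left _ _ (pow_pos hQ _), pow_succ', mul_assoc,
          Nat.add_mul_mod_self_left, hzv i hik]

/-! ### The algorithm as a function of the guesses -/

open Classical in
/-- The last minimum point of `g` among the numbers below the argument that satisfy `E`. -/
noncomputable def argmin (E : ℕ → Prop) (g : ℕ → ℝ) : ℕ → Option ℕ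
  | 0 => none
  | n + 1 => if E n ∧ ∀ m ∈ argmin E g n, g n ≤ g m then some n else argmin E g n

theorem argmin_spec (E : ℕ → Prop) (g : ℕ → ℝ) (n : ℕ) :
    (∀ m ∈ argmin E g n, m < n ∧ E m ∧ ∀ x < n, E x → g m ≤ g x) ∧
      (argmin E g n = none → ∀ x < n, ¬ E x) := by
  induction n with
  | zero => simp [argmin]
  | succ n ih =>
    rw [argmin]
    split_ifs with h
    · refine ⟨fun m hm => ?_, by simp⟩
      obtain rfl : n = m := by simpa using hm
      refine ⟨by omega, h.1, fun x hx hE => ?_⟩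
      obtain rfl | hx : x = n ∨ x < n := by omega
      · exact le_rfl
      · cases hm' : argmin E g n with
        | none => exact absurd hE (ih.2 hm' x hx)
        | some m => exact (h.2 m hm').trans ((ih.1 m hm').2.2 x hx hE)
    · refine ⟨fun m hm => ?_, fun hm x hx hE => ?_⟩
      · obtain ⟨h₁, h₂, h₃⟩ := ih.1 m hm
        refine ⟨by omega, h₂, fun x hx hE => ?_⟩
        obtain rfl | hx : x = n ∨ x < n := by omega
        · by_contra hlt
          refine h ⟨hE, fun m' hm' => ?_⟩
          rw [Option.mem_def.1 hm] at hm'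
          obtain rfl : m = m' := by simpa using hm'
          exact (not_le.1 hlt).le
        · exact h₃ x hx hE
      · obtain rfl | hx : x = n ∨ x < n := by omega
        · exact h ⟨hE, by simp [hm]⟩
        · exact ih.2 hm x hx hE

namespace RamInput

open Finset

/-- The distances between points form a pseudometric. -/
structure IsMetric (inp : RamInput) : Prop where
  nonneg : ∀ x < inp.numPoints, ∀ y < inp.numPoints, 0 ≤ inp.dist x y
  self : ∀ x < inp.numPoints, inp.dist x x = 0
  symm : ∀ x < inp.numPoints, ∀ y < inp.numPoints, inp.dist x y = inp.dist y x
  triangle : ∀ x < inp.numPoints, ∀ y < inp.numPoints, ∀ z < inp.numPoints,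
    inp.dist x z ≤ inp.dist x y + inp.dist y z

/-- The distance from `x` to the closest point of `S`, by convention `1` if there is none. -/
noncomputable def distTo (inp : RamInput) (x : ℕ) (S : Finset ℕ) : ℝ :=
  if h : S.Nonempty then S.inf' h (inp.dist x) else 1

/-- The weight of a point: `distTo` for clients, zero for the other points. -/
noncomputable def weight (inp : RamInput) (S : Finset ℕ) (x : ℕ) : ℝ :=
  if inp.isClient x = 1 then inp.distTo x S else 0

/-- The total weight. If `S` is nonempty, this is the cost of `S`. -/
noncomputable def totalWeight (inp : RamInput) (S : Finset ℕ) : ℝ :=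
  ∑ x ∈ range inp.numPoints, inp.weight S x

/-- The total weight of the points that are closer to `f` than `c`. -/
noncomputable def closerWeight (inp : RamInput) (S : Finset ℕ) (f c : ℕ) : ℝ :=
  ∑ x ∈ range inp.numPoints, if inp.dist f x < inp.dist f c then inp.weight S x else 0

/-- `c` belongs to the smallest ball around `f` with at least the fraction `1 / N` of the
weight. -/
def InBall (inp : RamInput) (N : ℕ) (S : Finset ℕ) (f c : ℕ) : Prop :=
  N * inp.closerWeight S f c < inp.totalWeight S

open Classical in
/-- The number of points of `V` whose balls contain `c`. -/
noncomputable def cover (inp : RamInput) (N : ℕ) (S V : Finset ℕ) (c : ℕ) : ℕ :=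
  #{f ∈ V | inp.InBall N S f c}

/-- A point that belongs to the balls of as many points of `V` as possible. -/
noncomputable def pick (inp : RamInput) (N : ℕ) (S V : Finset ℕ) : ℕ :=
  (argmin (fun _ => True) (fun c => -(inp.cover N S V c : ℝ)) inp.numPoints).getD 0

open Classical in
/-- The points whose balls contain none of the first candidates. -/
noncomputable def alive (inp : RamInput) (N : ℕ) (S : Finset ℕ) : ℕ → Finset ℕ
  | 0 => range inp.numPoints
  | r + 1 => {f ∈ alive inp N S r | ¬ inp.InBall N S f (inp.pick N S (alive inp N S r))}

/-- The candidates for the leader of the next cluster. -/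
noncomputable def candidate (inp : RamInput) (N : ℕ) (S : Finset ℕ) (r : ℕ) : ℕ :=
  inp.pick N S (inp.alive N S r)

/-- The facilities of type `τ` outside of `S`. -/
def Eligible (inp : RamInput) (typ : ℕ → ℕ) (S : Finset ℕ) (τ x : ℕ) : Prop :=
  inp.isFacility x = 1 ∧ x ∉ S ∧ typ x = τ

/-- Add to `S` the facility of type `τ` that is closest to the candidate number `a`. -/
noncomputable def extend (inp : RamInput) (typ : ℕ → ℕ) (N : ℕ) (S : Finset ℕ) (a τ : ℕ) :
    Finset ℕ :=
  S ∪ (argmin (inp.Eligible typ S τ) (inp.dist (inp.candidate N S a)) inp.numPoints).toFinset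

/-- The facilities selected with the guesses `A` and `B`. -/
noncomputable def selection (inp : RamInput) (typ : ℕ → ℕ) (N : ℕ) (A B : ℕ → ℕ) : ℕ → Finset ℕ
  | 0 => ∅
  | i + 1 => inp.extend typ N (selection inp typ N A B i) (A i) (B i)

variable {inp : RamInput} {typ A B A' B' : ℕ → ℕ} {N : ℕ} {S S' V : Finset ℕ}

theorem selection_congr {i : ℕ} (hA : ∀ j < i, A j = A' j) (hB : ∀ j < i, B j = B' j) :
    inp.selection typ N A B i = inp.selection typ N A' B' i := by
  induction i with
  | zero => rfl
  | succ i ih =>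
    rw [selection, selection, ih (fun j hj => hA j (by omega)) (fun j hj => hB j (by omega)),
      hA i (by omega), hB i (by omega)]

theorem distTo_insert (x h : ℕ) (hS : S.Nonempty) :
    inp.distTo x (insert h S) = min (inp.dist x h) (inp.distTo x S) := by
  rw [distTo, distTo, dif_pos hS, dif_pos (insert_nonempty h S), inf'_insert]

theorem distTo_singleton (x h : ℕ) : inp.distTo x {h} = inp.dist x h := by
  rw [distTo, dif_pos (singleton_nonempty h), inf'_singleton]

theorem distTo_le {x s : ℕ} (hs : s ∈ S) : inp.distTo x S ≤ inp.dist x s := by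
  rw [distTo, dif_pos ⟨s, hs⟩]
  exact inf'_le _ hs

theorem exists_distTo_eq (x : ℕ) (hS : S.Nonempty) : ∃ s ∈ S, inp.distTo x S = inp.dist x s := by
  rw [distTo, dif_pos hS]
  exact exists_mem_eq_inf' hS _

theorem distTo_anti (x : ℕ) (hS : S.Nonempty) (h : S ⊆ S') : inp.distTo x S' ≤ inp.distTo x S := by
  obtain ⟨s, hs, e⟩ := inp.exists_distTo_eq x hS
  exact e ▸ distTo_le (h hs)

theorem IsMetric.distTo_nonneg (h : inp.IsMetric) {x : ℕ} (hx : x < inp.numPoints)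
    (hS : S ⊆ range inp.numPoints) : 0 ≤ inp.distTo x S := by
  rcases S.eq_empty_or_nonempty with rfl | hn
  · simp [distTo]
  · obtain ⟨s, hs, e⟩ := inp.exists_distTo_eq x hn
    exact e ▸ h.nonneg x hx s (mem_range.1 (hS hs))

theorem IsMetric.distTo_le_add (h : inp.IsMetric) {x y : ℕ} (hx : x < inp.numPoints)
    (hy : y < inp.numPoints) (hS : S ⊆ range inp.numPoints) (hn : S.Nonempty) :
    inp.distTo x S ≤ inp.dist x y + inp.distTo y S := by
  obtain ⟨s, hs, e⟩ := inp.exists_distTo_eq y hn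
  rw [e]
  exact (distTo_le hs).trans (h.triangle x hx y hy s (mem_range.1 (hS hs)))

theorem IsMetric.weight_nonneg (h : inp.IsMetric) {x : ℕ} (hx : x < inp.numPoints)
    (hS : S ⊆ range inp.numPoints) : 0 ≤ inp.weight S x := by
  rw [weight]
  split_ifs
  · exact h.distTo_nonneg hx hS
  · exact le_rfl

theorem totalWeight_eq (inp : RamInput) (S : Finset ℕ) :
    inp.totalWeight S = ∑ x ∈ range inp.numPoints with inp.isClient x = 1, inp.distTo x S := by
  rw [totalWeight, sum_filter]
  rfl

theorem IsMetric.totalWeight_nonneg (h : inp.IsMetric) (hS : S ⊆ range inp.numPoints) :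
    0 ≤ inp.totalWeight S :=
  sum_nonneg fun _ hx => h.weight_nonneg (mem_range.1 hx) hS

theorem totalWeight_anti (hS : S.Nonempty) (h : S ⊆ S') :
    inp.totalWeight S' ≤ inp.totalWeight S := by
  rw [totalWeight_eq, totalWeight_eq]
  exact sum_le_sum fun x _ => distTo_anti x hS h

/-! ### The candidates hit every ball -/

theorem pick_lt (hn : 0 < inp.numPoints) : inp.pick N S V < inp.numPoints := by
  rw [pick]
  cases h : argmin (fun _ => True) (fun c => -(inp.cover N S V c : ℝ)) inp.numPoints with
  | none => exact hn
  | some m => exact ((argmin_spec _ _ _).1 m h).1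

theorem cover_le_cover_pick {c : ℕ} (hc : c < inp.numPoints) :
    inp.cover N S V c ≤ inp.cover N S V (inp.pick N S V) := by
  rw [pick]
  cases h : argmin (fun _ => True) (fun c => -(inp.cover N S V c : ℝ)) inp.numPoints with
  | none => exact absurd trivial ((argmin_spec _ _ _).2 h c hc)
  | some m =>
    have := ((argmin_spec _ _ _).1 m h).2.2 c hc trivial
    simp only [neg_le_neg_iff, Nat.cast_le] at this
    exact this

open Classical in
theorem IsMetric.totalWeight_le_ball (h : inp.IsMetric) (hS : S ⊆ range inp.numPoints)
    (hN : 0 < N) (f : ℕ) :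
    inp.totalWeight S ≤
      N * ∑ c ∈ range inp.numPoints, if inp.InBall N S f c then inp.weight S c else 0 := by
  have hN' : (1 : ℝ) ≤ N := by exact_mod_cast hN
  have hw : ∀ x ∈ range inp.numPoints, 0 ≤ inp.weight S x :=
    fun x hx => h.weight_nonneg (mem_range.1 hx) hS
  by_cases hall : ∀ c ∈ range inp.numPoints, inp.InBall N S f c
  · rw [sum_congr rfl fun c hc => if_pos (hall c hc)]
    exact le_mul_of_one_le_left (h.totalWeight_nonneg hS) hN'
  · push Not at hall
    obtain ⟨c, hc, hcb⟩ := hall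
    obtain ⟨c₀, hc₀, hmin⟩ := exists_min_image
      ({c ∈ range inp.numPoints | ¬ inp.InBall N S f c}) (inp.dist f)
      ⟨c, mem_filter.2 ⟨hc, hcb⟩⟩
    have hc₀' := (mem_filter.1 hc₀).2
    rw [InBall, not_lt] at hc₀'
    refine hc₀'.trans (mul_le_mul_of_nonneg_left (sum_le_sum fun x hx => ?_) (by positivity))
    split_ifs with h₁ h₂ h₂
    · exact le_rfl
    · exact absurd (hmin x (mem_filter.2 ⟨hx, h₂⟩)) (not_le.2 h₁)
    · exact hw x hx
    · exact le_rfl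

theorem IsMetric.card_le_cover_pick (h : inp.IsMetric) (hS : S ⊆ range inp.numPoints)
    (hN : 0 < N) (hW : 0 < inp.totalWeight S) (V : Finset ℕ) :
    #V ≤ N * inp.cover N S V (inp.pick N S V) := by
  classical
  have h₁ : (#V : ℝ) * inp.totalWeight S ≤ N * ∑ f ∈ V, ∑ c ∈ range inp.numPoints,
      if inp.InBall N S f c then inp.weight S c else 0 := by
    rw [mul_sum, ← nsmul_eq_mul]
    exact card_nsmul_le_sum _ _ _ fun f _ => h.totalWeight_le_ball hS hN f
  have h₂ : ∑ f ∈ V, ∑ c ∈ range inp.numPoints,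
      (if inp.InBall N S f c then inp.weight S c else 0) ≤
        inp.totalWeight S * inp.cover N S V (inp.pick N S V) := by
    rw [sum_comm, totalWeight, sum_mul]
    refine sum_le_sum fun c hc => ?_
    rw [← sum_filter, sum_const, nsmul_eq_mul, mul_comm]
    refine mul_le_mul_of_nonneg_left ?_ (h.weight_nonneg (mem_range.1 hc) hS)
    exact_mod_cast cover_le_cover_pick (mem_range.1 hc)
  have h₃ : (#V : ℝ) * inp.totalWeight S ≤
      (N * inp.cover N S V (inp.pick N S V) : ℝ) * inp.totalWeight S :=
    h₁.trans ((mul_le_mul_of_nonneg_left h₂ (by positivity)).trans (le_of_eq (by ring)))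
  exact_mod_cast le_of_mul_le_mul_right h₃ hW

theorem card_alive_succ (r : ℕ) : #(inp.alive N S (r + 1)) +
    inp.cover N S (inp.alive N S r) (inp.candidate N S r) = #(inp.alive N S r) := by
  classical
  rw [alive, cover, candidate, add_comm]
  exact card_filter_add_card_filter_not _

theorem alive_antitone : Antitone (inp.alive N S) := antitone_nat_of_succ_le fun r => by
  classical
  simp only [alive]
  exact filter_subset _ _

theorem alive_subset (r : ℕ) : inp.alive N S r ⊆ range inp.numPoints :=
  alive_antitone (Nat.zero_le r)

theorem IsMetric.alive_eq_empty (h : inp.IsMetric) (hS : S ⊆ range inp.numPoints)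
    (hN : 0 < N) (hW : 0 < inp.totalWeight S) {M : ℕ}
    (hM : inp.numPoints ≤ M ∨ ∃ l, inp.numPoints < 2 ^ l ∧ N * l ≤ M) :
    inp.alive N S M = ∅ := by
  have hstep : ∀ r, #(inp.alive N S r) ≤
      N * inp.cover N S (inp.alive N S r) (inp.candidate N S r) :=
    fun r => h.card_le_cover_pick hS hN hW _
  rcases hM with hM | ⟨l, hl, hM⟩
  · have : ∀ r, #(inp.alive N S r) ≤ inp.numPoints - r := fun r => by
      induction r with
      | zero => simp [alive]
      | succ r ih =>
        have h₁ := hstep r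
        have h₂ := card_alive_succ (inp := inp) (N := N) (S := S) r
        rcases Nat.eq_zero_or_pos (inp.cover N S (inp.alive N S r) (inp.candidate N S r))
          with h₃ | h₃
        · rw [h₃, mul_zero] at h₁; omega
        · omega
    have := this M
    rw [← card_eq_zero]; omega
  · have key : ∀ r, (#(inp.alive N S r) : ℝ) ≤ inp.numPoints * (1 - (N : ℝ)⁻¹) ^ r := fun r => by
      have hN' : (1 : ℝ) ≤ N := by exact_mod_cast hN
      have hinv : (N : ℝ)⁻¹ ≤ 1 := inv_le_one_of_one_le₀ hN'
      induction r with
      | zero => simp [alive]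
      | succ r ih =>
        have h₁ : (#(inp.alive N S r) : ℝ) ≤
          N * inp.cover N S (inp.alive N S r) (inp.candidate N S r) := by exact_mod_cast hstep r
        have h₂ : (#(inp.alive N S (r + 1)) : ℝ) +
          inp.cover N S (inp.alive N S r) (inp.candidate N S r) = #(inp.alive N S r) := by
          exact_mod_cast card_alive_succ (inp := inp) (N := N) (S := S) r
        have h₃ : (N : ℝ)⁻¹ * #(inp.alive N S r) ≤
            inp.cover N S (inp.alive N S r) (inp.candidate N S r) := by
          rw [inv_mul_le_iff₀ (by linarith)]; exact h₁
        calc (#(inp.alive N S (r + 1)) : ℝ) ≤ #(inp.alive N S r) * (1 - (N : ℝ)⁻¹) := by linarith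
          _ ≤ inp.numPoints * (1 - (N : ℝ)⁻¹) ^ r * (1 - (N : ℝ)⁻¹) :=
            mul_le_mul_of_nonneg_right ih (by linarith)
          _ = _ := by ring
    have hN' : (1 : ℝ) ≤ N := by exact_mod_cast hN
    have hinv : (N : ℝ)⁻¹ ≤ 1 := inv_le_one_of_one_le₀ hN'
    have h₁ : (1 - (N : ℝ)⁻¹) ^ (N * l) ≤ (2 ^ l : ℝ)⁻¹ := by
      have h₂ : (1 - (N : ℝ)⁻¹) ^ N ≤ 2⁻¹ := by
        have h₃ : (1 - (N : ℝ)⁻¹) ≤ Real.exp (-(N : ℝ)⁻¹) := by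
          have := Real.add_one_le_exp (-(N : ℝ)⁻¹)
          linarith
        calc (1 - (N : ℝ)⁻¹) ^ N ≤ Real.exp (-(N : ℝ)⁻¹) ^ N :=
              pow_le_pow_left₀ (by linarith) h₃ N
          _ = (Real.exp 1)⁻¹ := by
            rw [← Real.exp_nat_mul, ← Real.exp_neg]
            congr 1
            field_simp
          _ ≤ 2⁻¹ := by
            have := Real.add_one_le_exp 1
            exact inv_anti₀ (by norm_num) (by linarith)
      rw [pow_mul, ← inv_pow]
      exact pow_le_pow_left₀ (pow_nonneg (by linarith) _) h₂ l
    have h₂ : (#(inp.alive N S (N * l)) : ℝ) < 1 := by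
      refine (key _).trans_lt ((mul_le_mul_of_nonneg_left h₁ (by positivity)).trans_lt ?_)
      rw [← div_eq_mul_inv, div_lt_one (by positivity)]
      exact_mod_cast hl
    have h₃ : #(inp.alive N S (N * l)) < 1 := by exact_mod_cast h₂
    have h₄ := card_le_card (alive_antitone (inp := inp) (N := N) (S := S) hM)
    rw [← card_eq_zero]; omega

theorem IsMetric.exists_inBall_candidate (h : inp.IsMetric) (hS : S ⊆ range inp.numPoints)
    (hN : 0 < N) (hW : 0 < inp.totalWeight S) {M : ℕ}
    (hM : inp.numPoints ≤ M ∨ ∃ l, inp.numPoints < 2 ^ l ∧ N * l ≤ M) {f : ℕ}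
    (hf : f < inp.numPoints) : ∃ r < M, inp.InBall N S f (inp.candidate N S r) := by
  by_contra! hcon
  have : ∀ r ≤ M, f ∈ inp.alive N S r := fun r => by
    induction r with
    | zero => simp [alive, hf]
    | succ r ih =>
      intro hr
      classical
      simp only [alive, mem_filter]
      exact ⟨ih (by omega), hcon r (by omega)⟩
  have := this M le_rfl
  simp [h.alive_eq_empty hS hN hW hM] at this

/-- A candidate in the ball of `f` is at distance at most `ρ` from `f` if the points at distance
at most `ρ` from `f` have a large weight. -/
theorem InBall.dist_le {f c : ℕ} {ρ : ℝ} (hb : inp.InBall N S f c) (h : inp.IsMetric)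
    (hS : S ⊆ range inp.numPoints)
    (hρ : inp.totalWeight S ≤
      N * ∑ x ∈ range inp.numPoints with inp.dist f x ≤ ρ, inp.weight S x) :
    inp.dist f c ≤ ρ := by
  by_contra! hlt
  refine absurd hb (not_lt.2 (hρ.trans (mul_le_mul_of_nonneg_left ?_ (by positivity))))
  rw [sum_filter, closerWeight]
  refine sum_le_sum fun x hx => ?_
  split_ifs with h₁ h₂ h₂
  · exact le_rfl
  · exact absurd (h₁.trans_lt hlt) h₂
  · exact h.weight_nonneg (mem_range.1 hx) hS
  · exact le_rfl

end RamInput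

/-- Many values of a function are at most slightly larger than the average. -/
theorem Finset.card_near_average (P : Finset ℕ) (g : ℕ → ℝ) (hg : ∀ c ∈ P, 0 ≤ g c) {ε ρ : ℝ}
    (hε : 0 < ε) (hε1 : ε ≤ 1) (hρ : P.card * ρ = (1 + ε / 4) * ∑ c ∈ P, g c) (hP : 0 < P.card) :
    ε / 5 * P.card ≤ (P.filter fun c => g c ≤ ρ).card := by
  by_contra! hlt
  have hP' : (0 : ℝ) < P.card := by exact_mod_cast hP
  have hsum0 : 0 ≤ ∑ c ∈ P, g c := sum_nonneg hg
  have hcard : ((P.filter fun c => g c ≤ ρ).card : ℝ) + (P.filter fun c => ¬ g c ≤ ρ).card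
      = P.card := by
    exact_mod_cast card_filter_add_card_filter_not _
  set b : ℝ := ((P.filter fun c => ¬ g c ≤ ρ).card : ℝ) with hb
  have hbP : (1 - ε / 5) * P.card < b := by linarith
  have hb0 : 0 < b := lt_of_le_of_lt (by apply mul_nonneg <;> linarith) hbP
  have hne : (P.filter fun c => ¬ g c ≤ ρ).Nonempty := by
    rw [← card_pos, ← Nat.cast_pos (α := ℝ)]
    exact hb0
  have h₁ : b * ρ < ∑ c ∈ P with ¬ g c ≤ ρ, g c := by
    rw [hb, ← nsmul_eq_mul, ← sum_const]
    exact sum_lt_sum_of_nonempty hne fun c hc => not_le.1 (mem_filter.1 hc).2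
  have h₂ : ∑ c ∈ P with ¬ g c ≤ ρ, g c ≤ ∑ c ∈ P, g c :=
    sum_le_sum_of_subset_of_nonneg (filter_subset _ _) fun c hc _ => hg c hc
  have hρ0 : 0 ≤ ρ := by
    by_contra! hneg
    have : P.card * ρ < 0 := mul_neg_of_pos_of_neg hP' hneg
    have : 0 ≤ (1 + ε / 4) * ∑ c ∈ P, g c := by positivity
    linarith
  have h₃ : (1 - ε / 5) * (P.card * ρ) ≤ b * ρ := by
    rw [← mul_assoc]
    exact mul_le_mul_of_nonneg_right hbP.le hρ0
  rw [hρ] at h₃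
  nlinarith [mul_nonneg (mul_nonneg hε.le (sub_nonneg.2 hε1)) hsum0]

/-! ### The approximation guarantee -/

namespace RamInput

open Finset

variable {inp : RamInput} {typ : ℕ → ℕ} {N : ℕ} {S : Finset ℕ}

/-- The clients that `σ` assigns to `f`. -/
def cluster (inp : RamInput) (σ : ℕ → ℕ) (f : ℕ) : Finset ℕ :=
  {x ∈ range inp.numPoints | inp.isClient x = 1 ∧ σ x = f}

/-- The cost of a cluster with center `f`. -/
def clusterCost (inp : RamInput) (σ : ℕ → ℕ) (f : ℕ) : ℝ :=
  ∑ x ∈ inp.cluster σ f, inp.dist f x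

theorem mem_cluster {σ : ℕ → ℕ} {f x : ℕ} : x ∈ inp.cluster σ f ↔
    x < inp.numPoints ∧ inp.isClient x = 1 ∧ σ x = f := by
  simp [cluster]

theorem sum_cluster (inp : RamInput) {σ : ℕ → ℕ} (hσ : ∀ x, σ x ∈ S) (g : ℕ → ℝ) :
    ∑ f ∈ S, ∑ x ∈ inp.cluster σ f, g x =
      ∑ x ∈ range inp.numPoints with inp.isClient x = 1, g x := by
  refine (sum_congr rfl fun f _ => ?_).trans (sum_fiberwise_of_maps_to (fun x _ => hσ x) g)
  rw [cluster, filter_filter]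

/-- If `S` is empty, some cluster of an arbitrary solution has a center with a heavy ball. -/
theorem IsMetric.exists_heavy_of_empty (h : inp.IsMetric) {O : Finset ℕ} {σ : ℕ → ℕ}
    (hO : O ⊆ range inp.numPoints) (hσ : ∀ x, σ x ∈ O) {ε : ℝ} (hε : 0 < ε) (hε1 : ε ≤ 1) {c₁ : ℕ}
    (hc₁ : 160 ≤ c₁ * ε ^ 2) (hC : ({x ∈ range inp.numPoints | inp.isClient x = 1}).Nonempty) :
    ∃ f ∈ O, ∃ ρ, (#(inp.cluster σ f) : ℝ) * ρ = (1 + ε / 4) * inp.clusterCost σ f ∧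
      0 < inp.totalWeight ∅ ∧ inp.totalWeight ∅ ≤ ((c₁ * #O : ℕ) : ℝ) *
        ∑ x ∈ range inp.numPoints with inp.dist f x ≤ ρ, inp.weight ∅ x := by
  set C := {x ∈ range inp.numPoints | inp.isClient x = 1} with hCdef
  have hw : inp.totalWeight ∅ = #C := by simp [totalWeight_eq, distTo, hCdef]
  have hC0 : (0 : ℝ) < #C := by exact_mod_cast hC.card_pos
  have hcard : ∑ f ∈ O, (#(inp.cluster σ f) : ℝ) = #C := by
    simpa using inp.sum_cluster hσ fun _ => 1
  have hOne : O.Nonempty := ⟨σ 0, hσ 0⟩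
  have hO0 : (0 : ℝ) < #O := by exact_mod_cast hOne.card_pos
  obtain ⟨f, hf, hfc⟩ : ∃ f ∈ O, (#C : ℝ) / #O ≤ #(inp.cluster σ f) := by
    refine exists_le_of_sum_le hOne ?_
    rw [hcard, sum_const, nsmul_eq_mul, mul_div_cancel₀ _ hO0.ne']
  have hfn := mem_range.1 (hO hf)
  have hm : (0 : ℝ) < #(inp.cluster σ f) := lt_of_lt_of_le (by positivity) hfc
  have hρ : (#(inp.cluster σ f) : ℝ) * ((1 + ε / 4) * inp.clusterCost σ f / #(inp.cluster σ f)) =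
      (1 + ε / 4) * inp.clusterCost σ f := by field_simp
  refine ⟨f, hf, _, hρ, hw ▸ hC0, ?_⟩
  have hG := card_near_average (inp.cluster σ f) (inp.dist f)
    (fun c hc => h.nonneg f hfn c (mem_cluster.1 hc).1) hε hε1 hρ (by exact_mod_cast hm)
  set ρ := (1 + ε / 4) * inp.clusterCost σ f / #(inp.cluster σ f)
  have h₁ : (#{c ∈ inp.cluster σ f | inp.dist f c ≤ ρ} : ℝ) ≤
      ∑ x ∈ range inp.numPoints with inp.dist f x ≤ ρ, inp.weight ∅ x := by
    rw [card_eq_sum_ones, Nat.cast_sum]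
    refine (sum_le_sum fun x hx => ?_).trans (sum_le_sum_of_subset_of_nonneg
      (f := inp.weight ∅) (fun x hx => ?_) fun x hx _ => h.weight_nonneg
        (mem_range.1 (mem_filter.1 hx).1) (empty_subset _))
    · have := (mem_cluster.1 (mem_filter.1 hx).1).2.1
      simp [weight, this, distTo]
    · have hx' := mem_filter.1 hx
      exact mem_filter.2 ⟨mem_range.2 (mem_cluster.1 hx'.1).1, hx'.2⟩
  have h₂ : (#C : ℝ) ≤ #O * #(inp.cluster σ f) := by
    rwa [div_le_iff₀' hO0] at hfc
  have h₃ : (32 : ℝ) ≤ c₁ * (ε / 5) := by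
    have : (c₁ : ℝ) * ε ^ 2 ≤ c₁ * ε := mul_le_mul_of_nonneg_left (by nlinarith) (by positivity)
    linarith
  rw [hw]
  push_cast
  calc (#C : ℝ) ≤ #O * #(inp.cluster σ f) := h₂
    _ ≤ (c₁ * (ε / 5)) * (#O * #(inp.cluster σ f)) :=
      le_mul_of_one_le_left (by positivity) (by linarith)
    _ = c₁ * #O * (ε / 5 * #(inp.cluster σ f)) := by ring
    _ ≤ _ := mul_le_mul_of_nonneg_left (hG.trans h₁) (by positivity)

/-- If `S` is expensive, although it serves some clusters of a solution well, then the center of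
another cluster has a heavy ball. -/
theorem IsMetric.exists_heavy_of_nonempty (h : inp.IsMetric) {O J : Finset ℕ} {σ : ℕ → ℕ}
    (hO : O ⊆ range inp.numPoints) (hσ : ∀ x, σ x ∈ O) {ε : ℝ} (hε : 0 < ε)
    (hε1 : ε ≤ 1) {c₁ : ℕ} (hc₁ : 160 ≤ c₁ * ε ^ 2) (hS : S ⊆ range inp.numPoints)
    (hne : S.Nonempty)
    (hcov : ∀ f ∈ J, ∑ x ∈ inp.cluster σ f, inp.distTo x S ≤ (3 + ε / 2) * inp.clusterCost σ f)
    (hexp : (3 + ε) * ∑ f ∈ O, inp.clusterCost σ f < inp.totalWeight S) :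
    ∃ f ∈ O, f ∉ J ∧ f ∉ S ∧
      ∃ ρ, (#(inp.cluster σ f) : ℝ) * ρ = (1 + ε / 4) * inp.clusterCost σ f ∧
      0 < inp.totalWeight S ∧ inp.totalWeight S ≤ ((c₁ * #O : ℕ) : ℝ) *
        ∑ x ∈ range inp.numPoints with inp.dist f x ≤ ρ, inp.weight S x := by
  have hOne : O.Nonempty := ⟨σ 0, hσ 0⟩
  have hO0 : (0 : ℝ) < #O := by exact_mod_cast hOne.card_pos
  have hcost : ∀ f ∈ O, 0 ≤ inp.clusterCost σ f := fun f hf =>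
    sum_nonneg fun x hx => h.nonneg f (mem_range.1 (hO hf)) x (mem_cluster.1 hx).1
  have hsum := inp.sum_cluster hσ fun x => inp.distTo x S
  rw [← totalWeight_eq] at hsum
  set W := inp.totalWeight S
  set OPT := ∑ f ∈ O, inp.clusterCost σ f with hOPT
  have hOPT0 : 0 ≤ OPT := sum_nonneg hcost
  have hW : 0 < W := lt_of_le_of_lt (by positivity) hexp
  obtain ⟨f, hf, hfX⟩ : ∃ f ∈ O, (3 + ε / 2) * inp.clusterCost σ f + ε / 8 * W / #O <
      ∑ x ∈ inp.cluster σ f, inp.distTo x S := by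
    by_contra! hcon
    have h₁ := sum_le_sum hcon
    rw [hsum, sum_add_distrib, ← mul_sum, sum_const, nsmul_eq_mul, mul_div_cancel₀ _ hO0.ne',
      ← hOPT] at h₁
    nlinarith [mul_nonneg (mul_nonneg hε.le (sub_nonneg.2 hε1)) hW.le,
      mul_pos (by linarith : 0 < 3 + ε / 2) (sub_pos.2 hexp)]
  have hfn := mem_range.1 (hO hf)
  have hc0 := hcost f hf
  set X := ∑ x ∈ inp.cluster σ f, inp.distTo x S with hX
  set P := inp.cluster σ f with hP
  have hWk : 0 < ε / 8 * W / #O := by positivity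
  have hfJ : f ∉ J := fun hfJ => by linarith [hcov f hfJ]
  have hXD : X ≤ inp.clusterCost σ f + #P * inp.distTo f S := by
    rw [hX, clusterCost, ← nsmul_eq_mul, ← sum_const, ← sum_add_distrib]
    refine sum_le_sum fun x hx => ?_
    have hxn := (mem_cluster.1 hx).1
    rw [h.symm f hfn x hxn]
    exact h.distTo_le_add hxn hfn hS hne
  set D := inp.distTo f S with hD
  set K := inp.clusterCost σ f with hK
  have hmD : 2 * K ≤ #P * D := by nlinarith
  have hmX : 2 / 3 * X ≤ #P * D := by nlinarith
  have hmpos : 0 < #P * D := by nlinarith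
  have hm : (0 : ℝ) < #P := by
    rcases (Nat.cast_nonneg (α := ℝ) #P).lt_or_eq with h₀ | h₀
    · exact h₀
    · rw [← h₀, zero_mul] at hmpos
      exact absurd hmpos (lt_irrefl _)
  have hDpos : 0 < D := pos_of_mul_pos_right hmpos hm.le
  have hfS : f ∉ S := fun hfS => by
    have := inp.distTo_le (x := f) hfS
    rw [h.self f hfn] at this
    linarith
  have hρ : (#P : ℝ) * ((1 + ε / 4) * K / #P) = (1 + ε / 4) * K := by field_simp
  refine ⟨f, hf, hfJ, hfS, _, hρ, hW, ?_⟩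
  have hG := card_near_average P (inp.dist f)
    (fun c hc => h.nonneg f hfn c (mem_cluster.1 hc).1) hε hε1 hρ (by exact_mod_cast hm)
  set ρ := (1 + ε / 4) * K / #P
  have hρD : ρ ≤ 5 / 8 * D := by
    refine le_of_mul_le_mul_left ?_ hm
    rw [hρ]
    nlinarith
  have h₁ : (#{c ∈ P | inp.dist f c ≤ ρ} : ℝ) * (3 / 8 * D) ≤
      ∑ x ∈ range inp.numPoints with inp.dist f x ≤ ρ, inp.weight S x := by
    rw [← nsmul_eq_mul, ← sum_const]
    refine (sum_le_sum fun x hx => ?_).trans (sum_le_sum_of_subset_of_nonneg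
      (f := inp.weight S) (fun x hx => ?_) fun x hx _ => h.weight_nonneg
        (mem_range.1 (mem_filter.1 hx).1) hS)
    · obtain ⟨hxn, hxc, -⟩ := mem_cluster.1 (mem_filter.1 hx).1
      have hxρ := (mem_filter.1 hx).2
      have := h.distTo_le_add hfn hxn hS hne
      rw [weight, if_pos hxc]
      linarith
    · have hx' := mem_filter.1 hx
      exact mem_filter.2 ⟨mem_range.2 (mem_cluster.1 hx'.1).1, hx'.2⟩
  have h₂ : ε / 5 * (3 / 8) * (2 / 3) * (ε / 8 * W / #O) ≤
      (#{c ∈ P | inp.dist f c ≤ ρ} : ℝ) * (3 / 8 * D) := by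
    have hXW : ε / 8 * W / #O ≤ X := by nlinarith
    calc ε / 5 * (3 / 8) * (2 / 3) * (ε / 8 * W / #O) ≤ ε / 5 * (3 / 8) * (2 / 3) * X :=
          mul_le_mul_of_nonneg_left hXW (by positivity)
      _ = ε / 5 * (3 / 8) * (2 / 3 * X) := by ring
      _ ≤ ε / 5 * (3 / 8) * (#P * D) := mul_le_mul_of_nonneg_left hmX (by positivity)
      _ = ε / 5 * #P * (3 / 8 * D) := by ring
      _ ≤ _ := mul_le_mul_of_nonneg_right hG (by positivity)
  push_cast
  calc W ≤ c₁ * ε ^ 2 / 160 * W := le_mul_of_one_le_left hW.le (by linarith)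
    _ = c₁ * #O * (ε / 5 * (3 / 8) * (2 / 3) * (ε / 8 * W / #O)) := by field_simp; ring
    _ ≤ _ := mul_le_mul_of_nonneg_left (h₂.trans h₁) (by positivity)

/-- The facilities of the instance. -/
def facilitySet (inp : RamInput) : Finset ℕ := {x ∈ range inp.numPoints | inp.isFacility x = 1}

theorem exists_extend_eq_insert {J O : Finset ℕ} {f : ℕ}
    (hO : O ⊆ inp.facilitySet) (hJ : J ⊆ O) (hf : f ∈ O) (hfJ : f ∉ J)
    (htyp : S.val.map typ = J.val.map typ) (a : ℕ) :
    ∃ g ∈ inp.facilitySet, g ∉ S ∧ typ g = typ f ∧ inp.extend typ N S a (typ f) = insert g S ∧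
      (f ∉ S → inp.dist (inp.candidate N S a) g ≤ inp.dist (inp.candidate N S a) f) := by
  have hmem : ∀ x, x ∈ inp.facilitySet ↔ x < inp.numPoints ∧ inp.isFacility x = 1 := fun x => by
    simp [facilitySet]
  rw [extend]
  cases he : argmin (inp.Eligible typ S (typ f)) (inp.dist (inp.candidate N S a)) inp.numPoints with
  | none =>
    exfalso
    have hno := (argmin_spec _ _ _).2 he
    have h₁ : {x ∈ insert f J | typ f = typ x} ⊆ {x ∈ S | typ f = typ x} := fun x hx => by
      obtain ⟨hx₁, hx₂⟩ := mem_filter.1 hx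
      have hxF := (hmem x).1 (hO (insert_subset hf hJ hx₁))
      refine mem_filter.2 ⟨?_, hx₂⟩
      by_contra hxS
      exact hno x hxF.1 ⟨hxF.2, hxS, hx₂.symm⟩
    have h₂ := card_le_card h₁
    rw [filter_insert, if_pos rfl, card_insert_of_notMem fun hx => hfJ (mem_filter.1 hx).1] at h₂
    have h₃ := congrArg (Multiset.count (typ f)) htyp
    rw [Multiset.count_map, Multiset.count_map, ← filter_val, ← filter_val] at h₃
    change #_ = #_ at h₃
    omega
  | some g =>
    obtain ⟨hg₁, ⟨hg₂, hg₃, hg₄⟩, hg₅⟩ := (argmin_spec _ _ _).1 g he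
    refine ⟨g, (hmem g).2 ⟨hg₁, hg₂⟩, hg₃, hg₄, ?_, fun hfS => ?_⟩
    · ext x
      simp
    · have hfF := (hmem f).1 (hO hf)
      exact hg₅ f hfF.1 ⟨hfF.2, hfS, rfl⟩

/-- For every set of facilities there are guesses for which the selection has as many facilities of
each type and costs at most `3 + ε` times as much. -/
theorem IsMetric.exists_selection (h : inp.IsMetric) {O : Finset ℕ} (hO : O ⊆ inp.facilitySet)
    (hne : O.Nonempty) {ε : ℝ} (hε : 0 < ε) (hε1 : ε ≤ 1) {c₁ M T : ℕ} (hc₁ : 160 ≤ c₁ * ε ^ 2)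
    (hM0 : 0 < M)
    (hM : inp.numPoints ≤ M ∨ ∃ l, inp.numPoints < 2 ^ l ∧ c₁ * #O * l ≤ M)
    (hT : ∀ x ∈ inp.facilitySet, typ x < T) :
    ∃ A B : ℕ → ℕ, (∀ i < #O, A i < M) ∧ (∀ i < #O, B i < T) ∧
      inp.selection typ (c₁ * #O) A B #O ⊆ inp.facilitySet ∧
      (inp.selection typ (c₁ * #O) A B #O).val.map typ = O.val.map typ ∧
      inp.totalWeight (inp.selection typ (c₁ * #O) A B #O) ≤ (3 + ε) * inp.totalWeight O := by
  have hF : inp.facilitySet ⊆ range inp.numPoints := filter_subset _ _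
  have hOn := hO.trans hF
  choose σ hσ hσd using fun x => inp.exists_distTo_eq x hne
  have hOPT : inp.totalWeight O = ∑ f ∈ O, inp.clusterCost σ f := by
    rw [totalWeight_eq, ← inp.sum_cluster hσ]
    refine sum_congr rfl fun f hf => sum_congr rfl fun x hx => ?_
    obtain ⟨hx₁, -, hx₂⟩ := mem_cluster.1 hx
    rw [hσd, hx₂, h.symm x hx₁ f (mem_range.1 (hOn hf))]
  have hOPT0 : 0 ≤ inp.totalWeight O := h.totalWeight_nonneg hOn
  have hc₁0 : 0 < c₁ := by
    rcases Nat.eq_zero_or_pos c₁ with rfl | h₀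
    · norm_num at hc₁
    · exact h₀
  have hN : 0 < c₁ * #O := Nat.mul_pos hc₁0 hne.card_pos
  set N := c₁ * #O with hNdef
  have main : ∀ i ≤ #O, ∃ A B : ℕ → ℕ, (∀ j < i, A j < M) ∧ (∀ j < i, B j < T) ∧
      inp.selection typ N A B i ⊆ inp.facilitySet ∧ ∃ J ⊆ O, #J = i ∧
      (inp.selection typ N A B i).val.map typ = J.val.map typ ∧
      ((∀ S', inp.selection typ N A B i ⊆ S' → S'.Nonempty →
          inp.totalWeight S' ≤ (3 + ε) * inp.totalWeight O) ∨
        ∀ f ∈ J, ∑ x ∈ inp.cluster σ f, inp.distTo x (inp.selection typ N A B i) ≤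
          (3 + ε / 2) * inp.clusterCost σ f) := by
    intro i
    induction i with
    | zero => exact fun _ => ⟨fun _ => 0, fun _ => 0, by simp, by simp, by simp [selection], ∅,
        by simp, by simp, by simp [selection], Or.inr (by simp)⟩
    | succ i ih =>
      intro hi
      obtain ⟨A, B, hA, hB, hS, J, hJ, hJc, htyp, hinv⟩ := ih (by omega)
      set S := inp.selection typ N A B i with hSdef
      have hScard : #S = i := by
        have := congrArg Multiset.card htyp
        simpa [hJc] using this
      have extend_guess : ∀ f ∈ O, f ∉ J → ∀ a < M,
          ((∀ S', inp.extend typ N S a (typ f) ⊆ S' → S'.Nonempty →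
            inp.totalWeight S' ≤ (3 + ε) * inp.totalWeight O) ∨
          ∀ f' ∈ insert f J, ∑ x ∈ inp.cluster σ f',
            inp.distTo x (inp.extend typ N S a (typ f)) ≤
              (3 + ε / 2) * inp.clusterCost σ f') →
          ∃ A B : ℕ → ℕ, (∀ j < i + 1, A j < M) ∧ (∀ j < i + 1, B j < T) ∧
          inp.selection typ N A B (i + 1) ⊆ inp.facilitySet ∧ ∃ J ⊆ O, #J = i + 1 ∧
          (inp.selection typ N A B (i + 1)).val.map typ = J.val.map typ ∧
          ((∀ S', inp.selection typ N A B (i + 1) ⊆ S' → S'.Nonempty →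
              inp.totalWeight S' ≤ (3 + ε) * inp.totalWeight O) ∨
            ∀ f ∈ J, ∑ x ∈ inp.cluster σ f, inp.distTo x (inp.selection typ N A B (i + 1)) ≤
              (3 + ε / 2) * inp.clusterCost σ f) := by
        intro f hf hfJ a ha hinv'
        refine ⟨Function.update A i a, Function.update B i (typ f), ?_, ?_, ?_⟩
        · intro j hj
          rcases eq_or_ne j i with rfl | hji
          · simpa using ha
          · simpa [hji] using hA j (by omega)
        · intro j hj
          rcases eq_or_ne j i with rfl | hji
          · simpa using hT f (hO hf)
          · simpa [hji] using hB j (by omega)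
        · have hsel : inp.selection typ N (Function.update A i a) (Function.update B i (typ f))
              (i + 1) = inp.extend typ N S a (typ f) := by
            rw [selection, Function.update_self, Function.update_self,
              selection_congr (A' := A) (B' := B) (fun j hj => Function.update_of_ne hj.ne _ _)
                (fun j hj => Function.update_of_ne hj.ne _ _)]
          rw [hsel]
          obtain ⟨g, hgF, hgS, hgt, hge, -⟩ :=
            exists_extend_eq_insert (N := N) hO hJ hf hfJ htyp a
          refine ⟨?_, insert f J, insert_subset hf hJ, ?_, ?_, hinv'⟩
          · rw [hge]
            exact insert_subset hgF hS
          · rw [card_insert_of_notMem hfJ, hJc]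
          · rw [hge, insert_val_of_notMem hgS, insert_val_of_notMem hfJ, Multiset.map_cons,
              Multiset.map_cons, htyp, hgt]
      obtain ⟨f₀, hf₀, hf₀J⟩ : ∃ f ∈ O, f ∉ J := by
        by_contra! hcon
        have := card_le_card (show O ⊆ J from hcon)
        omega
      by_cases hcheap : ∀ S', S ⊆ S' → S'.Nonempty →
          inp.totalWeight S' ≤ (3 + ε) * inp.totalWeight O
      · exact extend_guess f₀ hf₀ hf₀J 0 hM0
          (Or.inl fun S' hS' => hcheap S' (subset_union_left.trans hS'))
      have hcov := hinv.resolve_left hcheap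
      have hSn := hS.trans hF
      obtain ⟨f, hf, hfJ, hfS, ρ, hρ, hW, hheavy⟩ : ∃ f ∈ O, f ∉ J ∧ f ∉ S ∧
          ∃ ρ, (#(inp.cluster σ f) : ℝ) * ρ = (1 + ε / 4) * inp.clusterCost σ f ∧
          0 < inp.totalWeight S ∧ inp.totalWeight S ≤ (N : ℝ) *
            ∑ x ∈ range inp.numPoints with inp.dist f x ≤ ρ, inp.weight S x := by
        push Not at hcheap
        obtain ⟨S', hSS', hne', hexp⟩ := hcheap
        rcases S.eq_empty_or_nonempty with hS0 | hS1
        · have hJ0 : J = ∅ := by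
            rw [← card_eq_zero, hJc, ← hScard, hS0, card_empty]
          have hC : ({x ∈ range inp.numPoints | inp.isClient x = 1}).Nonempty := by
            by_contra hC
            rw [not_nonempty_iff_eq_empty] at hC
            rw [inp.totalWeight_eq S', hC, sum_empty] at hexp
            have : 0 ≤ (3 + ε) * inp.totalWeight O := by positivity
            linarith
          obtain ⟨f, hf, hrest⟩ := h.exists_heavy_of_empty hOn hσ hε hε1 hc₁ hC
          rw [hS0, hJ0]
          exact ⟨f, hf, by simp, by simp, hrest⟩
        · refine h.exists_heavy_of_nonempty hOn hσ hε hε1 hc₁ hSn hS1 hcov ?_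
          rw [← hOPT]
          exact hexp.trans_le (totalWeight_anti hS1 hSS')
      have hfn := mem_range.1 (hOn hf)
      obtain ⟨a, ha, hball⟩ := h.exists_inBall_candidate hSn hN hW hM hfn
      have hdist := hball.dist_le h hSn hheavy
      refine extend_guess f hf hfJ a ha (Or.inr fun f' hf' => ?_)
      obtain ⟨g, hgF, hgS, hgt, hge, hgd⟩ :=
        exists_extend_eq_insert (N := N) hO hJ hf hfJ htyp a
      rw [hge]
      have hgn := mem_range.1 (hF hgF)
      set l := inp.candidate N S a with hl
      have hln : l < inp.numPoints := pick_lt (by omega)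
      rcases mem_insert.1 hf' with rfl | hf'J
      · calc ∑ x ∈ inp.cluster σ f', inp.distTo x (insert g S)
            ≤ ∑ x ∈ inp.cluster σ f', (inp.dist f' x + 2 * ρ) := by
              refine sum_le_sum fun x hx => ?_
              have hxn := (mem_cluster.1 hx).1
              have h₁ := inp.distTo_le (x := x) (mem_insert_self g S)
              have h₂ := h.triangle x hxn f' hfn g hgn
              have h₃ := h.triangle f' hfn l hln g hgn
              have h₄ := hgd hfS
              rw [h.symm l hln f' hfn] at h₄
              rw [h.symm x hxn f' hfn] at h₂
              linarith
          _ = inp.clusterCost σ f' + 2 * (#(inp.cluster σ f') * ρ) := by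
              rw [sum_add_distrib, sum_const, nsmul_eq_mul, clusterCost]
              ring
          _ = _ := by rw [hρ]; ring
      · have hSne : S.Nonempty := by
          rw [← card_pos, hScard, ← hJc]
          exact card_pos.2 ⟨f', hf'J⟩
        exact (sum_le_sum fun x _ => distTo_anti x hSne (subset_insert g S)).trans (hcov f' hf'J)
  obtain ⟨A, B, hA, hB, hS, J, hJ, hJc, htyp, hinv⟩ := main #O le_rfl
  obtain rfl : J = O := eq_of_subset_of_card_le hJ hJc.ge
  refine ⟨A, B, hA, hB, hS, htyp, ?_⟩
  set S := inp.selection typ N A B #J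
  have hSne : S.Nonempty := by
    have := congrArg Multiset.card htyp
    simp only [Multiset.card_map, card_val] at this
    rw [← card_pos, this]
    exact hne.card_pos
  rcases hinv with hinv | hinv
  · exact hinv S subset_rfl hSne
  · have h₁ := sum_le_sum hinv
    rw [inp.sum_cluster hσ, ← totalWeight_eq, ← mul_sum, ← hOPT] at h₁
    nlinarith

end RamInput

/-! ### The program -/

notation "aOut" => (0 : ℕ)
notation "vLog" => (1 : ℕ)
notation "vPow" => (2 : ℕ)
notation "vTypes" => (3 : ℕ)
notation "vCands" => (4 : ℕ)
notation "aTyp" => (5 : ℕ)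
notation "aRep" => (6 : ℕ)
notation "vSame" => (7 : ℕ)
notation "vFound" => (8 : ℕ)
notation "vX" => (9 : ℕ)
notation "vRep" => (10 : ℕ)
notation "vGroup" => (11 : ℕ)
notation "aLead" => (12 : ℕ)
notation "vLeadCarry" => (13 : ℕ)
notation "vLeadIdx" => (14 : ℕ)
notation "aKind" => (15 : ℕ)
notation "vKindCarry" => (16 : ℕ)
notation "vKindIdx" => (17 : ℕ)
notation "vStep" => (18 : ℕ)
notation "aSel" => (19 : ℕ)
notation "vNum" => (20 : ℕ)
notation "aAlive" => (21 : ℕ)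
notation "vRound" => (22 : ℕ)
notation "vC" => (23 : ℕ)
notation "vF" => (24 : ℕ)
notation "vY" => (25 : ℕ)
notation "vCand" => (26 : ℕ)
notation "aElig" => (27 : ℕ)
notation "vNear" => (28 : ℕ)
notation "vOk" => (29 : ℕ)
notation "vCnt" => (30 : ℕ)
notation "vHave" => (31 : ℕ)
notation "vZ" => (32 : ℕ)
notation "rWeight" => (40 : ℕ)
notation "rTotal" => (41 : ℕ)
notation "rSum" => (42 : ℕ)
notation "rVal" => (43 : ℕ)
notation "rBest" => (44 : ℕ)
notation "rCost" => (45 : ℕ)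

theorem Runs.forLoop_pow {inp : RamInput} {coins : ℕ → Bool} {s : RamState} {v : ℕ} {e : NatExpr}
    {body : RamProg} {N x a c : ℕ} (hNx : N ≤ x) (hx : 1 ≤ x) (P : ℕ → RamState → Prop)
    (hN : ∀ s', Frame (RamProg.forLoop v e body) s s' → e.eval inp s' = N)
    (hv : body.mods v = false)
    (h0 : P 0 (s.writeNat v 0 0))
    (hstep : ∀ j < N, ∀ s', Frame (RamProg.forLoop v e body) s s' → s'.nat v 0 = j → P j s' →
      Runs inp coins body s' (c * x ^ a) fun s'' => P (j + 1) (s''.writeNat v 0 (j + 1))) :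
    Runs inp coins (RamProg.forLoop v e body) s ((c + 2 * e.time + 22) * x ^ (a + 1)) (P N) := by
  refine (Runs.forLoop N P hN hv h0 hstep).mono ?_
  have h₁ : N * (c * x ^ a + e.time + 11) ≤ x * (c * x ^ a + e.time + 11) :=
    Nat.mul_le_mul_right _ hNx
  have h₂ : x ≤ x ^ (a + 1) := Nat.le_self_pow (by omega) x
  have h₃ := Nat.mul_le_mul_right (e.time + 11) h₂
  have h₄ := Nat.mul_le_mul_right (e.time + 11) (hx.trans h₂)
  calc N * (c * x ^ a + e.time + 11) + e.time + 11
      ≤ x * (c * x ^ a + e.time + 11) + e.time + 11 := by omega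
    _ = c * x ^ (a + 1) + x * (e.time + 11) + 1 * (e.time + 11) := by ring
    _ ≤ c * x ^ (a + 1) + x ^ (a + 1) * (e.time + 11) + x ^ (a + 1) * (e.time + 11) := by omega
    _ = _ := by ring

namespace RamProg

/-- Find the smallest eligible entry of the array `rVal`. The result is its index plus one, or zero
if there is none. -/
def findMin : RamProg :=
  .seq (setVar vNear (.const 0))
    (forLoop vZ .numPoints
      (.ite (.natLe (.const 1) (.load aElig (.var vZ)))
        (.ite (.natLe (.var vNear) (.const 0))
          (setVar vNear (.add (.var vZ) (.const 1)))
          (.ite (.realLe (.load rVal (.var vZ)) (.load rVal (.sub (.var vNear) (.const 1))))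
            (setVar vNear (.add (.var vZ) (.const 1))) .skip))
        .skip))

/-- Compute the weight of the points closer to `vF` than the point in the variable `v`. -/
def sumCloser (v : ℕ) : RamProg :=
  .seq (.setReal rSum (.const 0) (.ofNat (.const 0)))
    (forLoop vY .numPoints
      (.ite (.realLe (.dist (.var vF) (.var v)) (.dist (.var vF) (.var vY))) .skip
        (.setReal rSum (.const 0) (.add (.load rSum (.const 0)) (.load rWeight (.var vY))))))

/-- The test that the point considered by `sumCloser` is not in the ball of `vF`. -/
def notInBall (c₁ : ℕ) : RamTest :=
  .realLe (.load rTotal (.const 0))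
    (.mul (.mul (.ofNat (.const c₁)) (.ofNat .budget)) (.load rSum (.const 0)))

/-- For all points, count the living points whose balls they belong to. -/
def score (c₁ : ℕ) : RamProg :=
  forLoop vC .numPoints
    (.seq (setVar vCnt (.const 0))
      (.seq (forLoop vF .numPoints
          (.seq (sumCloser vC)
            (.ite (notInBall c₁) .skip
              (setVar vCnt (.add (.var vCnt) (.load aAlive (.var vF)))))))
        (.seq (.setReal rVal (.var vC) (.sub (.ofNat (.const 0)) (.ofNat (.var vCnt))))
          (.setNat aElig (.var vC) (.const 1)))))

/-- Find the next candidate. -/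
def round (c₁ : ℕ) : RamProg :=
  .seq (score c₁)
    (.seq findMin
      (.seq (setVar vCand (.sub (.var vNear) (.const 1)))
        (forLoop vF .numPoints
          (.seq (sumCloser vCand)
            (.ite (notInBall c₁) .skip (.setNat aAlive (.var vF) (.const 0)))))))

/-- Find the candidate with the number given by the array `aLead`. -/
def findCand (c₁ : ℕ) : RamProg :=
  .seq (forLoop vF .numPoints (.setNat aAlive (.var vF) (.const 1)))
    (.seq (.setReal rTotal (.const 0) (.ofNat (.const 0)))
      (.seq (forLoop vY .numPoints
          (.setReal rTotal (.const 0) (.add (.load rTotal (.const 0)) (.load rWeight (.var vY)))))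
        (forLoop vRound (.add (.load aLead (.var vStep)) (.const 1)) (round c₁))))

section Specs

variable {inp : RamInput} {coins : ℕ → Bool} {s : RamState} {S V : Finset ℕ} {c₁ : ℕ}

open RamInput Finset

theorem runs_findMin {E : ℕ → Prop} {g : ℕ → ℝ} (hn : 1 ≤ inp.numPoints)
    (hE : ∀ x < inp.numPoints, 1 ≤ s.nat aElig x ↔ E x)
    (hg : ∀ x < inp.numPoints, s.real rVal x = g x) :
    Runs inp coins findMin s (100 * inp.numPoints) fun s' =>
      s'.nat vNear 0 = (argmin E g inp.numPoints).elim 0 (· + 1) := by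
  refine Runs.mono (Runs.seq (Runs.setNat (Q := fun s' => s'.nat vNear 0 = 0) ?_) fun s₁ f₁ h₁ =>
    Runs.forLoop_pow (c := 40) (a := 0) le_rfl hn
      (fun j s' => s'.nat vNear 0 = (argmin E g j).elim 0 (· + 1)) (fun _ _ => rfl) rfl ?_ ?_) ?_
  · simp [NatExpr.eval]
  · simp [argmin, h₁]
  · intro j hj s' hf hz hP
    have hv : ∀ x < inp.numPoints, s'.real rVal x = g x := fun x hx => by
      rw [hf.real rfl, f₁.real rfl, hg x hx]
    have he : 1 ≤ s'.nat aElig j ↔ E j := by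
      rw [hf.nat rfl, f₁.nat rfl, hE j hj]
    have hlt := (argmin_spec E g j).1
    refine Runs.mono (Runs.ite (fun hb => Runs.ite (fun hb₁ => Runs.setNat ?_) fun hb₁ =>
      Runs.ite (fun hb₂ => Runs.setNat ?_) fun hb₂ => Runs.skip ?_) fun hb => Runs.skip ?_) ?_
    all_goals simp only [RamTest.Holds, NatExpr.eval, RealExpr.eval, hz, he] at *
    · cases hm : argmin E g j with
      | none => simp [argmin, hm, hb]
      | some m => simp [hP, hm] at hb₁
    · cases hm : argmin E g j with
      | none => simp [hP, hm] at hb₁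
      | some m =>
        have := hlt m hm
        simp only [hP, hm, Option.elim, Nat.add_sub_cancel] at hb₂
        rw [hv j hj, hv m (by omega)] at hb₂
        simp [argmin, hm, hb, hb₂]
    · cases hm : argmin E g j with
      | none => simp [hP, hm] at hb₁
      | some m =>
        have := hlt m hm
        simp only [hP, hm, Option.elim, Nat.add_sub_cancel] at hb₂
        rw [hv j hj, hv m (by omega)] at hb₂
        simp [argmin, hm, hb, hb₂, hP]
    · simp [argmin, hb, hP]
    · simp [RamTest.time, NatExpr.time, RealExpr.time]
  · simp [NatExpr.time]; omega

theorem runs_sumCloser (hn : 1 ≤ inp.numPoints)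
    (hw : ∀ x < inp.numPoints, s.real rWeight x = inp.weight S x) {v : ℕ}
    (hv : (sumCloser v).mods v = false) :
    Runs inp coins (sumCloser v) s (100 * inp.numPoints) fun s' =>
      s'.real rSum 0 = inp.closerWeight S (s.nat vF 0) (s.nat v 0) := by
  refine Runs.mono (Runs.seq (Runs.setReal (Q := fun s' => s'.real rSum 0 = 0) ?_) fun s₁ f₁ h₁ =>
    Runs.forLoop_pow (c := 40) (a := 0) le_rfl hn
      (fun j s' => s'.real rSum 0 = ∑ x ∈ range j,
        if inp.dist (s.nat vF 0) x < inp.dist (s.nat vF 0) (s.nat v 0) then inp.weight S x else 0)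
      (fun _ _ => rfl) rfl ?_ ?_) ?_
  · simp [RealExpr.eval, NatExpr.eval]
  · simp [h₁]
  · intro j hj s' hf hz hP
    simp only [sumCloser, mods, forLoop, Bool.or_eq_false_iff] at hv
    have hF : s'.nat vF 0 = s.nat vF 0 := by rw [hf.nat rfl, f₁.nat rfl]
    have hC : s'.nat v 0 = s.nat v 0 := by
      rw [hf.nat, f₁.nat] <;> simp_all [mods, forLoop]
    have hW : s'.real rWeight j = inp.weight S j := by rw [hf.real rfl, f₁.real rfl, hw j hj]
    refine Runs.mono (Runs.ite (fun hb => Runs.skip ?_) fun hb => Runs.setReal ?_) ?_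
    all_goals simp only [RamTest.Holds, NatExpr.eval, RealExpr.eval, hz, hF, hC] at *
    · simp [sum_range_succ, hP, not_lt.2 hb]
    · simp [sum_range_succ, hP, not_le.1 hb, hW]
    · simp [RamTest.time, NatExpr.time, RealExpr.time]
  · simp [NatExpr.time, RealExpr.time]; omega

theorem not_holds_notInBall {f c : ℕ} (ht : s.real rTotal 0 = inp.totalWeight S)
    (hs : s.real rSum 0 = inp.closerWeight S f c) :
    ¬ (notInBall c₁).Holds inp s ↔ inp.InBall (c₁ * inp.budget) S f c := by
  simp [notInBall, RamTest.Holds, RealExpr.eval, NatExpr.eval, InBall, ht, hs]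

/-- The array `aAlive` stores the set `V`. -/
def StoresAlive (inp : RamInput) (V : Finset ℕ) (s : RamState) : Prop :=
  ∀ x < inp.numPoints, s.nat aAlive x = if x ∈ V then 1 else 0

/-- The array `rWeight` and the variable `rTotal` store the weights for `S`. -/
def StoresWeight (inp : RamInput) (S : Finset ℕ) (s : RamState) : Prop :=
  (∀ x < inp.numPoints, s.real rWeight x = inp.weight S x) ∧ s.real rTotal 0 = inp.totalWeight S

theorem StoresWeight.frame {p : RamProg} {s' : RamState} (h : StoresWeight inp S s)
    (hf : Frame p s s') (h₁ : p.mods rWeight = false) (h₂ : p.mods rTotal = false) :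
    StoresWeight inp S s' :=
  ⟨fun x hx => by rw [hf.real h₁, h.1 x hx], by rw [hf.real h₂, h.2]⟩

theorem StoresAlive.frame {p : RamProg} {s' : RamState} (h : StoresAlive inp V s)
    (hf : Frame p s s') (h₁ : p.mods aAlive = false) : StoresAlive inp V s' :=
  fun x hx => by rw [hf.nat h₁, h x hx]

theorem runs_score (hn : 1 ≤ inp.numPoints) (hw : StoresWeight inp S s)
    (hV : StoresAlive inp V s) (hVn : V ⊆ range inp.numPoints) :
    Runs inp coins (score c₁) s (300 * inp.numPoints ^ 3) fun s' =>
      (∀ x < inp.numPoints, s'.nat aElig x = 1) ∧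
      ∀ x < inp.numPoints, s'.real rVal x = -(inp.cover (c₁ * inp.budget) S V x : ℝ) := by
  classical
  refine Runs.mono (Runs.forLoop_pow (c := 250) (a := 2) le_rfl hn
      (fun j s' => (∀ x < j, s'.nat aElig x = 1) ∧
        ∀ x < j, s'.real rVal x = -(inp.cover (c₁ * inp.budget) S V x : ℝ))
      (fun _ _ => rfl) rfl ?_ ?_) ?_
  · simp
  · intro j hj s' hf hz hP
    refine Runs.mono (Runs.seq (Runs.setNat (Q := fun s' => s'.nat vCnt 0 = 0) ?_) fun s₁ f₁ h₁ =>
      Runs.seq (Runs.forLoop_pow (c := 150) (a := 1) le_rfl hn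
        (fun i s' => s'.nat vCnt 0 = ∑ f ∈ range i,
          if f ∈ V ∧ inp.InBall (c₁ * inp.budget) S f j then 1 else 0)
        (fun _ _ => rfl) rfl ?_ ?_)
        fun s₂ f₂ h₂ => Runs.seq (Runs.setReal (Q := fun s' =>
          (∀ x < j, s'.nat aElig x = 1) ∧
          ∀ x < j + 1, s'.real rVal x = -(inp.cover (c₁ * inp.budget) S V x : ℝ)) ?_)
          fun s₃ f₃ h₃ => Runs.setNat ?_) ?_
    · simp [NatExpr.eval]
    · simp [h₁]
    · intro i hi s₂ f₂ hz₂ hP₂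
      have hj₂ : s₂.nat vC 0 = j := by rw [f₂.nat rfl, f₁.nat rfl, hz]
      have hw₂ : StoresWeight inp S s₂ :=
        ((hw.frame hf rfl rfl).frame f₁ rfl rfl).frame f₂ rfl rfl
      have hV₂ : StoresAlive inp V s₂ := ((hV.frame hf rfl).frame f₁ rfl).frame f₂ rfl
      refine Runs.mono (Runs.seq (runs_sumCloser hn hw₂.1 rfl) fun s₃ f₃ h₃ =>
        Runs.ite (fun hb => Runs.skip ?_) fun hb => Runs.setNat ?_) ?_
      all_goals try rw [hz₂, hj₂] at h₃
      · have hb' := (not_holds_notInBall (c₁ := c₁) (hw₂.frame f₃ rfl rfl).2 h₃).not_right.1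
          hb
        simp [-sum_boole, sum_range_succ, hb', hP₂,
          f₃.nat (show (sumCloser vC).mods vCnt = false from rfl)]
      · have hb' := (not_holds_notInBall (c₁ := c₁) (hw₂.frame f₃ rfl rfl).2 h₃).1 hb
        have hi₃ : s₃.nat vF 0 = i := by rw [f₃.nat rfl, hz₂]
        have hc₃ : s₃.nat vCnt 0 = s₂.nat vCnt 0 := f₃.nat rfl 0
        simp [-sum_boole, NatExpr.eval, sum_range_succ, hb', hc₃, hP₂, hi₃, (hV₂.frame f₃ rfl) i hi]
      · simp [notInBall, RamTest.time, NatExpr.time, RealExpr.time]; omega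
    · have hj₂ : s₂.nat vC 0 = j := by rw [f₂.nat rfl, f₁.nat rfl, hz]
      have hcov : s₂.nat vCnt 0 = inp.cover (c₁ * inp.budget) S V j := by
        rw [h₂, cover, ← card_filter]
        congr 1
        ext f
        simp only [mem_filter]
        exact ⟨fun h => h.2, fun h => ⟨hVn h.1, h⟩⟩
      simp only [NatExpr.eval, RealExpr.eval, RamState.writeReal_nat, hj₂, hcov]
      refine ⟨fun x hx => ?_, fun x hx => ?_⟩
      · rw [f₂.nat rfl, f₁.nat rfl, hP.1 x hx]
      · rw [RamState.writeReal_real]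
        split_ifs with h
        · simp [h.2]
        · rw [f₂.real rfl, f₁.real rfl, hP.2 x (by omega)]
    · have hj₃ : s₃.nat vC 0 = j := by rw [f₃.nat rfl, f₂.nat rfl, f₁.nat rfl, hz]
      simp only [NatExpr.eval, hj₃]
      refine ⟨fun x hx => ?_, fun x hx => ?_⟩
      · have := h₃.1 x
        simp
        omega
      · simpa using h₃.2 x hx
    · simp [NatExpr.time, RealExpr.time]
      nlinarith [Nat.one_le_pow 2 _ hn]
  · simp only [NatExpr.time]
    have := Nat.one_le_pow 3 _ hn
    simp only [Nat.reduceAdd]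
    omega

theorem runs_round (hn : 1 ≤ inp.numPoints) (hw : StoresWeight inp S s)
    (hV : StoresAlive inp V s) (hVn : V ⊆ range inp.numPoints) :
    Runs inp coins (round c₁) s (800 * inp.numPoints ^ 3) fun s' =>
      s'.nat vCand 0 = inp.pick (c₁ * inp.budget) S V ∧
      ∀ V' : Finset ℕ, (∀ f, f ∈ V' ↔
        f ∈ V ∧ ¬ inp.InBall (c₁ * inp.budget) S f (inp.pick (c₁ * inp.budget) S V)) →
        StoresAlive inp V' s' := by
  classical
  refine Runs.mono (Runs.seq (runs_score hn hw hV hVn) fun s₁ f₁ h₁ =>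
    Runs.seq (runs_findMin (E := fun _ => True) hn (fun x hx => by simp [h₁.1 x hx]) h₁.2)
    fun s₂ f₂ h₂ => Runs.seq (Runs.setNat (Q := fun s' =>
      s'.nat vCand 0 = inp.pick (c₁ * inp.budget) S V) ?_) fun s₃ f₃ h₃ =>
    (Runs.forLoop_pow (c := 150) (a := 1) le_rfl hn
      (fun j s' => s'.nat vCand 0 = inp.pick (c₁ * inp.budget) S V ∧
        ∀ x < inp.numPoints, s'.nat aAlive x = if x ∈ V ∧ ¬ (x < j ∧
          inp.InBall (c₁ * inp.budget) S x (inp.pick (c₁ * inp.budget) S V)) then 1 else 0)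
      (fun _ _ => rfl) rfl ?_ ?_).post ?_) ?_
  · simp only [NatExpr.eval, h₂, pick]
    cases argmin (fun _ => True) (fun c => -(inp.cover (c₁ * inp.budget) S V c : ℝ)) inp.numPoints
    all_goals simp
  · have : StoresAlive inp V s₃ := ((hV.frame f₁ rfl).frame f₂ rfl).frame f₃ rfl
    simpa [h₃] using fun x hx => this x hx
  · intro j hj s₄ f₄ hz hP
    have hw₄ : StoresWeight inp S s₄ :=
      (((hw.frame f₁ rfl rfl).frame f₂ rfl rfl).frame f₃ rfl rfl).frame f₄ rfl rfl
    refine Runs.mono (Runs.seq (runs_sumCloser hn hw₄.1 rfl) fun s₅ f₅ h₅ =>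
        Runs.ite (fun hb => Runs.skip ?_) fun hb => Runs.setNat ?_) ?_
    all_goals try rw [hz, hP.1] at h₅
    · have hb' := (not_holds_notInBall (c₁ := c₁) (hw₄.frame f₅ rfl rfl).2 h₅).not_right.1
          hb
      refine ⟨?_, fun x hx => ?_⟩
      · simpa using (f₅.nat rfl 0).trans hP.1
      · have := (f₅.nat (a := aAlive) rfl x).trans (hP.2 x hx)
        simp only [RamState.writeNat_nat, this]
        rcases eq_or_ne x j with rfl | hxj
        · simp [hb']
        · simp [show x < j + 1 ↔ x < j by omega]
    · have hb' := (not_holds_notInBall (c₁ := c₁) (hw₄.frame f₅ rfl rfl).2 h₅).1 hb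
      have hj₅ : s₅.nat vF 0 = j := by rw [f₅.nat rfl, hz]
      refine ⟨?_, fun x hx => ?_⟩
      · simpa [NatExpr.eval] using (f₅.nat rfl 0).trans hP.1
      · have := (f₅.nat (a := aAlive) rfl x).trans (hP.2 x hx)
        simp only [RamState.writeNat_nat, this, NatExpr.eval, hj₅]
        rcases eq_or_ne x j with rfl | hxj
        · simp [hb']
        · simp [show x < j + 1 ↔ x < j by omega, hxj]
    · simp [notInBall, RamTest.time, NatExpr.time, RealExpr.time]; omega
  · rintro s' - ⟨hc, ha⟩
    refine ⟨hc, fun V' hV' x hx => ?_⟩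
    rw [ha x hx]
    simp [hV', hx]
  · simp only [NatExpr.time]
    have h₁ := Nat.pow_le_pow_right hn (show 1 ≤ 3 by omega)
    have h₂ := Nat.pow_le_pow_right hn (show 2 ≤ 3 by omega)
    have h₃ := Nat.one_le_pow 3 _ hn
    rw [pow_one] at h₁
    simp only [Nat.reduceAdd]
    omega

theorem runs_findCand (hn : 1 ≤ inp.numPoints)
    (hw : ∀ x < inp.numPoints, s.real rWeight x = inp.weight S x)
    (ha : s.nat aLead (s.nat vStep 0) < inp.numPoints) :
    Runs inp coins (findCand c₁) s (1100 * inp.numPoints ^ 4) fun s' =>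
      s'.nat vCand 0 = inp.candidate (c₁ * inp.budget) S (s.nat aLead (s.nat vStep 0)) := by
  classical
  refine Runs.mono (Runs.seq (Runs.forLoop_pow (c := 10) (a := 0) le_rfl hn
    (fun j s' => ∀ x < j, s'.nat aAlive x = 1) (fun _ _ => rfl) rfl ?_ ?_) fun s₁ f₁ h₁ =>
    Runs.seq (Runs.setReal (Q := fun s' => s'.real rTotal 0 = 0) ?_) fun s₂ f₂ h₂ =>
    Runs.seq (Runs.forLoop_pow (c := 20) (a := 0) le_rfl hn
    (fun j s' => s'.real rTotal 0 = ∑ x ∈ range j, inp.weight S x) (fun _ _ => rfl) rfl ?_ ?_)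
    fun s₃ f₃ h₃ =>
    (Runs.forLoop_pow (c := 800) (a := 3) (show s.nat aLead (s.nat vStep 0) + 1 ≤ _ from ha) hn
    (fun j s' => StoresAlive inp (inp.alive (c₁ * inp.budget) S j) s' ∧
      ∀ r, j = r + 1 → s'.nat vCand 0 = inp.candidate (c₁ * inp.budget) S r)
      ?_ rfl ?_ ?_).post ?_) ?_
  · simp
  · intro j hj s' hf hz hP
    refine Runs.mono (Runs.setNat ?_) (show _ ≤ 10 * _ ^ 0 from ?_)
    · intro x hx
      obtain rfl | h : x = j ∨ x < j := by omega
      · simp [NatExpr.eval, hz]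
      · simp [hP x h, NatExpr.eval]
    · simp [NatExpr.time]
  · simp [RealExpr.eval, NatExpr.eval]
  · simp [h₂]
  · intro j hj s' hf hz hP
    refine Runs.mono (Runs.setReal ?_) (show _ ≤ 20 * _ ^ 0 from ?_)
    · have hW : s'.real rWeight j = inp.weight S j := by
        rw [hf.real rfl, f₂.real rfl, f₁.real rfl, hw j hj]
      simp [RealExpr.eval, NatExpr.eval, sum_range_succ, hP, hz, hW]
    · simp [NatExpr.time, RealExpr.time]
  · intro s' hf
    simp only [NatExpr.eval]
    rw [hf.nat rfl, hf.nat rfl, f₃.nat rfl, f₃.nat rfl, f₂.nat rfl, f₂.nat rfl, f₁.nat rfl,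
      f₁.nat rfl]
  · refine ⟨fun x hx => ?_, by simp⟩
    have : s₃.nat aAlive x = 1 := by rw [f₃.nat rfl, f₂.nat rfl, h₁ x hx]
    simp [this, alive, hx]
  · intro j hj s' hf hz hP
    have hw' : StoresWeight inp S s' :=
      ⟨fun x hx => by rw [hf.real rfl, f₃.real rfl, f₂.real rfl, f₁.real rfl, hw x hx],
        by rw [hf.real rfl, h₃, totalWeight]⟩
    refine (runs_round hn hw' hP.1 (alive_subset j)).post fun s'' f'' h'' => ⟨?_, ?_⟩
    · have := h''.2 (inp.alive (c₁ * inp.budget) S (j + 1)) fun f => by simp [alive]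
      intro x hx
      simpa using this x hx
    · rintro r hr
      obtain rfl : j = r := by omega
      simpa [candidate] using h''.1
  · rintro s' - ⟨-, hc⟩
    exact hc _ rfl
  · simp only [NatExpr.time, RealExpr.time]
    have h₁ := Nat.pow_le_pow_right hn (show 1 ≤ 4 by omega)
    have h₃ := Nat.one_le_pow 4 _ hn
    simp only [Nat.reduceAdd]
    omega

end Specs

end RamProg

namespace RamProg

/-- Mark in the array `aElig` the facilities of the guessed type that are not selected, and compute
their distances to `vCand`. -/
def markEligible : RamProg :=
  forLoop vC .numPoints
    (.seq (.setReal rVal (.var vC) (.dist (.var vCand) (.var vC)))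
      (.seq (.setNat aElig (.var vC) (.const 0))
        (.ite (.natLe (.const 1) (.isFacility (.var vC)))
          (.ite (.natLe (.load aSel (.var vC)) (.const 0))
            (.ite (.natLe (.load aTyp (.var vC)) (.load aKind (.var vStep)))
              (.ite (.natLe (.load aKind (.var vStep)) (.load aTyp (.var vC)))
                (.setNat aElig (.var vC) (.const 1)) .skip) .skip) .skip) .skip)))

/-- Select the facility given by `vNear` and update the weights. -/
def addFacility : RamProg :=
  .seq (.setNat aSel (.sub (.var vNear) (.const 1)) (.const 1))
    (.seq (forLoop vY .numPoints
      (.ite (.natLe (.const 1) (.isClient (.var vY)))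
        (.ite (.natLe (.var vNum) (.const 0))
          (.setReal rWeight (.var vY) (.dist (.var vY) (.sub (.var vNear) (.const 1))))
          (.ite (.realLe (.load rWeight (.var vY))
              (.dist (.var vY) (.sub (.var vNear) (.const 1)))) .skip
            (.setReal rWeight (.var vY) (.dist (.var vY) (.sub (.var vNear) (.const 1))))))
        .skip))
      (setVar vNum (.add (.var vNum) (.const 1))))

/-- Extend the selection by one facility. -/
def extendStep (c₁ : ℕ) : RamProg :=
  .seq (findCand c₁) (.seq markEligible (.seq findMin
    (.ite (.natLe (.const 1) (.var vNear)) addFacility .skip)))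

/-- Compute the selection for the guesses in the arrays `aLead` and `aKind`. -/
def select (c₁ : ℕ) : RamProg :=
  .seq (forLoop vY .numPoints
      (.seq (.setNat aSel (.var vY) (.const 0))
        (.setReal rWeight (.var vY) (.ofNat (.isClient (.var vY))))))
    (.seq (setVar vNum (.const 0)) (forLoop vStep .budget (extendStep c₁)))

/-- Test whether the selection is a solution. -/
def checkFeasible : RamProg :=
  .seq (setVar vOk (.const 1))
    (.seq (.ite (.natLe (.var vNum) .budget)
        (.ite (.natLe .budget (.var vNum)) .skip (setVar vOk (.const 0))) (setVar vOk (.const 0)))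
      (forLoop vGroup .numGroups
        (.seq (setVar vCnt (.const 0))
          (.seq (forLoop vY .numPoints
              (.ite (.natLe (.const 1) (.load aSel (.var vY)))
                (setVar vCnt (.add (.var vCnt) (.inGroup (.var vY) (.var vGroup)))) .skip))
            (.ite (.natLe (.req (.var vGroup)) (.var vCnt)) .skip (setVar vOk (.const 0)))))))

/-- Make the selection the output. -/
def save : RamProg :=
  .seq (.setReal rBest (.const 0) (.load rCost (.const 0)))
    (.seq (setVar vHave (.const 1))
      (forLoop vY .numPoints (.setNat aOut (.var vY) (.load aSel (.var vY)))))

/-- Make the selection the output if it is the best solution so far. -/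
def compare : RamProg :=
  .seq checkFeasible
    (.seq (.setReal rCost (.const 0) (.ofNat (.const 0)))
      (.seq (forLoop vY .numPoints
          (.setReal rCost (.const 0) (.add (.load rCost (.const 0)) (.load rWeight (.var vY)))))
        (.ite (.natLe (.const 1) (.var vOk))
          (.ite (.natLe (.const 1) (.var vHave))
            (.ite (.realLe (.load rCost (.const 0)) (.load rBest (.const 0))) save .skip)
            save)
          .skip)))

section Specs

variable {inp : RamInput} {coins : ℕ → Bool} {s : RamState} {S V : Finset ℕ} {c₁ : ℕ}
  {typ : ℕ → ℕ}

open RamInput Finset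

/-- The points with entry one in the array `aSel` are those of `S`, and the other data on the
selection are right. -/
structure StoresSel (inp : RamInput) (S : Finset ℕ) (s : RamState) : Prop where
  sel : ∀ x < inp.numPoints, s.nat aSel x = if x ∈ S then 1 else 0
  num : s.nat vNum 0 = #S
  weight : ∀ x < inp.numPoints, s.real rWeight x = inp.weight S x

theorem StoresSel.frame {p : RamProg} {s' : RamState} (h : StoresSel inp S s)
    (hf : Frame p s s') (h₁ : p.mods aSel = false) (h₂ : p.mods vNum = false)
    (h₃ : p.mods rWeight = false) : StoresSel inp S s' :=
  ⟨fun x hx => by rw [hf.nat h₁, h.sel x hx], by rw [hf.nat h₂, h.num],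
    fun x hx => by rw [hf.real h₃, h.weight x hx]⟩

theorem StoresSel.writeNat (h : StoresSel inp S s) {a : ℕ} (h₁ : aSel ≠ a) (h₂ : vNum ≠ a)
    (i v : ℕ) : StoresSel inp S (s.writeNat a i v) :=
  ⟨by rw [s.writeNat_frame a i v h₁]; exact h.sel, by rw [s.writeNat_frame a i v h₂]; exact h.num,
    h.weight⟩

theorem runs_markEligible (hn : 1 ≤ inp.numPoints) (h01 : ∀ x, inp.isFacility x ≤ 1)
    (hS : ∀ x < inp.numPoints, s.nat aSel x = if x ∈ S then 1 else 0)
    (ht : ∀ x, s.nat aTyp x = typ x) {τ : ℕ} (hτ : s.nat aKind (s.nat vStep 0) = τ) :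
    Runs inp coins markEligible s (200 * inp.numPoints) fun s' =>
      (∀ x < inp.numPoints, 1 ≤ s'.nat aElig x ↔ inp.Eligible typ S τ x) ∧
      ∀ x < inp.numPoints, s'.real rVal x = inp.dist (s.nat vCand 0) x := by
  classical
  refine Runs.mono (Runs.forLoop_pow (c := 100) (a := 0) le_rfl hn
    (fun j s' => (∀ x < j, 1 ≤ s'.nat aElig x ↔ inp.Eligible typ S τ x) ∧
      ∀ x < j, s'.real rVal x = inp.dist (s.nat vCand 0) x) (fun _ _ => rfl) rfl ?_ ?_) ?_
  · simp
  · intro j hj s' hf hz hP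
    have hc : s'.nat vCand 0 = s.nat vCand 0 := hf.nat rfl 0
    have hk : s'.nat aKind (s'.nat vStep 0) = τ := by rw [hf.nat rfl, hf.nat rfl, hτ]
    have hs : s'.nat aSel j = if j ∈ S then 1 else 0 := by rw [hf.nat rfl, hS j hj]
    have ht' : s'.nat aTyp j = typ j := by rw [hf.nat rfl, ht]
    have hfac := h01 j
    have key : ∀ s'' : RamState, (∀ x < j, s''.nat aElig x = s'.nat aElig x) →
        (∀ x < j, s''.real rVal x = s'.real rVal x) →
        s''.real rVal j = inp.dist (s.nat vCand 0) j →
        (1 ≤ s''.nat aElig j ↔ inp.Eligible typ S τ j) →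
        (∀ x < j + 1, 1 ≤ (s''.writeNat vC 0 (j + 1)).nat aElig x ↔ inp.Eligible typ S τ x) ∧
        ∀ x < j + 1, (s''.writeNat vC 0 (j + 1)).real rVal x = inp.dist (s.nat vCand 0) x := by
      intro s'' h₁ h₂ h₃ h₄
      refine ⟨fun x hx => ?_, fun x hx => ?_⟩
      · obtain rfl | hxj : x = j ∨ x < j := by omega
        · simpa using h₄
        · simpa [h₁ x hxj] using hP.1 x hxj
      · obtain rfl | hxj : x = j ∨ x < j := by omega
        · simpa using h₃
        · simpa [h₂ x hxj] using hP.2 x hxj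
    refine Runs.mono (Runs.seq (Runs.setReal (Q := fun s₁ => s₁ = s'.writeReal rVal j
      (inp.dist (s.nat vCand 0) j)) ?_) fun s₁ f₁ h₁ => Runs.seq (Runs.setNat (Q := fun s₂ =>
        s₂ = (s'.writeReal rVal j (inp.dist (s.nat vCand 0) j)).writeNat aElig j 0) ?_)
      fun s₂ f₂ h₂ => Runs.ite (fun hb => Runs.ite (fun hb₁ => Runs.ite (fun hb₂ =>
        Runs.ite (fun hb₃ => Runs.setNat ?_) fun hb₃ => Runs.skip ?_) fun hb₂ => Runs.skip ?_)
        fun hb₁ => Runs.skip ?_) fun hb => Runs.skip ?_) ?_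
    · simp [RealExpr.eval, NatExpr.eval, hz, hc]
    · simp [h₁, NatExpr.eval, hz]
    rotate_right
    · simp [RamTest.time, NatExpr.time, RealExpr.time]
    all_goals
      subst h₂
      simp only [RamTest.Holds, NatExpr.eval, RamState.writeNat_nat, RamState.writeReal_nat,
        Nat.reduceEqDiff, false_and, if_false, hz] at hb
    any_goals
      simp only [RamTest.Holds, NatExpr.eval, RamState.writeNat_nat, RamState.writeReal_nat,
        Nat.reduceEqDiff, false_and, if_false, hz, hs] at hb₁
    any_goals
      simp only [RamTest.Holds, NatExpr.eval, RamState.writeNat_nat, RamState.writeReal_nat,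
        Nat.reduceEqDiff, false_and, if_false, hz, ht', hk] at hb₂
    any_goals
      simp only [RamTest.Holds, NatExpr.eval, RamState.writeNat_nat, RamState.writeReal_nat,
        Nat.reduceEqDiff, false_and, if_false, hz, ht', hk] at hb₃
    all_goals
      refine key _ (fun x hx => ?_) (fun x hx => ?_) ?_ ?_
      · simp [NatExpr.eval, hz, hx.ne]
      · simp [hx.ne]
      · simp
    · have h₁ : j ∉ S := fun h => by simp [h] at hb₁
      simp [NatExpr.eval, hz, Eligible, h₁]
      omega
    · simp [Eligible]
      omega
    · simp [Eligible]
      omega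
    · have h₁ : j ∈ S := by
        by_contra h
        simp [h] at hb₁
      simp [Eligible, h₁]
    · simp [Eligible]
      omega
  · simp only [NatExpr.time]
    simp only [Nat.reduceAdd, pow_one]
    omega

theorem runs_addFacility (hn : 1 ≤ inp.numPoints) (h01 : ∀ x, inp.isClient x ≤ 1)
    (hS : StoresSel inp S s) {g : ℕ} (hg : s.nat vNear 0 = g + 1) (hgS : g ∉ S) :
    Runs inp coins addFacility s (200 * inp.numPoints) fun s' =>
      StoresSel inp (insert g S) s' := by
  refine Runs.mono (Runs.seq (Runs.setNat (Q := fun s' => s' = s.writeNat aSel g 1) ?_)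
    fun s₁ f₁ h₁ => Runs.seq (Runs.forLoop_pow (c := 80) (a := 0) le_rfl hn
    (fun j s' => (∀ x < j, s'.real rWeight x = inp.weight (insert g S) x) ∧
      ∀ x < inp.numPoints, j ≤ x → s'.real rWeight x = inp.weight S x) (fun _ _ => rfl) rfl ?_ ?_)
      fun s₂ f₂ h₂ => Runs.setNat ?_) ?_
  · simp [NatExpr.eval, hg]
  · subst h₁
    simpa using hS.weight
  · intro j hj s' hf hz hP
    have hg' : s'.nat vNear 0 = g + 1 := by rw [hf.nat rfl, f₁.nat rfl, hg]
    have hnum : s'.nat vNum 0 = #S := by rw [hf.nat rfl, f₁.nat rfl, hS.num]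
    have hw := hP.2 j hj le_rfl
    have hcl := h01 j
    refine Runs.mono (Runs.ite (fun hb => Runs.ite (fun hb₁ => Runs.setReal ?_) fun hb₁ =>
      Runs.ite (fun hb₂ => Runs.skip ?_) fun hb₂ => Runs.setReal ?_) fun hb => Runs.skip ?_) ?_
    rotate_right
    · simp [RamTest.time, NatExpr.time, RealExpr.time]
    all_goals
      simp only [RamTest.Holds, NatExpr.eval, hz] at hb
    any_goals
      simp only [RamTest.Holds, NatExpr.eval, hnum, nonpos_iff_eq_zero, card_eq_zero] at hb₁
    any_goals
      simp only [RamTest.Holds, NatExpr.eval, RealExpr.eval, hz, hg', hw, Nat.add_sub_cancel,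
        not_le] at hb₂
    all_goals
      try simp only [NatExpr.eval, RealExpr.eval, hz, hg', Nat.add_sub_cancel]
      refine ⟨fun x hx => ?_, fun x hx hx' => ?_⟩
      rotate_left
      · have := hP.2 x hx (by omega)
        simpa [show x ≠ j by omega] using this
      obtain rfl | hxj : x = j ∨ x < j := by omega
      rotate_left
      · simpa [hxj.ne] using hP.1 x hxj
    · have hc : inp.isClient x = 1 := by omega
      simp [RamInput.weight, hc, hb₁, distTo_singleton]
    · have hc : inp.isClient x = 1 := by omega
      simp only [RamInput.weight, hc, if_true] at hb₂ hw
      simp [RamInput.weight, hc, distTo_insert x g (nonempty_iff_ne_empty.2 hb₁), hw, hb₂]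
    · have hc : inp.isClient x = 1 := by omega
      simp only [RamInput.weight, hc, if_true] at hb₂ hw
      simp [RamInput.weight, hc, distTo_insert x g (nonempty_iff_ne_empty.2 hb₁), hb₂.le]
    · have hc : inp.isClient x ≠ 1 := by omega
      simp only [RamInput.weight, hc, if_false] at hw
      simp [RamInput.weight, hc, hw]
  · have hnum : s₂.nat vNum 0 = #S := by rw [f₂.nat rfl, f₁.nat rfl, hS.num]
    refine ⟨fun x hx => ?_, ?_, fun x hx => ?_⟩
    · have : s₂.nat aSel x = s₁.nat aSel x := f₂.nat rfl x
      have := hS.sel x hx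
      by_cases hxg : x = g <;> simp_all [NatExpr.eval]
    · simp [NatExpr.eval, hnum, card_insert_of_notMem hgS]
    · simpa using h₂.1 x hx
  · simp only [NatExpr.time]
    simp only [Nat.reduceAdd, pow_one]
    omega

theorem runs_extendStep (hn : 1 ≤ inp.numPoints) (hF : ∀ x, inp.isFacility x ≤ 1)
    (hC : ∀ x, inp.isClient x ≤ 1) (hS : StoresSel inp S s) (ht : ∀ x, s.nat aTyp x = typ x)
    (ha : s.nat aLead (s.nat vStep 0) < inp.numPoints) :
    Runs inp coins (extendStep c₁) s (1800 * inp.numPoints ^ 4) fun s' =>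
      StoresSel inp (inp.extend typ (c₁ * inp.budget) S (s.nat aLead (s.nat vStep 0))
        (s.nat aKind (s.nat vStep 0))) s' := by
  refine Runs.mono (Runs.seq (runs_findCand hn hS.weight ha) fun s₁ f₁ h₁ =>
    Runs.seq (runs_markEligible (typ := typ) (τ := s.nat aKind (s.nat vStep 0)) hn hF
      (hS.frame f₁ rfl rfl rfl).sel (fun x => ?_) ?_) fun s₂ f₂ h₂ =>
    Runs.seq (runs_findMin hn h₂.1 h₂.2) fun s₃ f₃ h₃ => ?_) (T₁ := 1100 * inp.numPoints ^ 4 +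
      (200 * inp.numPoints + (100 * inp.numPoints + (4 + max (200 * inp.numPoints) 1)))) ?_
  · rw [f₁.nat rfl, ht]
  · rw [f₁.nat rfl, f₁.nat rfl]
  · rw [h₁] at h₃
    have hS₃ := ((hS.frame f₁ rfl rfl rfl).frame f₂ rfl rfl rfl).frame f₃ rfl rfl rfl
    rw [extend]
    have hspec := (argmin_spec (inp.Eligible typ S (s.nat aKind (s.nat vStep 0))) (inp.dist
      (inp.candidate (c₁ * inp.budget) S (s.nat aLead (s.nat vStep 0)))) inp.numPoints).1
    generalize argmin (inp.Eligible typ S (s.nat aKind (s.nat vStep 0))) (inp.dist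
      (inp.candidate (c₁ * inp.budget) S (s.nat aLead (s.nat vStep 0)))) inp.numPoints = o at *
    refine Runs.ite (fun hb => ?_) fun hb => Runs.skip ?_
    · cases o with
      | none => simp [RamTest.Holds, NatExpr.eval, h₃] at hb
      | some g =>
        refine (runs_addFacility hn hC hS₃ (by simpa using h₃) (hspec g rfl).2.1.2.1).post
          fun s' _ h => ?_
        rwa [Option.toFinset_some, union_comm, ← insert_eq]
    · cases o with
      | none => simpa using hS₃
      | some g => simp [RamTest.Holds, NatExpr.eval, h₃] at hb
  · have h₁ := Nat.pow_le_pow_right hn (show 1 ≤ 4 by omega)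
    rw [pow_one] at h₁
    omega

theorem runs_select (hn : 1 ≤ inp.numPoints) (hF : ∀ x, inp.isFacility x ≤ 1)
    (hC : ∀ x, inp.isClient x ≤ 1) (hk : inp.budget ≤ inp.numPoints)
    (ht : ∀ x, s.nat aTyp x = typ x) (ha : ∀ i < inp.budget, s.nat aLead i < inp.numPoints) :
    Runs inp coins (select c₁) s (2000 * inp.numPoints ^ 5) fun s' => StoresSel inp
      (inp.selection typ (c₁ * inp.budget) (s.nat aLead) (s.nat aKind) inp.budget) s' := by
  refine Runs.mono (Runs.seq (Runs.forLoop_pow (c := 20) (a := 0) le_rfl hn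
    (fun j s' => (∀ x < j, s'.nat aSel x = 0) ∧ ∀ x < j, s'.real rWeight x = inp.weight ∅ x)
    (fun _ _ => rfl) rfl ?_ ?_) fun s₁ f₁ h₁ =>
    Runs.seq (Runs.setNat (Q := StoresSel inp ∅) ?_) fun s₂ f₂ h₂ =>
    Runs.forLoop_pow (c := 1800) (a := 4) hk hn
      (fun j s' => StoresSel inp (inp.selection typ (c₁ * inp.budget) (s.nat aLead) (s.nat aKind) j)
        s') (fun _ _ => rfl) rfl ?_ ?_) ?_
  · simp
  · intro j hj s' hf hz hP
    have hcl := hC j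
    refine Runs.mono (Runs.seq (Runs.setNat (Q := fun s'' => s'' = s'.writeNat aSel j 0) ?_)
      fun s₁ f₁ h₁ => Runs.setReal ?_) ?_
    · simp [NatExpr.eval, hz]
    · subst h₁
      have hw : (inp.isClient j : ℝ) = inp.weight ∅ j := by
        rw [RamInput.weight]
        split_ifs with h
        · simp [h, distTo]
        · simp [show inp.isClient j = 0 by omega]
      refine ⟨fun x hx => ?_, fun x hx => ?_⟩
      · obtain rfl | hxj : x = j ∨ x < j := by omega
        · simp [NatExpr.eval, hz]
        · simpa [NatExpr.eval, hz, hxj.ne] using hP.1 x hxj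
      · obtain rfl | hxj : x = j ∨ x < j := by omega
        · simp [NatExpr.eval, RealExpr.eval, hz, hw]
        · simpa [NatExpr.eval, hz, hxj.ne] using hP.2 x hxj
    · simp [NatExpr.time, RealExpr.time]
  · exact ⟨by simpa using h₁.1, by simp [NatExpr.eval], by simpa using h₁.2⟩
  · exact h₂.writeNat (by decide) (by decide) _ _
  · intro j hj s' hf hz hP
    have hl : ∀ x, s'.nat aLead x = s.nat aLead x := fun x => by
      rw [hf.nat rfl, f₂.nat rfl, f₁.nat rfl]
    have hk' : ∀ x, s'.nat aKind x = s.nat aKind x := fun x => by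
      rw [hf.nat rfl, f₂.nat rfl, f₁.nat rfl]
    refine (runs_extendStep (typ := typ) hn hF hC hP (fun x => ?_) ?_).post fun s'' f'' h'' => ?_
    · rw [hf.nat rfl, f₂.nat rfl, f₁.nat rfl, ht]
    · rw [hl, hz]
      exact ha j hj
    · rw [hl, hk', hz] at h''
      rw [selection]
      exact h''.writeNat (by decide) (by decide) _ _
  · simp only [NatExpr.time]
    have h₁ := Nat.pow_le_pow_right hn (show 1 ≤ 5 by omega)
    rw [pow_one] at h₁
    simp only [Nat.reduceAdd, pow_one]
    omega

/-- The set `S` of facilities satisfies the cardinality and group constraints. -/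
def Good (inp : RamInput) (S : Finset ℕ) : Prop :=
  #S = inp.budget ∧ ∀ g < inp.numGroups,
    inp.req g ≤ ∑ y ∈ range inp.numPoints, if y ∈ S then inp.inGroup y g else 0

theorem runs_checkFeasible (hn : 1 ≤ inp.numPoints) (hS : StoresSel inp S s) :
    Runs inp coins checkFeasible s (300 * inp.numPoints * (inp.numGroups + 1)) fun s' =>
      (1 ≤ s'.nat vOk 0 ↔ Good inp S) := by
  refine Runs.mono (Runs.seq (Runs.setNat (Q := fun s' => s'.nat vOk 0 = 1) ?_) fun s₁ f₁ h₁ =>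
    Runs.seq (Runs.ite (Q := fun s' => 1 ≤ s'.nat vOk 0 ↔ #S = inp.budget)
      (fun hb => Runs.ite (fun hb₁ => Runs.skip ?_) fun hb₁ => Runs.setNat ?_)
      fun hb => Runs.setNat ?_) fun s₂ f₂ h₂ =>
    (Runs.forLoop (T := 150 * inp.numPoints) inp.numGroups
      (fun j s' => 1 ≤ s'.nat vOk 0 ↔ #S = inp.budget ∧ ∀ g < j,
        inp.req g ≤ ∑ y ∈ range inp.numPoints, if y ∈ S then inp.inGroup y g else 0)
      (fun _ _ => rfl) rfl ?_ ?_)) ?_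
  · simp [NatExpr.eval]
  any_goals
    have hnum : s₁.nat vNum 0 = #S := by rw [f₁.nat rfl, hS.num]
    simp only [RamTest.Holds, NatExpr.eval, hnum, RamState.writeNat_nat, and_self, if_true,
      h₁] at *
    omega
  · simpa using h₂
  · intro j hj s' hf hz hP
    refine Runs.mono (Runs.seq (Runs.setNat (Q := fun s' => s'.nat vCnt 0 = 0) ?_) fun s₃ f₃ h₃ =>
      Runs.seq (Runs.forLoop_pow (c := 30) (a := 0) le_rfl hn
        (fun i s' => s'.nat vCnt 0 = ∑ y ∈ range i, if y ∈ S then inp.inGroup y j else 0)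
        (fun _ _ => rfl) rfl ?_ ?_) fun s₄ f₄ h₄ =>
      Runs.ite (fun hb => Runs.skip ?_) fun hb => Runs.setNat ?_) ?_
    · simp [NatExpr.eval]
    · simp [h₃]
    · intro i hi s₅ f₅ hz₅ hP₅
      have hj₅ : s₅.nat vGroup 0 = j := by rw [f₅.nat rfl, f₃.nat rfl, hz]
      have hs₅ : s₅.nat aSel i = if i ∈ S then 1 else 0 := by
        rw [f₅.nat rfl, f₃.nat rfl, hf.nat rfl, f₂.nat rfl, f₁.nat rfl, hS.sel i hi]
      refine Runs.mono (Runs.ite (fun hb => Runs.setNat ?_) fun hb => Runs.skip ?_) ?_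
      · have : i ∈ S := by
          by_contra h
          simp [RamTest.Holds, NatExpr.eval, hz₅, hs₅, h] at hb
        simp [-sum_ite_mem, NatExpr.eval, sum_range_succ, this, hP₅, hz₅, hj₅]
      · have : i ∉ S := fun h => by
          simp [RamTest.Holds, NatExpr.eval, hz₅, hs₅, h] at hb
        simp [-sum_ite_mem, sum_range_succ, this, hP₅]
      · simp [RamTest.time, NatExpr.time]
    · have hj₄ : s₄.nat vGroup 0 = j := by rw [f₄.nat rfl, f₃.nat rfl, hz]
      have ho₄ : s₄.nat vOk 0 = s'.nat vOk 0 := by rw [f₄.nat rfl, f₃.nat rfl]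
      simp only [RamTest.Holds, NatExpr.eval, hj₄, h₄] at hb
      simp only [RamState.writeNat_nat, Nat.reduceEqDiff, false_and, if_false, ho₄, hP]
      rw [Nat.forall_lt_succ_right]
      tauto
    · have hj₄ : s₄.nat vGroup 0 = j := by rw [f₄.nat rfl, f₃.nat rfl, hz]
      simp only [RamTest.Holds, NatExpr.eval, hj₄, h₄] at hb
      simp only [RamState.writeNat_nat, NatExpr.eval, Nat.reduceEqDiff, false_and, if_false,
        and_self, if_true]
      rw [Nat.forall_lt_succ_right]
      simp [-sum_ite_mem, hb]
    · simp [RamTest.time, NatExpr.time]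
      omega
  · simp [RamTest.time, NatExpr.time]
    nlinarith

/-- The output is the best solution among the sets with `P`. -/
structure StoresBest (inp : RamInput) (P : Finset ℕ → Prop) (s : RamState) : Prop where
  exists_good : 1 ≤ s.nat vHave 0 → ∃ S ⊆ inp.facilitySet, Good inp S ∧
    (∀ x < inp.numPoints, s.nat aOut x = if x ∈ S then 1 else 0) ∧
    s.real rBest 0 = inp.totalWeight S
  le : ∀ S, P S → Good inp S → 1 ≤ s.nat vHave 0 ∧ s.real rBest 0 ≤ inp.totalWeight S

theorem StoresBest.mono {P P' : Finset ℕ → Prop} (h : StoresBest inp P s)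
    (hP : ∀ S, P' S → P S) : StoresBest inp P' s :=
  ⟨h.exists_good, fun S hS => h.le S (hP S hS)⟩

theorem StoresBest.frame {P : Finset ℕ → Prop} {p : RamProg} {s' : RamState}
    (h : StoresBest inp P s) (hf : Frame p s s') (h₁ : p.mods vHave = false)
    (h₂ : p.mods aOut = false) (h₃ : p.mods rBest = false) : StoresBest inp P s' := by
  refine ⟨fun hh => ?_, fun S hS hG => ?_⟩
  · rw [hf.nat h₁] at hh
    obtain ⟨S, h₄, h₅, h₆, h₇⟩ := h.exists_good hh
    exact ⟨S, h₄, h₅, fun x hx => by rw [hf.nat h₂, h₆ x hx], by rw [hf.real h₃, h₇]⟩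
  · rw [hf.nat h₁, hf.real h₃]
    exact h.le S hS hG

theorem runs_save (hn : 1 ≤ inp.numPoints)
    (hS : ∀ x < inp.numPoints, s.nat aSel x = if x ∈ S then 1 else 0)
    (hc : s.real rCost 0 = inp.totalWeight S) :
    Runs inp coins save s (100 * inp.numPoints) fun s' => s'.nat vHave 0 = 1 ∧
      (∀ x < inp.numPoints, s'.nat aOut x = if x ∈ S then 1 else 0) ∧
      s'.real rBest 0 = inp.totalWeight S := by
  refine Runs.mono (Runs.seq (Runs.setReal (Q := fun s' => s'.real rBest 0 = inp.totalWeight S) ?_)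
    fun s₁ f₁ h₁ => Runs.seq (Runs.setNat (Q := fun s' => s'.nat vHave 0 = 1) ?_)
    fun s₂ f₂ h₂ => (Runs.forLoop_pow (c := 20) (a := 0) le_rfl hn
      (fun j s' => ∀ x < j, s'.nat aOut x = if x ∈ S then 1 else 0)
      (fun _ _ => rfl) rfl ?_ ?_).post ?_) ?_
  · simp [NatExpr.eval, RealExpr.eval, hc]
  · simp [NatExpr.eval]
  · simp
  · intro j hj s' hf hz hP
    have hs : s'.nat aSel j = if j ∈ S then 1 else 0 := by
      rw [hf.nat rfl, f₂.nat rfl, f₁.nat rfl, hS j hj]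
    refine Runs.mono (Runs.setNat ?_) (show _ ≤ 20 * _ ^ 0 from ?_)
    · intro x hx
      obtain rfl | hxj : x = j ∨ x < j := by omega
      · simp [NatExpr.eval, hz, hs]
      · simpa [NatExpr.eval, hz, hxj.ne] using hP x hxj
    · simp [NatExpr.time]
  · intro s' f' h'
    exact ⟨by rw [f'.nat rfl, h₂], h', by rw [f'.real rfl, f₂.real rfl, h₁]⟩
  · simp only [NatExpr.time, RealExpr.time]
    simp only [Nat.reduceAdd, pow_one]
    omega

theorem runs_compare {P : Finset ℕ → Prop} (hn : 1 ≤ inp.numPoints) (hS : StoresSel inp S s)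
    (hSF : S ⊆ inp.facilitySet) (hP : StoresBest inp P s) :
    Runs inp coins RamProg.compare s (700 * inp.numPoints * (inp.numGroups + 1)) fun s' =>
      StoresBest inp (fun S' => P S' ∨ S' = S) s' := by
  refine Runs.mono (Runs.seq (runs_checkFeasible hn hS) fun s₁ f₁ h₁ =>
    Runs.seq (Runs.setReal (Q := fun s' => s'.real rCost 0 = 0) ?_) fun s₂ f₂ h₂ =>
    Runs.seq (Runs.forLoop_pow (c := 20) (a := 0) le_rfl hn
    (fun j s' => s'.real rCost 0 = ∑ x ∈ range j, inp.weight S x) (fun _ _ => rfl) rfl ?_ ?_)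
    fun s₃ f₃ h₃ => Runs.ite (fun hb => Runs.ite (fun hb₁ => Runs.ite (fun hb₂ =>
      (runs_save (S := S) hn ?_ h₃).post ?_) fun hb₂ => Runs.skip ?_) fun hb₁ =>
      (runs_save (S := S) hn ?_ h₃).post ?_) fun hb => Runs.skip ?_) ?_
  · simp [RealExpr.eval, NatExpr.eval]
  · simp [h₂]
  · intro j hj s' hf hz hP
    refine Runs.mono (Runs.setReal ?_) (show _ ≤ 20 * _ ^ 0 from ?_)
    · have hW : s'.real rWeight j = inp.weight S j := by
        rw [hf.real rfl, f₂.real rfl, f₁.real rfl, hS.weight j hj]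
      simp [RealExpr.eval, NatExpr.eval, sum_range_succ, hP, hz, hW]
    · simp [NatExpr.time, RealExpr.time]
  all_goals try
    have hP₃ := ((hP.frame f₁ rfl rfl rfl).frame f₂ rfl rfl rfl).frame f₃ rfl rfl rfl
    have hS₃ := ((hS.frame f₁ rfl rfl rfl).frame f₂ rfl rfl rfl).frame f₃ rfl rfl rfl
    have hO₃ : s₃.nat vOk 0 = s₁.nat vOk 0 := by rw [f₃.nat rfl, f₂.nat rfl]
    simp only [RamTest.Holds, NatExpr.eval, RealExpr.eval, hO₃, h₁] at *
  · exact hS₃.sel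
  · rintro s' - ⟨h₄, h₅, h₆⟩
    refine ⟨fun _ => ⟨S, hSF, hb, h₅, h₆⟩, fun S' hS' hG => ⟨by omega, ?_⟩⟩
    rw [h₆]
    rcases hS' with hS' | rfl
    · rw [totalWeight, ← h₃]
      exact hb₂.trans (hP₃.le S' hS' hG).2
    · exact le_rfl
  · refine ⟨hP₃.exists_good, fun S' hS' hG => ?_⟩
    rcases hS' with hS' | rfl
    · exact hP₃.le S' hS' hG
    · refine ⟨hb₁, ?_⟩
      rw [totalWeight, ← h₃]
      exact (not_le.1 hb₂).le
  · exact hS₃.sel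
  · rintro s' - ⟨h₄, h₅, h₆⟩
    refine ⟨fun _ => ⟨S, hSF, hb, h₅, h₆⟩, fun S' hS' hG => ⟨by omega, ?_⟩⟩
    rw [h₆]
    rcases hS' with hS' | rfl
    · exact absurd (hP₃.le S' hS' hG).1 hb₁
    · exact le_rfl
  · refine ⟨hP₃.exists_good, fun S' hS' hG => ?_⟩
    rcases hS' with hS' | rfl
    · exact hP₃.le S' hS' hG
    · exact absurd hG hb
  · simp [RamTest.time, NatExpr.time, RealExpr.time]
    have := Nat.le_mul_of_pos_right inp.numPoints (Nat.succ_pos inp.numGroups)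
    simp only [mul_assoc, Nat.succ_eq_add_one] at *
    omega

end Specs

end RamProg

namespace RamProg

/-- Set `vSame` to one if the point `vX` and the representative number `vRep` belong to the same
groups, and to zero otherwise. -/
def compareGroups : RamProg :=
  .seq (setVar vSame (.const 1))
    (forLoop vGroup .numGroups
      (.ite (.natLe (.inGroup (.var vX) (.var vGroup))
          (.inGroup (.load aRep (.var vRep)) (.var vGroup)))
        (.ite (.natLe (.inGroup (.load aRep (.var vRep)) (.var vGroup))
            (.inGroup (.var vX) (.var vGroup))) .skip (setVar vSame (.const 0)))
        (setVar vSame (.const 0))))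

/-- Look for a representative that belongs to the same groups as the point `vX`. The result is its
number plus one, or zero if there is none. -/
def findType : RamProg :=
  .seq (setVar vFound (.const 0))
    (forLoop vRep (.var vTypes)
      (.seq compareGroups
        (.ite (.natLe (.const 1) (.var vSame)) (setVar vFound (.add (.var vRep) (.const 1)))
          .skip)))

/-- Compute the types of the facilities. -/
def classify : RamProg :=
  forLoop vX .numPoints
    (.ite (.natLe (.const 1) (.isFacility (.var vX)))
      (.seq findType
        (.ite (.natLe (.const 1) (.var vFound))
          (.setNat aTyp (.var vX) (.sub (.var vFound) (.const 1)))
          (.seq (.setNat aRep (.var vTypes) (.var vX))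
            (.seq (.setNat aTyp (.var vX) (.var vTypes))
              (setVar vTypes (.add (.var vTypes) (.const 1)))))))
      .skip)

/-- Compute the binary length of the number of points. -/
def logarithm : RamProg :=
  .seq (setVar vLog (.const 0))
    (.seq (setVar vPow (.const 1))
      (forLoop vX .numPoints
        (.ite (.natLe (.var vPow) .numPoints)
          (.seq (setVar vPow (.add (.var vPow) (.var vPow)))
            (setVar vLog (.add (.var vLog) (.const 1))))
          .skip)))

/-- Compute the number of candidates. -/
def countCands (c₁ : ℕ) : RamProg :=
  .seq (setVar vCands (.const 0))
    (forLoop vX .numPoints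
      (.ite (.realLe (.ofNat (.add (.var vX) (.const 1)))
          (.mul (.mul (.ofNat (.const c₁)) (.ofNat .budget)) (.ofNat (.var vLog))))
        (setVar vCands (.add (.var vCands) (.const 1))) .skip))

/-- Try all guesses. -/
def search (c₁ : ℕ) : RamProg :=
  enumerate aLead vLeadCarry vLeadIdx (.var vCands) .budget
    (enumerate aKind vKindCarry vKindIdx (.var vTypes) .budget (.seq (select c₁) compare))

/-- The algorithm. -/
def kMedian (c₁ : ℕ) : RamProg :=
  .seq classify (.seq logarithm (.seq (countCands c₁) (search c₁)))

section Specs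

variable {inp : RamInput} {coins : ℕ → Bool} {s : RamState} {S V : Finset ℕ} {c₁ : ℕ}
  {typ : ℕ → ℕ}

open RamInput Finset

/-- Two points belong to the same groups. -/
def SameGroups (inp : RamInput) (x y : ℕ) : Prop :=
  ∀ g < inp.numGroups, inp.inGroup x g = inp.inGroup y g

theorem runs_compareGroups : Runs inp coins compareGroups s (100 * (inp.numGroups + 1)) fun s' =>
      (1 ≤ s'.nat vSame 0 ↔ SameGroups inp (s.nat vX 0) (s.nat aRep (s.nat vRep 0))) := by
  refine Runs.mono (Runs.seq (Runs.setNat (Q := fun s' => s'.nat vSame 0 = 1) ?_) fun s₁ f₁ h₁ =>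
    Runs.forLoop (T := 40) inp.numGroups (fun j s' => 1 ≤ s'.nat vSame 0 ↔
      ∀ g < j, inp.inGroup (s.nat vX 0) g = inp.inGroup (s.nat aRep (s.nat vRep 0)) g)
    (fun _ _ => rfl) rfl ?_ ?_) ?_
  · simp [NatExpr.eval]
  · simp [h₁]
  · intro j hj s' hf hz hP
    have hx : s'.nat vX 0 = s.nat vX 0 := by rw [hf.nat rfl, f₁.nat rfl]
    have hr : s'.nat vRep 0 = s.nat vRep 0 := by rw [hf.nat rfl, f₁.nat rfl]
    have hR : ∀ i, s'.nat aRep i = s.nat aRep i := fun i => by rw [hf.nat rfl, f₁.nat rfl]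
    refine Runs.mono (Runs.ite (fun hb => Runs.ite (fun hb₁ => Runs.skip ?_) fun hb₁ =>
      Runs.setNat ?_) fun hb => Runs.setNat ?_) ?_
    rotate_right
    · simp [RamTest.time, NatExpr.time]
    all_goals
      simp only [RamTest.Holds, NatExpr.eval, hz, hx, hr, hR] at hb
      try simp only [RamTest.Holds, NatExpr.eval, hz, hx, hr, hR] at hb₁
      simp only [RamState.writeNat_nat, Nat.reduceEqDiff, false_and, if_false, and_self, if_true,
        NatExpr.eval]
      rw [Nat.forall_lt_succ_right]
    · have := le_antisymm hb hb₁
      tauto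
    · have := (not_le.1 hb₁).ne
      simp [this]
    · have := (not_le.1 hb).ne'
      simp [this]
  · simp only [NatExpr.time]
    omega

theorem runs_findType (hn : 1 ≤ inp.numPoints) {T : ℕ} (hT : s.nat vTypes 0 = T)
    (hTn : T ≤ inp.numPoints) :
    Runs inp coins findType s (200 * (inp.numGroups + 1) * inp.numPoints) fun s' =>
      (s'.nat vFound 0 = 0 ∧ ∀ r < T, ¬ SameGroups inp (s.nat vX 0) (s.nat aRep r)) ∨
      ∃ r < T, s'.nat vFound 0 = r + 1 ∧ SameGroups inp (s.nat vX 0) (s.nat aRep r) := by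
  refine Runs.mono (Runs.seq (Runs.setNat (Q := fun s' => s'.nat vFound 0 = 0) ?_) fun s₁ f₁ h₁ =>
    Runs.forLoop_pow (c := 120 * (inp.numGroups + 1)) (a := 0) hTn hn (fun j s' =>
      (s'.nat vFound 0 = 0 ∧ ∀ r < j, ¬ SameGroups inp (s.nat vX 0) (s.nat aRep r)) ∨
      ∃ r < T, s'.nat vFound 0 = r + 1 ∧ SameGroups inp (s.nat vX 0) (s.nat aRep r))
    (fun s' hs' => ?_) rfl ?_ ?_) ?_
  · simp [NatExpr.eval]
  · simp only [NatExpr.eval]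
    rw [hs'.nat rfl, f₁.nat rfl, hT]
  · simp [h₁]
  · intro j hj s' hf hz hP
    have hx : s'.nat vX 0 = s.nat vX 0 := by rw [hf.nat rfl, f₁.nat rfl]
    have hR : ∀ i, s'.nat aRep i = s.nat aRep i := fun i => by rw [hf.nat rfl, f₁.nat rfl]
    refine Runs.mono (Runs.seq runs_compareGroups fun s₂ f₂ h₂ =>
      Runs.ite (fun hb => Runs.setNat ?_) fun hb => Runs.skip ?_) ?_
    rotate_right
    · simp [RamTest.time, NatExpr.time]
      omega
    all_goals
      simp only [RamTest.Holds, NatExpr.eval, h₂, hz, hx, hR] at hb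
      have hj₂ : s₂.nat vRep 0 = j := by rw [f₂.nat rfl, hz]
      have hf₂ : s₂.nat vFound 0 = s'.nat vFound 0 := f₂.nat rfl 0
    · exact Or.inr ⟨j, hj, by simp [NatExpr.eval, hj₂], hb⟩
    · simp only [RamState.writeNat_nat, Nat.reduceEqDiff, false_and, if_false, hf₂]
      refine hP.imp_left fun h => ⟨h.1, ?_⟩
      rw [Nat.forall_lt_succ_right]
      exact ⟨h.2, hb⟩
  · simp only [NatExpr.time, Nat.reduceAdd, pow_one]
    nlinarith [Nat.mul_le_mul hn (Nat.succ_pos inp.numGroups)]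

/-- The types of the first `j` points are right. -/
structure Classified (inp : RamInput) (j : ℕ) (s : RamState) : Prop where
  types_le : s.nat vTypes 0 ≤ j
  rep : ∀ r < s.nat vTypes 0, ∀ r' < r, ¬ SameGroups inp (s.nat aRep r) (s.nat aRep r')
  typ : ∀ x < j, inp.isFacility x = 1 → s.nat aTyp x < s.nat vTypes 0 ∧
    SameGroups inp x (s.nat aRep (s.nat aTyp x))

theorem runs_classify (hn : 1 ≤ inp.numPoints) (h01 : ∀ x, inp.isFacility x ≤ 1)
    (hs : s.nat vTypes 0 = 0) :
    Runs inp coins classify s (300 * (inp.numGroups + 1) * inp.numPoints ^ 2)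
      (Classified inp inp.numPoints) := by
  refine Runs.mono (Runs.forLoop_pow (c := 250 * (inp.numGroups + 1)) (a := 1) le_rfl hn
    (fun j s' => Classified inp j s') (fun _ _ => rfl) rfl ?_ ?_) ?_
  · exact ⟨by simp [hs], by simp [hs], by simp⟩
  · intro j hj s' hf hz hP
    have hfac := h01 j
    refine Runs.mono (Runs.ite (fun hb => Runs.seq (runs_findType hn rfl (hP.types_le.trans hj.le))
      fun s₁ f₁ h₁ => Runs.ite (fun hb₁ => Runs.setNat ?_) fun hb₁ =>
        Runs.seq (Runs.setNat (Q := fun s₂ => s₂ = s₁.writeNat aRep (s'.nat vTypes 0) j) ?_)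
        fun s₂ f₂ h₂ => Runs.seq (Runs.setNat (Q := fun s₃ =>
          s₃ = s₂.writeNat aTyp j (s'.nat vTypes 0)) ?_) fun s₃ f₃ h₃ => Runs.setNat ?_)
      fun hb => Runs.skip ?_) ?_
    rotate_right
    · simp [RamTest.time, NatExpr.time]
      nlinarith [Nat.mul_le_mul (Nat.succ_pos inp.numGroups) hn]
    all_goals
      simp only [RamTest.Holds, NatExpr.eval, hz] at hb
    any_goals
      have hT : s₁.nat vTypes 0 = s'.nat vTypes 0 := f₁.nat rfl 0
      have hR : ∀ r, s₁.nat aRep r = s'.nat aRep r := f₁.nat rfl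
      have hY : ∀ r, s₁.nat aTyp r = s'.nat aTyp r := f₁.nat rfl
      have hX : s₁.nat vX 0 = j := by rw [f₁.nat rfl, hz]
      simp only [RamTest.Holds, NatExpr.eval] at hb₁
    · rcases h₁ with h₁ | ⟨r, hr, h₁, hsame⟩
      · omega
      · rw [hz] at hsame
        refine ⟨?_, ?_, fun x hx hxF => ?_⟩
        · have := hP.types_le
          simp [hT]
          omega
        · simpa [hT, hR] using hP.rep
        · simp only [RamState.writeNat_nat, Nat.reduceEqDiff, false_and, if_false, NatExpr.eval, hX,
            hT, hR, hY, h₁, Nat.add_sub_cancel, true_and]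
          split_ifs with hxj
          · exact ⟨hr, hxj ▸ hsame⟩
          · exact hP.typ x (by omega) hxF
    · simp [NatExpr.eval, hT, hX]
    · simp [NatExpr.eval, hT, hX, h₂]
    · rcases h₁ with ⟨h₁, hno⟩ | ⟨r, hr, h₁, hsame⟩
      · rw [hz] at hno
        subst h₂
        subst h₃
        refine ⟨?_, ?_, fun x hx hxF => ?_⟩
        · have := hP.types_le
          simp [hT, NatExpr.eval]
          omega
        · intro r hr r' hr'
          simp only [RamState.writeNat_nat, Nat.reduceEqDiff, false_and, if_false, NatExpr.eval,
            hT, hR, and_self, if_true, true_and] at hr ⊢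
          rw [if_neg (show r' ≠ s'.nat vTypes 0 by omega)]
          split_ifs with hrT
          · exact hno r' (by omega)
          · exact hP.rep r (by omega) r' hr'
        · simp only [RamState.writeNat_nat, Nat.reduceEqDiff, false_and, if_false, NatExpr.eval,
            hT, hR, hY, and_self, if_true, true_and]
          rcases eq_or_ne x j with rfl | hxj
          · simp [SameGroups]
          · have := hP.typ x (by omega) hxF
            rw [if_neg hxj, if_neg this.1.ne]
            exact ⟨by omega, this.2⟩
      · omega
    · refine ⟨?_, ?_, fun x hx hxF => ?_⟩
      · have := hP.types_le
        simp
        omega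
      · simpa using hP.rep
      · have : x ≠ j := by
          rintro rfl
          omega
        simpa using hP.typ x (by omega) hxF
  · simp only [NatExpr.time, Nat.reduceAdd]
    refine Nat.mul_le_mul_right _ ?_
    omega

theorem Classified.types_le_two_pow {j : ℕ} (h : Classified inp j s)
    (h01 : ∀ x g, inp.inGroup x g ≤ 1) : s.nat vTypes 0 ≤ 2 ^ inp.numGroups := by
  have := card_le_card_of_injOn (s := range (s.nat vTypes 0)) (t := (range inp.numGroups).powerset)
    (fun r => {g ∈ range inp.numGroups | inp.inGroup (s.nat aRep r) g = 1})
    (fun r _ => mem_coe.2 (mem_powerset.2 (filter_subset _ _))) ?_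
  · simpa using this
  · have key : ∀ r r', ({g ∈ range inp.numGroups | inp.inGroup (s.nat aRep r) g = 1} : Finset ℕ) =
        {g ∈ range inp.numGroups | inp.inGroup (s.nat aRep r') g = 1} →
        SameGroups inp (s.nat aRep r) (s.nat aRep r') := fun r r' he g hg => by
      have := Finset.ext_iff.1 he g
      simp only [mem_filter, mem_range, hg, true_and] at this
      have := h01 (s.nat aRep r) g
      have := h01 (s.nat aRep r') g
      omega
    intro r hr r' hr' he
    simp only [coe_range, Set.mem_Iio] at hr hr'
    rcases lt_trichotomy r r' with hlt | rfl | hlt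
    · exact absurd (key _ _ he.symm) (h.rep r' hr' r hlt)
    · rfl
    · exact absurd (key _ _ he) (h.rep r hr r' hlt)

theorem runs_logarithm (hn : 1 ≤ inp.numPoints) :
    Runs inp coins logarithm s (100 * inp.numPoints) fun s' =>
      inp.numPoints < 2 ^ s'.nat vLog 0 ∧ 2 ^ s'.nat vLog 0 ≤ 2 * inp.numPoints := by
  refine Runs.mono (Runs.seq (Runs.setNat (Q := fun s' => s'.nat vLog 0 = 0) ?_) fun s₁ f₁ h₁ =>
    Runs.seq (Runs.setNat (Q := fun s' => s'.nat vLog 0 = 0 ∧ s'.nat vPow 0 = 1) ?_)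
    fun s₂ f₂ h₂ => (Runs.forLoop_pow (c := 50) (a := 0) le_rfl hn
    (fun j s' => s'.nat vPow 0 = 2 ^ s'.nat vLog 0 ∧ s'.nat vPow 0 ≤ 2 * inp.numPoints ∧
      (inp.numPoints < s'.nat vPow 0 ∨ s'.nat vLog 0 = j))
    (fun _ _ => rfl) rfl ?_ ?_).post ?_) ?_
  · simp [NatExpr.eval]
  · simp [NatExpr.eval, h₁]
  · simp [h₂]
    omega
  · rintro j hj s' hf hz ⟨hP₁, hP₂, hP₃⟩
    refine Runs.mono (Runs.ite (fun hb => Runs.seq (Runs.setNat (Q := fun s'' =>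
      s'' = s'.writeNat vPow 0 (s'.nat vPow 0 + s'.nat vPow 0)) ?_) fun s₃ f₃ h₃ => Runs.setNat ?_)
      fun hb => Runs.skip ?_) ?_
    · simp [NatExpr.eval]
    · simp only [RamTest.Holds, NatExpr.eval] at hb
      subst h₃
      simp [NatExpr.eval, pow_succ]
      omega
    · simp only [RamTest.Holds, NatExpr.eval] at hb
      simp
      omega
    · simp [RamTest.time, NatExpr.time]
  · rintro s' - ⟨h₃, h₄, h₅⟩
    rw [← h₃]
    refine ⟨?_, h₄⟩
    rcases h₅ with h₅ | h₅
    · exact h₅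
    · rw [h₃, h₅]
      exact Nat.lt_two_pow_self
  · simp only [NatExpr.time, Nat.reduceAdd, pow_one]
    omega

theorem runs_countCands (hn : 1 ≤ inp.numPoints) :
    Runs inp coins (countCands c₁) s (100 * inp.numPoints) fun s' =>
      s'.nat vCands 0 = min inp.numPoints (c₁ * inp.budget * s.nat vLog 0) := by
  refine Runs.mono (Runs.seq (Runs.setNat (Q := fun s' => s'.nat vCands 0 = 0) ?_) fun s₁ f₁ h₁ =>
    Runs.forLoop_pow (c := 50) (a := 0) le_rfl hn
    (fun j s' => s'.nat vCands 0 = min j (c₁ * inp.budget * s.nat vLog 0))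
    (fun _ _ => rfl) rfl ?_ ?_) ?_
  · simp [NatExpr.eval]
  · simp [h₁]
  · intro j hj s' hf hz hP
    have hl : s'.nat vLog 0 = s.nat vLog 0 := by rw [hf.nat rfl, f₁.nat rfl]
    have hiff : (RamTest.realLe (.ofNat (.add (.var vX) (.const 1)))
          (.mul (.mul (.ofNat (.const c₁)) (.ofNat .budget)) (.ofNat (.var vLog)))).Holds inp s' ↔
        j + 1 ≤ c₁ * inp.budget * s.nat vLog 0 := by
      simp only [RamTest.Holds, RealExpr.eval, NatExpr.eval, hz, hl]
      norm_cast
    refine Runs.mono (Runs.ite (fun hb => Runs.setNat ?_) fun hb => Runs.skip ?_) ?_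
    · rw [hiff] at hb
      simp [NatExpr.eval, hP]
      omega
    · rw [hiff] at hb
      simp [hP]
      omega
    · simp [RamTest.time, NatExpr.time, RealExpr.time]
  · simp only [NatExpr.time, Nat.reduceAdd, pow_one]
    omega

theorem selection_subset (N : ℕ) (A B : ℕ → ℕ) (i : ℕ) :
    inp.selection typ N A B i ⊆ inp.facilitySet := by
  induction i with
  | zero => simp [selection]
  | succ i ih =>
    rw [selection, extend]
    refine union_subset ih fun x hx => ?_
    obtain ⟨h₁, h₂, -⟩ := (argmin_spec _ _ _).1 x (Option.mem_toFinset.1 hx)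
    exact mem_filter.2 ⟨mem_range.2 h₁, h₂.1⟩

theorem runs_search (hn : 1 ≤ inp.numPoints) (hF : ∀ x, inp.isFacility x ≤ 1)
    (hC : ∀ x, inp.isClient x ≤ 1) (hk : inp.budget ≤ inp.numPoints)
    (ht : ∀ x, s.nat aTyp x = typ x) {M T : ℕ} (hM : s.nat vCands 0 = M) (hT : s.nat vTypes 0 = T)
    (hM0 : 0 < M) (hT0 : 0 < T) (hMn : M ≤ inp.numPoints) (hh : s.nat vHave 0 = 0) :
    Runs inp coins (search c₁) s
      (13000 * (M ^ inp.budget * T ^ inp.budget * (inp.numGroups + 1)) * inp.numPoints ^ 5)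
      (StoresBest inp fun S => ∃ A B : ℕ → ℕ, (∀ i < inp.budget, A i < M) ∧
        (∀ i < inp.budget, B i < T) ∧
          S = inp.selection typ (c₁ * inp.budget) A B inp.budget) := by
  set k := inp.budget with hkdef
  set sel : ℕ → ℕ → Finset ℕ := fun z y => inp.selection typ (c₁ * k) (fun i => z / M ^ i % M)
    (fun i => y / T ^ i % T) k with hsel
  refine Runs.mono (Runs.post (Runs.enumerate (Q := M) (k := k) (by decide) (by decide) (by decide)
    rfl (fun z => StoresBest inp fun S => ∃ z' < z, ∃ y < T ^ k, S = sel z' y)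
    (fun s' hs' => ?_) (fun _ _ => rfl) hM0 (fun z s₁ s₂ h hf => h.frame hf rfl rfl rfl) ?_
    (T := (T ^ k + 1) * (2000 * inp.numPoints ^ 5 + 700 * inp.numPoints * (inp.numGroups + 1) +
      k * 43 + 41)) ?_) ?_) ?_
  · simp only [NatExpr.eval]
    rw [hs'.nat rfl, hM]
  · exact ⟨by omega, by simp⟩
  · intro z hz s' hf hdig hP
    refine Runs.mono (Runs.post (Runs.enumerate (Q := T) (k := k) (by decide) (by decide)
      (by decide) rfl (fun y => StoresBest inp fun S =>
        (∃ z' < z, ∃ y < T ^ k, S = sel z' y) ∨ ∃ y' < y, S = sel z y')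
      (fun s'' hs'' => ?_) (fun _ _ => rfl) hT0 (fun z s₁ s₂ h hf => h.frame hf rfl rfl rfl) ?_
      (T := 2000 * inp.numPoints ^ 5 + 700 * inp.numPoints * (inp.numGroups + 1)) ?_) ?_) ?_
    · simp only [NatExpr.eval]
      rw [hs''.nat rfl, hf.nat rfl, hT]
    · simpa using hP
    · intro y hy s'' hf' hdig' hP'
      have hlead : ∀ i < k, s''.nat aLead i = z / M ^ i % M := fun i hi => by
        rw [hf'.nat rfl, hdig i hi]
      refine Runs.seq (runs_select (typ := typ) hn hF hC hk (fun x => ?_) fun i hi => ?_)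
        fun s₃ f₃ h₃ => (runs_compare hn h₃ (selection_subset _ _ _ _)
          (hP'.frame f₃ rfl rfl rfl)).post fun s₄ _ h₄ => h₄.mono ?_
      · rw [hf'.nat rfl, hf.nat rfl, ht]
      · rw [hlead i hi]
        exact (Nat.mod_lt _ hM0).trans_le hMn
      · rintro S (hS | ⟨y', hy', rfl⟩)
        · exact Or.inl (Or.inl hS)
        · obtain rfl | hlt : y' = y ∨ y' < y := by omega
          · exact Or.inr (selection_congr (fun i hi => (hlead i hi).symm)
              fun i hi => (hdig' i hi).symm)
          · exact Or.inl (Or.inr ⟨y', hlt, rfl⟩)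
    · rintro s'' - h
      refine h.mono ?_
      rintro S ⟨z', hz', y, hy, rfl⟩
      obtain rfl | hlt : z' = z ∨ z' < z := by omega
      · exact Or.inr ⟨y, hy, rfl⟩
      · exact Or.inl ⟨z', hlt, y, hy, rfl⟩
    · refine Nat.mul_le_mul_left _ ?_
      simp only [NatExpr.time]
      omega
  · rintro s' - h
    refine h.mono ?_
    rintro S ⟨A, B, hA, hB, rfl⟩
    obtain ⟨z, hz, hzA⟩ := Nat.exists_digits_eq A k hA
    obtain ⟨y, hy, hyB⟩ := Nat.exists_digits_eq B k hB
    exact ⟨z, hz, y, hy, selection_congr (fun i hi => (hzA i hi).symm) fun i hi => (hyB i hi).symm⟩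
  · have h1 : 1 ≤ M ^ k := Nat.one_le_pow _ _ hM0
    have h2 : 1 ≤ T ^ k := Nat.one_le_pow _ _ hT0
    have h3 : inp.numPoints ≤ inp.numPoints ^ 5 := Nat.le_self_pow (by omega) _
    have h4 : 1 ≤ inp.numPoints ^ 5 := hn.trans h3
    simp only [NatExpr.time]
    generalize inp.numPoints ^ 5 = n₅ at *
    generalize inp.numPoints = n at *
    generalize inp.numGroups = t at *
    generalize M ^ k = m at *
    generalize T ^ k = τ at *
    have h5 : n₅ ≤ n₅ * (t + 1) := Nat.le_mul_of_pos_right _ (Nat.succ_pos t)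
    have h6 : n * (t + 1) ≤ n₅ * (t + 1) := Nat.mul_le_mul_right _ h3
    have h7 : 2000 * n₅ + 700 * n * (t + 1) + k * 43 + 41 ≤ 2784 * (n₅ * (t + 1)) := by
      rw [mul_assoc]
      omega
    set w := n₅ * (t + 1)
    have hτw : w ≤ τ * w := Nat.le_mul_of_pos_left _ h2
    have h8 : (τ + 1) * (2000 * n₅ + 700 * n * (t + 1) + k * 43 + 41) ≤ 5568 * (τ * w) := by
      refine (Nat.mul_le_mul_left _ h7).trans ?_
      rw [add_mul, one_mul, mul_left_comm]
      omega
    have h9 : (τ + 1) * (2000 * n₅ + 700 * n * (t + 1) + k * 43 + 41) + k * (2 + 1 + 40) + 1 + 40 ≤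
        5652 * (τ * w) := by
      omega
    have h10 : τ * w ≤ m * (τ * w) := Nat.le_mul_of_pos_left _ h1
    calc _ ≤ (m + 1) * (5652 * (τ * w)) := Nat.mul_le_mul_left _ (by omega)
      _ = 5652 * (m * (τ * w)) + 5652 * (τ * w) := by ring
      _ ≤ 13000 * (m * (τ * w)) := by omega
      _ = _ := by ring

/-- The facts on the input of the algorithm that do not depend on the numbers of points and
groups. -/
structure _root_.RamInput.IsValid (inp : RamInput) : Prop where
  one_le : 1 ≤ inp.budget
  le : inp.budget ≤ inp.numPoints
  isFacility_le : ∀ x, inp.isFacility x ≤ 1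
  isClient_le : ∀ x, inp.isClient x ≤ 1
  inGroup_le : ∀ x g, inp.inGroup x g ≤ 1
  facilitySet_nonempty : inp.facilitySet.Nonempty
  isMetric : inp.IsMetric

theorem good_of_map_eq {S O : Finset ℕ} (hS : S ⊆ inp.facilitySet) (hO : O ⊆ inp.facilitySet)
    (htyp : ∀ x ∈ inp.facilitySet, ∀ y ∈ inp.facilitySet, typ x = typ y → SameGroups inp x y)
    (h01 : ∀ x g, inp.inGroup x g ≤ 1)
    (h : S.val.map typ = O.val.map typ) (hG : Good inp O) : Good inp S := by
  classical
  refine ⟨?_, fun g hg => (hG.2 g hg).trans_eq ?_⟩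
  · have := congrArg Multiset.card h
    simp only [Multiset.card_map, card_val] at this
    exact this.trans hG.1
  · have key : ∀ S ⊆ inp.facilitySet, (∑ y ∈ range inp.numPoints,
        if y ∈ S then inp.inGroup y g else 0) = (S.val.map typ).countP fun τ =>
          ∃ x ∈ inp.facilitySet, typ x = τ ∧ inp.inGroup x g = 1 := fun S hS => by
      rw [← sum_filter, Multiset.countP_map, ← filter_val]
      change _ = #_
      have h₁ : {y ∈ range inp.numPoints | y ∈ S} = S := by
        ext y
        simp only [mem_filter, and_iff_right_iff_imp]
        exact fun hy => (mem_filter.1 (hS hy)).1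
      rw [h₁, card_filter]
      refine sum_congr rfl fun y hy => ?_
      have hle := h01 y g
      split_ifs with hx
      · obtain ⟨x, hx₁, hx₂, hx₃⟩ := hx
        rw [← hx₃, htyp x hx₁ y (hS hy) hx₂ g hg]
      · have : inp.inGroup y g ≠ 1 := fun h => hx ⟨y, hS hy, rfl, h⟩
        omega
    rw [key S hS, key O hO, h]

theorem runs_kMedian (hinp : inp.IsValid) {ε : ℝ} (hε : 0 < ε) (hε1 : ε ≤ 1)
    (hc₁ : 160 ≤ c₁ * ε ^ 2) :
    ∃ l T, 2 ^ l ≤ 2 * inp.numPoints ∧ T ≤ inp.numPoints ∧ T ≤ 2 ^ inp.numGroups ∧ 0 < T ∧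
      Runs inp coins (kMedian c₁) RamState.init
        (14000 * ((c₁ * inp.budget * l) ^ inp.budget * T ^ inp.budget * (inp.numGroups + 1)) *
          inp.numPoints ^ 5)
        fun s' => ∀ O ⊆ inp.facilitySet, Good inp O → ∃ S ⊆ inp.facilitySet, Good inp S ∧
          (∀ x < inp.numPoints, s'.nat aOut x = if x ∈ S then 1 else 0) ∧
          ∀ O ⊆ inp.facilitySet, Good inp O → inp.totalWeight S ≤ (3 + ε) * inp.totalWeight O := by
  have hn : 1 ≤ inp.numPoints := hinp.one_le.trans hinp.le
  have hc₁0 : 0 < c₁ := by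
    rcases Nat.eq_zero_or_pos c₁ with rfl | h₀
    · norm_num at hc₁
    · exact h₀
  obtain ⟨m₁, s₁, e₁, t₁, p₁⟩ :=
    runs_classify (coins := coins) (s := RamState.init) hn hinp.isFacility_le rfl
  obtain ⟨m₂, s₂, e₂, t₂, p₂, p₂'⟩ := runs_logarithm (coins := coins) (s := s₁) hn
  obtain ⟨m₃, s₃, e₃, t₃, p₃⟩ := runs_countCands (coins := coins) (c₁ := c₁) (s := s₂) hn
  have f₂ := e₂.frame
  have f₃ := e₃.frame
  have hl0 : 0 < s₂.nat vLog 0 := by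
    by_contra h
    rw [show s₂.nat vLog 0 = 0 by omega] at p₂
    omega
  set l := s₂.nat vLog 0 with hl
  set T := s₁.nat vTypes 0 with hT
  have hT₃ : s₃.nat vTypes 0 = T := by rw [f₃.nat rfl, f₂.nat rfl]
  have hmem : ∀ x ∈ inp.facilitySet, x < inp.numPoints ∧ inp.isFacility x = 1 := fun x hx => by
    simpa [facilitySet] using hx
  have htypT : ∀ x ∈ inp.facilitySet, s₁.nat aTyp x < T := fun x hx =>
    (p₁.typ x (hmem x hx).1 (hmem x hx).2).1
  have hT0 : 0 < T := by
    obtain ⟨x, hx⟩ := hinp.facilitySet_nonempty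
    have := htypT x hx
    omega
  have hM0 : 0 < min inp.numPoints (c₁ * inp.budget * l) :=
    lt_min hn (Nat.mul_pos (Nat.mul_pos hc₁0 hinp.one_le) hl0)
  obtain ⟨m₄, s₄, e₄, t₄, p₄⟩ := runs_search (coins := coins) (c₁ := c₁) (s := s₃)
    (typ := s₁.nat aTyp) hn hinp.isFacility_le hinp.isClient_le hinp.le
    (fun x => by rw [f₃.nat rfl, f₂.nat rfl]) p₃ hT₃ hM0 hT0 (min_le_left _ _)
    (by rw [f₃.nat rfl, f₂.nat rfl, e₁.frame.nat rfl]; rfl)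
  refine ⟨l, T, p₂', p₁.types_le, p₁.types_le_two_pow hinp.inGroup_le, hT0, _, s₄,
    .seq e₁ (.seq e₂ (.seq e₃ e₄)), ?_, ?_⟩
  · have h1 : min inp.numPoints (c₁ * inp.budget * l) ^ inp.budget ≤
        (c₁ * inp.budget * l) ^ inp.budget := Nat.pow_le_pow_left (min_le_right _ _) _
    have h2 : 1 ≤ (c₁ * inp.budget * l) ^ inp.budget := (Nat.one_le_pow _ _ hM0).trans h1
    have h3 : 1 ≤ T ^ inp.budget := Nat.one_le_pow _ _ hT0
    have h4 : inp.numPoints ≤ inp.numPoints ^ 5 := Nat.le_self_pow (by omega) _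
    have h5 : inp.numPoints ^ 2 ≤ inp.numPoints ^ 5 := Nat.pow_le_pow_right hn (by omega)
    have h6 := Nat.mul_le_mul_right (inp.numPoints ^ 5) (Nat.mul_le_mul_left 13000
      (Nat.mul_le_mul_right (inp.numGroups + 1) (Nat.mul_le_mul_right (T ^ inp.budget) h1)))
    have h7 : inp.numGroups + 1 ≤
        (c₁ * inp.budget * l) ^ inp.budget * T ^ inp.budget * (inp.numGroups + 1) :=
      Nat.le_mul_of_pos_left _ (Nat.mul_pos h2 h3)
    set w := (c₁ * inp.budget * l) ^ inp.budget * T ^ inp.budget * (inp.numGroups + 1)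
    have h8 : 300 * (inp.numGroups + 1) * inp.numPoints ^ 2 ≤ 300 * (w * inp.numPoints ^ 5) := by
      rw [mul_assoc]
      exact Nat.mul_le_mul_left _ (Nat.mul_le_mul h7 h5)
    have h9 : inp.numPoints ≤ w * inp.numPoints ^ 5 :=
      h4.trans (Nat.le_mul_of_pos_left _ (by omega))
    have h10 := t₄.trans h6
    rw [mul_assoc] at h10 ⊢
    omega
  · have hsol : ∀ O ⊆ inp.facilitySet, Good inp O → ∃ S ⊆ inp.facilitySet, Good inp S ∧
        inp.totalWeight S ≤ (3 + ε) * inp.totalWeight O ∧ ∃ A B : ℕ → ℕ,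
          (∀ i < inp.budget, A i < min inp.numPoints (c₁ * inp.budget * l)) ∧
          (∀ i < inp.budget, B i < T) ∧
          S = inp.selection (s₁.nat aTyp) (c₁ * inp.budget) A B inp.budget := by
      intro O hO hG
      have hne : O.Nonempty := card_pos.1 (hG.1 ▸ hinp.one_le)
      have hM : inp.numPoints ≤ min inp.numPoints (c₁ * inp.budget * l) ∨
          ∃ l', inp.numPoints < 2 ^ l' ∧
            c₁ * #O * l' ≤ min inp.numPoints (c₁ * inp.budget * l) := by
        rcases le_total inp.numPoints (c₁ * inp.budget * l) with h | h
        · exact Or.inl (le_min le_rfl h)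
        · refine Or.inr ⟨l, p₂, ?_⟩
          rw [hG.1]
          exact le_min h le_rfl
      obtain ⟨A, B, hA, hB, hS, hmap, hle⟩ :=
        hinp.isMetric.exists_selection hO hne hε hε1 hc₁ hM0 hM htypT
      rw [hG.1] at *
      refine ⟨_, hS, good_of_map_eq hS hO ?_ hinp.inGroup_le hmap hG, hle, A, B, hA, hB, rfl⟩
      intro x hx y hy hxy g hg
      have hx' := (p₁.typ x (hmem x hx).1 (hmem x hx).2).2 g hg
      have hy' := (p₁.typ y (hmem y hy).1 (hmem y hy).2).2 g hg
      rw [hx', hy', hxy]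
    intro O hO hG
    obtain ⟨S, -, hSG, -, hS⟩ := hsol O hO hG
    obtain ⟨R, hR, hRG, hRout, hRbest⟩ := p₄.exists_good (p₄.le S hS hSG).1
    refine ⟨R, hR, hRG, hRout, fun O hO hG => ?_⟩
    obtain ⟨S, -, hSG, hSle, hS⟩ := hsol O hO hG
    exact hRbest ▸ (p₄.le S hS hSG).2.trans hSle

end Specs

end RamProg

/-! ### Instances as inputs -/

namespace DivKMed

open Finset RamInput

variable {U : Type*} [Fintype U] {t : ℕ}

/-- The number of a point. -/
def number (label : U ≃ Fin (Fintype.card U)) : U ↪ ℕ :=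
  label.toEmbedding.trans Fin.valEmbedding

theorem number_lt (label : U ≃ Fin (Fintype.card U)) (x : U) : number label x < Fintype.card U :=
  (label x).isLt

theorem exists_number_eq (label : U ≃ Fin (Fintype.card U)) {i : ℕ} (hi : i < Fintype.card U) :
    ∃ x, number label x = i := ⟨label.symm ⟨i, hi⟩, by simp [number]⟩

theorem sum_range_card (label : U ≃ Fin (Fintype.card U)) {M : Type*} [AddCommMonoid M]
    (f : ℕ → M) : ∑ i ∈ range (Fintype.card U), f i = ∑ x : U, f (number label x) := by
  rw [Finset.sum_range, ← Equiv.sum_comp label]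
  rfl

variable [DecidableEq U] [MetricSpace U] (I : DivKMed U t) (label : U ≃ Fin (Fintype.card U))

theorem toInput_dist (x y : U) :
    (I.toInput label).dist (number label x) (number label y) = dist x y := by
  simp [toInput, number]

theorem toInput_isFacility (x : U) :
    (I.toInput label).isFacility (number label x) = if x ∈ I.facilities then 1 else 0 := by
  simp [toInput, number]

theorem toInput_isClient (x : U) :
    (I.toInput label).isClient (number label x) = if x ∈ I.clients then 1 else 0 := by
  simp [toInput, number]

theorem toInput_inGroup (x : U) (g : Fin t) :
    (I.toInput label).inGroup (number label x) g = if x ∈ I.group g then 1 else 0 := by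
  simp [toInput, number]

theorem mem_facilitySet (x : U) :
    number label x ∈ (I.toInput label).facilitySet ↔ x ∈ I.facilities := by
  rw [facilitySet, mem_filter, toInput_isFacility, mem_range]
  have : number label x < (I.toInput label).numPoints := number_lt label x
  simp [this]

theorem map_subset_facilitySet {S : Finset U} :
    S.map (number label) ⊆ (I.toInput label).facilitySet ↔ S ⊆ I.facilities := by
  refine ⟨fun h x hx => (I.mem_facilitySet label x).1 (h (mem_map_of_mem _ hx)), fun h i hi => ?_⟩
  obtain ⟨x, hx, rfl⟩ := mem_map.1 hi
  exact (I.mem_facilitySet label x).2 (h hx)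

theorem good_map {S : Finset U} : RamProg.Good (I.toInput label) (S.map (number label)) ↔
    S.card = I.k ∧ ∀ i, I.req i ≤ (S ∩ I.group i).card := by
  have key : ∀ g : Fin t, (∑ y ∈ range (I.toInput label).numPoints,
      if y ∈ S.map (number label) then (I.toInput label).inGroup y g else 0) =
        (S ∩ I.group g).card := fun g => by
    change ∑ y ∈ range (Fintype.card U), _ = _
    rw [sum_range_card label]
    simp only [mem_map', toInput_inGroup]
    rw [← sum_filter, ← card_filter]
    congr 1
    ext x
    simp
  rw [RamProg.Good, card_map]
  refine and_congr Iff.rfl ⟨fun h i => ?_, fun h g hg => ?_⟩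
  · have := h i i.isLt
    rw [key] at this
    simpa [toInput] using this
  · have := h ⟨g, hg⟩
    rw [← key ⟨g, hg⟩] at this
    simpa [toInput, show g < t from hg] using this

theorem totalWeight_map {S : Finset U} (hS : S.Nonempty) :
    (I.toInput label).totalWeight (S.map (number label)) = I.cost S := by
  have hd : ∀ x : U, (I.toInput label).distTo (number label x) (S.map (number label)) =
      Metric.infDist x (S : Set U) := fun x => by
    refine le_antisymm ((Metric.le_infDist (by simpa using hS)).2 fun y hy => ?_) ?_
    · rw [← I.toInput_dist label]
      exact distTo_le (mem_map_of_mem _ hy)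
    · obtain ⟨i, hi, e⟩ := (I.toInput label).exists_distTo_eq (number label x) (hS.map)
      obtain ⟨y, hy, rfl⟩ := mem_map.1 hi
      rw [e, toInput_dist]
      exact Metric.infDist_le_dist_of_mem hy
  change ∑ y ∈ range (Fintype.card U), _ = _
  rw [sum_range_card label, cost]
  simp only [RamInput.weight, toInput_isClient, hd]
  simp

theorem toInput_isValid : (I.toInput label).IsValid where
  one_le := I.k_pos
  le := I.k_le.trans (card_le_univ _)
  isFacility_le x := by
    simp only [toInput]
    split_ifs <;> simp
  isClient_le x := by
    simp only [toInput]
    split_ifs <;> simp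
  inGroup_le x g := by
    simp only [toInput]
    split_ifs <;> simp
  facilitySet_nonempty := by
    obtain ⟨x, hx⟩ := card_pos.1 (I.k_pos.trans I.k_le)
    exact ⟨_, (I.mem_facilitySet label x).2 hx⟩
  isMetric := by
    have h : ∀ i < (I.toInput label).numPoints, ∃ x, number label x = i := fun i hi =>
      exists_number_eq label hi
    refine ⟨fun i hi j hj => ?_, fun i hi => ?_, fun i hi j hj => ?_, fun i hi j hj l hl => ?_⟩
    · obtain ⟨x, rfl⟩ := h i hi
      obtain ⟨y, rfl⟩ := h j hj
      rw [toInput_dist]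
      exact dist_nonneg
    · obtain ⟨x, rfl⟩ := h i hi
      rw [toInput_dist, dist_self]
    · obtain ⟨x, rfl⟩ := h i hi
      obtain ⟨y, rfl⟩ := h j hj
      rw [toInput_dist, toInput_dist, dist_comm]
    · obtain ⟨x, rfl⟩ := h i hi
      obtain ⟨y, rfl⟩ := h j hj
      obtain ⟨z, rfl⟩ := h l hl
      rw [toInput_dist, toInput_dist, toInput_dist]
      exact dist_triangle x y z

theorem map_outputSet {s : RamState} {R : Finset ℕ} (hR : R ⊆ (I.toInput label).facilitySet)
    (hs : ∀ i < Fintype.card U, s.nat 0 i = if i ∈ R then 1 else 0) :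
    (outputSet label s).map (number label) = R := by
  have hmem : ∀ x, x ∈ outputSet label s ↔ number label x ∈ R := fun x => by
    have h := hs _ (number_lt label x)
    rw [outputSet, mem_filter]
    change _ ∧ s.nat 0 (number label x) = 1 ↔ _
    rw [h]
    simp
  ext i
  rw [mem_map]
  refine ⟨fun ⟨x, hx, hi⟩ => hi ▸ (hmem x).1 hx, fun hi => ?_⟩
  obtain ⟨x, rfl⟩ := exists_number_eq label (mem_range.1 (mem_filter.1 (hR hi)).1)
  exact ⟨x, (hmem x).2 hi, rfl⟩

theorem isApprox_outputSet {s : RamState} {α α' : ℝ} (hα : α' ≤ α)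
    (h : ∀ O ⊆ (I.toInput label).facilitySet, RamProg.Good (I.toInput label) O →
      ∃ S ⊆ (I.toInput label).facilitySet, RamProg.Good (I.toInput label) S ∧
        (∀ x < (I.toInput label).numPoints, s.nat 0 x = if x ∈ S then 1 else 0) ∧
        ∀ O ⊆ (I.toInput label).facilitySet, RamProg.Good (I.toInput label) O →
          (I.toInput label).totalWeight S ≤ α' * (I.toInput label).totalWeight O)
    (hI : ∃ S, I.Feasible S) : I.IsApprox α (outputSet label s) := by
  obtain ⟨O, hO₁, hO₂⟩ := hI
  obtain ⟨R, hRF, hRG, hRs, hRle⟩ := h (O.map (number label))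
    ((I.map_subset_facilitySet label).2 hO₁) ((I.good_map label).2 hO₂)
  have hout := I.map_outputSet label hRF hRs
  rw [← hout] at hRF hRG hRle
  rw [map_subset_facilitySet] at hRF
  rw [good_map] at hRG
  refine ⟨⟨hRF, hRG⟩, fun O' ⟨hO₁', hO₂'⟩ => ?_⟩
  have hne : ∀ S : Finset U, S.card = I.k → S.Nonempty := fun S hS =>
    card_pos.1 (hS ▸ I.k_pos)
  have hle := hRle (O'.map (number label)) ((I.map_subset_facilitySet label).2 hO₁')
    ((I.good_map label).2 hO₂')
  rw [totalWeight_map _ _ (hne _ hRG.1), totalWeight_map _ _ (hne _ hO₂'.1)] at hle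
  exact hle.trans (mul_le_mul_of_nonneg_right hα (sum_nonneg fun _ _ => Metric.infDist_nonneg))

end DivKMed

/-! ### The running time -/

theorem half_le_log_pow {k : ℕ} (hk : 1 ≤ k) : (1 / 2 : ℝ) ≤ Real.log (k + 1) ^ k := by
  obtain rfl | hk : k = 1 ∨ 2 ≤ k := by omega
  · have := Real.log_two_gt_d9
    norm_num
    linarith
  · have h : (1 : ℝ) ≤ Real.log (k + 1) := by
      rw [Real.le_log_iff_exp_le (by positivity)]
      have h₁ := Real.exp_one_lt_d9
      have h₂ : (2 : ℝ) ≤ k := by exact_mod_cast hk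
      linarith
    linarith [one_le_pow₀ h (n := k)]

theorem mul_log_pow_le {k l n : ℕ} (hl : 2 ^ l ≤ 2 * n) :
    (161 * l : ℝ) ^ k ≤ (k : ℝ) ^ k * (2 * n) ^ 322 := by
  have h₁ : (161 * l : ℝ) ^ k ≤ k.factorial * Real.exp (161 * l) := by
    have := Real.pow_div_factorial_le_exp (161 * l : ℝ) (by positivity) k
    rwa [div_le_iff₀' (by positivity)] at this
  have h₂ : Real.exp (161 * l) ≤ (2 * n) ^ 322 := by
    have h₃ : Real.exp 1 ≤ 2 ^ 2 := by
      have := Real.exp_one_lt_d9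
      norm_num
      linarith
    have h₄ : (2 : ℝ) ^ l ≤ 2 * n := by exact_mod_cast hl
    calc Real.exp (161 * l) = Real.exp 1 ^ (161 * l) := by
          rw [← Real.exp_nat_mul]
          push_cast
          rw [mul_one]
      _ ≤ (2 ^ 2) ^ (161 * l) := pow_le_pow_left₀ (Real.exp_pos _).le h₃ _
      _ = (2 ^ l) ^ 322 := by
          rw [← pow_mul, ← pow_mul]
          congr 1
          ring
      _ ≤ (2 * n) ^ 322 := pow_le_pow_left₀ (by positivity) h₄ _
  refine h₁.trans (mul_le_mul ?_ h₂ (Real.exp_pos _).le (by positivity))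
  exact_mod_cast Nat.factorial_le_pow k

theorem types_pow_mul_le {k t n T : ℕ} (hk : 1 ≤ k) (hTn : T ≤ n) (hT : T ≤ 2 ^ t) :
    T ^ k * (t + 1) ≤ n * (2 ^ t) ^ k := by
  obtain ⟨k, rfl⟩ := Nat.exists_eq_add_of_le' hk
  have ht : t + 1 ≤ 2 ^ t := Nat.lt_two_pow_self
  calc T ^ (k + 1) * (t + 1) = T * (T ^ k * (t + 1)) := by ring
    _ ≤ n * ((2 ^ t) ^ k * 2 ^ t) :=
      Nat.mul_le_mul hTn (Nat.mul_le_mul (Nat.pow_le_pow_left hT k) ht)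
    _ = n * (2 ^ t) ^ (k + 1) := by ring

theorem time_bound {k l n t T c₁ : ℕ} {E : ℝ} (hE : 0 ≤ E) (hk : 1 ≤ k) (hl : 2 ^ l ≤ 2 * n)
    (hTn : T ≤ n) (hT : T ≤ 2 ^ t) (hc₁ : (c₁ : ℝ) ≤ 161 * E) :
    ((14000 * ((c₁ * k * l) ^ k * T ^ k * (t + 1)) * n ^ 5 : ℕ) : ℝ) ≤
      28000 * 2 ^ 322 * ((2 : ℝ) ^ t * E * (k : ℝ) ^ 2 * Real.log (k + 1)) ^ k * (n : ℝ) ^ 328 := by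
  have h₁ : ((c₁ : ℝ) * k * l) ^ k ≤ E ^ k * k ^ k * (k ^ k * (2 * n) ^ 322) := by
    calc ((c₁ : ℝ) * k * l) ^ k ≤ (161 * E * k * l) ^ k := by gcongr
      _ = E ^ k * k ^ k * (161 * l) ^ k := by ring
      _ ≤ _ := mul_le_mul_of_nonneg_left (mul_log_pow_le hl) (by positivity)
  have h₂ : (T : ℝ) ^ k * (t + 1) ≤ n * (2 ^ t) ^ k := by
    exact_mod_cast types_pow_mul_le hk hTn hT
  have h₃ := half_le_log_pow hk
  push_cast
  calc 14000 * (((c₁ : ℝ) * k * l) ^ k * T ^ k * (t + 1)) * n ^ 5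
      = 14000 * (((c₁ : ℝ) * k * l) ^ k * (T ^ k * (t + 1))) * n ^ 5 := by ring
    _ ≤ 14000 * (E ^ k * k ^ k * (k ^ k * (2 * n) ^ 322) * (n * (2 ^ t) ^ k)) * n ^ 5 := by
      gcongr
    _ = 28000 * 2 ^ 322 * (((2 : ℝ) ^ t * E * k ^ 2) ^ k * (1 / 2)) * n ^ 328 := by
      rw [mul_pow 2 (n : ℝ), mul_pow, mul_pow, ← pow_mul (k : ℝ), mul_comm 2 k, pow_mul]
      generalize (2 : ℝ) ^ 322 = a
      ring
    _ ≤ 28000 * 2 ^ 322 * (((2 : ℝ) ^ t * E * k ^ 2) ^ k * Real.log (k + 1) ^ k) * n ^ 328 := by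
      gcongr
    _ = _ := by rw [mul_pow _ (Real.log _)]

instance : MeasureTheory.IsProbabilityMeasure coinMeasure := by
  unfold coinMeasure
  infer_instance

theorem mainTheorem2 :
    ∃ (A : ℝ) (B : ℕ), ∀ ε : ℝ, 0 < ε → ∃ p : RamProg,
      ∀ (U : Type*) [DecidableEq U] [Fintype U] [MetricSpace U] (t : ℕ) (I : DivKMed U t)
        (label : U ≃ Fin (Fintype.card U)),
        RunsInTime p (I.toInput label)
          (A * ((2 : ℝ) ^ t * max 1 ((ε ^ 2)⁻¹) * (I.k : ℝ) ^ 2 * Real.log (I.k + 1)) ^ I.k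
            * (Fintype.card U : ℝ) ^ B) ∧
        ((∃ S, I.Feasible S) → 2 / 3 ≤ successProb p I label (3 + ε)) := by
  refine ⟨28000 * 2 ^ 322, 328, fun ε hε => ?_⟩
  set δ := min ε 1 with hδ
  have hδ0 : 0 < δ := lt_min hε one_pos
  have hδ1 : δ ≤ 1 := min_le_right _ _
  have hE : (δ ^ 2)⁻¹ = max 1 ((ε ^ 2)⁻¹) := by
    rcases le_total ε 1 with h | h
    · rw [hδ, min_eq_left h, max_eq_right]
      exact (one_le_inv₀ (by positivity)).2 (pow_le_one₀ hε.le h)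
    · rw [hδ, min_eq_right h, max_eq_left (inv_le_one_of_one_le₀ (one_le_pow₀ h))]
      norm_num
  set c₁ := ⌈160 * (δ ^ 2)⁻¹⌉₊ with hc
  have hc₁ : 160 ≤ c₁ * δ ^ 2 := by
    have := Nat.le_ceil (160 * (δ ^ 2)⁻¹)
    rwa [← div_eq_mul_inv, div_le_iff₀ (by positivity), div_eq_mul_inv, ← hc] at this
  have hc₁' : (c₁ : ℝ) ≤ 161 * max 1 ((ε ^ 2)⁻¹) := by
    have h₁ := Nat.ceil_lt_add_one (show 0 ≤ 160 * (δ ^ 2)⁻¹ by positivity)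
    rw [← hc, hE] at h₁
    linarith [le_max_left 1 ((ε ^ 2)⁻¹)]
  refine ⟨RamProg.kMedian c₁, fun U _ _ _ t I label => ⟨fun coins => ?_, fun hI => ?_⟩⟩
  · obtain ⟨l, T, hl, hTn, hT, -, m, s, e, hm, -⟩ :=
      RamProg.runs_kMedian (coins := coins) (I.toInput_isValid label) hδ0 hδ1 hc₁
    refine ⟨m, s, e, (Nat.cast_le.2 hm).trans ?_⟩
    exact time_bound (by positivity) I.k_pos hl hTn hT hc₁'
  · have huniv : {coins | ∃ (n : ℕ) (s : RamState),
        RamExec (I.toInput label) coins (RamProg.kMedian c₁) RamState.init n s ∧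
          I.IsApprox (3 + ε) (outputSet label s)} = Set.univ := by
      refine Set.eq_univ_of_forall fun coins => ?_
      obtain ⟨l, T, -, -, -, -, m, s, e, -, h⟩ :=
        RamProg.runs_kMedian (coins := coins) (I.toInput_isValid label) hδ0 hδ1 hc₁
      exact ⟨m, s, e, I.isApprox_outputSet label (by linarith [min_le_left ε 1]) h hI⟩
    rw [successProb, huniv, MeasureTheory.measure_univ]
    exact ENNReal.div_le_of_le_mul (by norm_num)
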